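/- Let $K=\mathrm{SO}(m)$ with $m\ge 5$ or $K=\mathrm{SU}(m)$ with $m\ge 3$, with Lie algebra $\mathfrak k$, and let $h$ be a bi-invariant Riemannian metric on $K$. Let $H$ be a two-dimensional torus (compact connected abelian Lie group) with Lie algebra $\mathfrak h$, equipped with an invariant Riemannian metric, and let $\langle\cdot,\cdot\rangle$ be the induced scalar product on $\mathfrak h$. For a Lie group $N$ with Riemannian metric $\nu$ and a linear map $\lambda:T_eN\to\mathfrak h$, regarded as a left invariant $\mathfrak h$-valued $1$-form on $N$, let $g_\lambda$ be the metric on $N\times H$ given by $$g_\lambda\big((X,Z),(X',Z')\big)=\nu(X,X')+\langle\lambda(X)+Z,\ \lambda(X')+Z'\rangle ,$$ where tangent vectors of $H$ are identified with elements of $\mathfrak h$ by left translation. Let $\lambda,\lambda':\mathfrak k\to\mathfrak h$ be linear maps such that for each $Z\in\mathfrak h$ there is $a_Z\in K$ with $\langle\lambda'(X),Z\rangle=\langle\lambda(\mathrm{Ad}_{a_Z}X),Z\rangle$ for all $X\in\mathfrak k$. Let $g_\lambda,g_{\lambda'}$ be the associated metrics on $K\times H$ (with $\nu=h$), and assume that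 $\|\mathrm{Ric}^{g_\lambda}\|^2\ne\|\mathrm{Ric}^{g_{\lambda'}}\|^2$ (both are constant functions). Let $\bar\lambda:\mathfrak k\oplus\mathfrak k\to\mathfrak h$, $\bar\lambda(X,Y)=\lambda(X)+\lambda'(Y)$, and let $g_{\bar\lambda}$ be the associated metric on $K\times K\times H$ (with $\nu$ the product metric $h\times h$ on $N=K\times K$). Let $0<\varepsilon<1/8$, let $\varphi(x)=e^{2\varepsilon\,\mathrm{Re}(\mathrm{tr}\,x)/m}$ for $x\in K$, and put $\tilde\varphi_1(x,y,z)=\varphi(x)$, $\tilde\varphi_2(x,y,z)=\varphi(y)$ on $K\times K\times H$. Then the conformally equivalent metrics $\tilde\varphi_1g_{\bar\lambda}$ and $\tilde\varphi_2g_{\bar\lambda}$ on $K\times K\times H$ are not locally isometric: for neither of the two metrics does every point have an open neighbourhood isometric to an open subset of $K\times K\times H$ with the other metric. More precisely, the set of points in which the scalar curvature of $\tilde\varphi_1g_{\bar\lambda}$ (respectively $\tilde\varphi_2g_{\bar\lambda}$) attains its maximum is an embedded submanifold of $K\times K\times H$ which, with the induced metric, is isometric to $(K\times H,e^{2\varepsilon}g_{\lambda'})$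 (respectively $(K\times H,e^{2\varepsilon}g_\lambda)$), and the Ricci tensors of these two manifolds have different (constant) norms. -/

import Mathlib

open scoped Manifold ContDiff Topology Matrix
open Set

set_option maxSynthPendingDepth 3

noncomputable section
namespace IsoConf

section LieGroup

attribute [local instance] Matrix.linftyOpNormedRing Matrix.linftyOpNormedAlgebra

variable (m : ℕ) (𝕜 : Type*) [RCLike 𝕜]

/-- The skew-Hermitian traceless matrices, as a real vector space. -/
def skewSubmodule : Submodule ℝ (Matrix (Fin m) (Fin m) 𝕜) where
  carrier := {X | Xᴴ = -X ∧ X.trace = 0}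
  add_mem' := by
    rintro X Y ⟨hX, hX'⟩ ⟨hY, hY'⟩
    exact ⟨by rw [Matrix.conjTranspose_add, hX, hY, neg_add], by rw [Matrix.trace_add, hX', hY', add_zero]⟩
  zero_mem' := by simp
  smul_mem' := by
    rintro c X ⟨hX, hX'⟩
    exact ⟨by rw [Matrix.conjTranspose_smul, hX, star_trivial, smul_neg], by rw [Matrix.trace_smul, hX', smul_zero]⟩

/-- The skew-Hermitian traceless matrices: the model space of the special unitary group. -/
def SkewLie : Type _ := skewSubmodule m 𝕜

instance : NormedAddCommGroup (SkewLie m 𝕜) := inferInstanceAs (NormedAddCommGroup (skewSubmodule m 𝕜))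
instance : NormedSpace ℝ (SkewLie m 𝕜) := inferInstanceAs (NormedSpace ℝ (skewSubmodule m 𝕜))
instance : FiniteDimensional ℝ (Matrix (Fin m) (Fin m) 𝕜) := 
  Module.Finite.trans 𝕜 _
instance : FiniteDimensional ℝ (SkewLie m 𝕜) := inferInstanceAs (FiniteDimensional ℝ (skewSubmodule m 𝕜))

variable {m 𝕜}

theorem differentiable_det : Differentiable 𝕜 (fun A : Matrix (Fin m) (Fin m) 𝕜 => A.det) := by
  have hcoord : ∀ i j, Differentiable 𝕜 (fun A : Matrix (Fin m) (Fin m) 𝕜 => A i j) := fun i j =>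
    (LinearMap.toContinuousLinearMap (Matrix.entryLinearMap 𝕜 𝕜 i j)).differentiable
  simp only [Matrix.det_apply']
  fun_prop

theorem hasDerivAt_det_exp_zero (X : Matrix (Fin m) (Fin m) 𝕜) :
    HasDerivAt (fun s : 𝕜 => (NormedSpace.exp (s • X)).det) X.trace 0 := by
  have hd := (differentiable_det (m := m) (𝕜 := 𝕜) 1).hasFDerivAt
  have h1 : HasDerivAt (fun s : 𝕜 => (NormedSpace.exp (s • X)).det)
      (fderiv 𝕜 (fun A : Matrix (Fin m) (Fin m) 𝕜 => A.det) 1 X) 0 := by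
    have he := hasDerivAt_exp_smul_const (𝕂 := 𝕜) X (0 : 𝕜)
    rw [zero_smul, NormedSpace.exp_zero, one_mul] at he
    have hd' : HasFDerivAt (fun A : Matrix (Fin m) (Fin m) 𝕜 => A.det)
        (fderiv 𝕜 (fun A : Matrix (Fin m) (Fin m) 𝕜 => A.det) 1)
        (NormedSpace.exp ((0 : 𝕜) • X)) := by
      rw [zero_smul, NormedSpace.exp_zero]; exact hd
    exact hd'.comp_hasDerivAt (0 : 𝕜) he
  have h2 : HasDerivAt (fun s : 𝕜 => (1 + s • X).det)
      (fderiv 𝕜 (fun A : Matrix (Fin m) (Fin m) 𝕜 => A.det) 1 X) 0 := by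
    have he : HasDerivAt (fun s : 𝕜 => 1 + s • X) X 0 := by
      have := ((hasDerivAt_id (0 : 𝕜)).smul_const X).const_add 1
      rw [one_smul] at this
      exact this
    have hd' : HasFDerivAt (fun A : Matrix (Fin m) (Fin m) 𝕜 => A.det)
        (fderiv 𝕜 (fun A : Matrix (Fin m) (Fin m) 𝕜 => A.det) 1) (1 + (0 : 𝕜) • X) := by
      rw [zero_smul, add_zero]; exact hd
    exact hd'.comp_hasDerivAt (0 : 𝕜) he
  have h3 : HasDerivAt (fun s : 𝕜 => (1 + s • X).det) X.trace 0 := by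
    have hfun := funext fun s : 𝕜 => Matrix.det_one_add_smul s X
    rw [hfun]
    generalize (1 + (Polynomial.X : Polynomial 𝕜) • X.map Polynomial.C).det.divX.divX = p
    have := (((hasDerivAt_id (0 : 𝕜)).const_mul X.trace).const_add 1).add
      ((p.hasDerivAt 0).mul ((hasDerivAt_id (0 : 𝕜)).pow 2))
    refine (this.congr_deriv ?_)
    simp
  rwa [h2.unique h3] at h1

theorem det_exp (X : Matrix (Fin m) (Fin m) 𝕜) :
    (NormedSpace.exp X).det = NormedSpace.exp X.trace := by
  have hderiv : ∀ t : 𝕜, HasDerivAt (fun s : 𝕜 => (NormedSpace.exp (s • X)).det)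
      ((NormedSpace.exp (t • X)).det * X.trace) t := by
    intro t
    have h0 : HasDerivAt (fun s : 𝕜 => (NormedSpace.exp (s • X)).det) X.trace (t - t) := by
      rw [sub_self]; exact hasDerivAt_det_exp_zero X
    have h1 := (h0.comp_sub_const t t).const_mul (NormedSpace.exp (t • X)).det
    have hfun : (fun s : 𝕜 => (NormedSpace.exp (s • X)).det) = fun s =>
        (NormedSpace.exp (t • X)).det * (NormedSpace.exp ((s - t) • X)).det := by
      ext s
      rw [← Matrix.det_mul, ← Matrix.exp_add_of_commute _ _
        (((Commute.refl X).smul_left _).smul_right _), ← add_smul, add_sub_cancel]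
    rw [hfun]
    exact h1
  have hconst : ∀ t : 𝕜, HasDerivAt
      (fun s : 𝕜 => (NormedSpace.exp (s • X)).det * NormedSpace.exp (s • (-X.trace))) 0 t := by
    intro t
    have := (hderiv t).mul (hasDerivAt_exp_smul_const (𝕂 := 𝕜) (-X.trace) t)
    refine this.congr_deriv ?_
    ring
  have hc := is_const_of_deriv_eq_zero (fun t => (hconst t).differentiableAt)
    (fun t => (hconst t).deriv) 1 0
  simp only [one_smul, zero_smul, NormedSpace.exp_zero, Matrix.det_one, mul_one] at hc
  have h2 : NormedSpace.exp (-X.trace) * NormedSpace.exp X.trace = 1 := by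
    rw [← NormedSpace.exp_add_of_commute ((Commute.refl _).neg_left)]
    simp
  calc (NormedSpace.exp X).det
      = (NormedSpace.exp X).det * (NormedSpace.exp (-X.trace) * NormedSpace.exp X.trace) := by
        rw [h2, mul_one]
    _ = NormedSpace.exp X.trace := by rw [← mul_assoc, hc, one_mul]

theorem exp_mem_specialUnitaryGroup {X : Matrix (Fin m) (Fin m) 𝕜} (hX : X ∈ skewSubmodule m 𝕜) :
    NormedSpace.exp X ∈ Matrix.specialUnitaryGroup (Fin m) 𝕜 := by
  rw [Matrix.mem_specialUnitaryGroup_iff, Matrix.mem_unitaryGroup_iff]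
  refine ⟨?_, ?_⟩
  · rw [Matrix.star_eq_conjTranspose, ← Matrix.exp_conjTranspose, hX.1,
      ← Matrix.exp_add_of_commute _ _ ((Commute.refl X).neg_right), add_neg_cancel,
      NormedSpace.exp_zero]
  · rw [det_exp, hX.2, NormedSpace.exp_zero]

variable (m 𝕜) in
/-- The matrix exponential has a real-analytic local inverse `L` between neighbourhoods `U` of `1`
and `V` of `0`, which maps special unitary matrices to skew-Hermitian traceless ones. -/
theorem exists_log : ∃ (U V : Set (Matrix (Fin m) (Fin m) 𝕜))
    (L : Matrix (Fin m) (Fin m) 𝕜 → Matrix (Fin m) (Fin m) 𝕜),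
    IsOpen U ∧ IsOpen V ∧ 1 ∈ U ∧ 0 ∈ V ∧
    (∀ X ∈ V, NormedSpace.exp X ∈ U ∧ L (NormedSpace.exp X) = X) ∧
    (∀ B ∈ U, L B ∈ V ∧ NormedSpace.exp (L B) = B) ∧ ContDiffOn ℝ ω L U ∧
    ∀ B ∈ U, B ∈ Matrix.specialUnitaryGroup (Fin m) 𝕜 → L B ∈ skewSubmodule m 𝕜 := by
  have hs : HasStrictFDerivAt (NormedSpace.exp : Matrix (Fin m) (Fin m) 𝕜 → _)
      ((ContinuousLinearEquiv.refl ℝ (Matrix (Fin m) (Fin m) 𝕜) :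
        Matrix (Fin m) (Fin m) 𝕜 →L[ℝ] Matrix (Fin m) (Fin m) 𝕜)) 0 :=
    hasStrictFDerivAt_exp_zero (𝕂 := ℝ)
  have ht : HasStrictFDerivAt (NormedSpace.exp : 𝕜 → 𝕜)
      ((ContinuousLinearEquiv.refl ℝ 𝕜 : 𝕜 →L[ℝ] 𝕜)) 0 :=
    hasStrictFDerivAt_exp_zero (𝕂 := ℝ)
  set e := hs.toOpenPartialHomeomorph NormedSpace.exp with he
  set f := ht.toOpenPartialHomeomorph NormedSpace.exp with hf
  have hcoe : ∀ X, e X = NormedSpace.exp X := fun X => rfl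
  have hfcoe : ∀ X, f X = NormedSpace.exp X := fun X => rfl
  have h0 : (0 : Matrix (Fin m) (Fin m) 𝕜) ∈ e.source := hs.mem_toOpenPartialHomeomorph_source
  have h0' : (0 : 𝕜) ∈ f.source := ht.mem_toOpenPartialHomeomorph_source
  have h1 : e 0 = 1 := NormedSpace.exp_zero
  have hsm : ContDiffAt ℝ ω e.symm 1 := by
    have h2 : e.symm 1 = 0 := by rw [← h1, e.left_inv h0]
    have h1t : (1 : Matrix (Fin m) (Fin m) 𝕜) ∈ e.target := h1 ▸ e.map_source h0
    refine e.contDiffAt_symm (f₀' := ContinuousLinearEquiv.refl ℝ _) h1t ?_ ?_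
    · rw [h2]; exact hs.hasFDerivAt
    · rw [h2]; exact (NormedSpace.exp_analytic (𝕂 := ℝ) (0 : Matrix (Fin m) (Fin m) 𝕜)).contDiffAt
  obtain ⟨W, hW, hWo, h1W⟩ := eventually_nhds_iff.1 (hsm.eventually (by simp))
  have hneg : Continuous fun X : Matrix (Fin m) (Fin m) 𝕜 => -Xᴴ :=
    (continuous_id.matrix_conjTranspose).neg
  have htr : Continuous fun X : Matrix (Fin m) (Fin m) 𝕜 => X.trace := continuous_id.matrix_trace
  have hexp : Continuous (NormedSpace.exp : Matrix (Fin m) (Fin m) 𝕜 → _) :=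
    NormedSpace.exp_continuous
  set V : Set (Matrix (Fin m) (Fin m) 𝕜) := e.source ∩ ((fun X => -Xᴴ) ⁻¹' e.source ∩
    ((fun X => X.trace) ⁻¹' f.source ∩ NormedSpace.exp ⁻¹' W)) with hV
  have hVo : IsOpen V := e.open_source.inter ((e.open_source.preimage hneg).inter
    ((f.open_source.preimage htr).inter (hWo.preimage hexp)))
  have h0V : (0 : Matrix (Fin m) (Fin m) 𝕜) ∈ V := by
    refine ⟨h0, ?_, ?_, ?_⟩
    · simpa using h0
    · simpa using h0'
    · simpa [NormedSpace.exp_zero] using h1W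
  have hUo : IsOpen (e.target ∩ e.symm ⁻¹' V) := e.isOpen_inter_preimage_symm hVo
  refine ⟨e.target ∩ e.symm ⁻¹' V, V, e.symm, hUo, hVo, ?_, h0V, ?_, ?_, ?_, ?_⟩
  · rw [← h1]
    refine ⟨e.map_source h0, ?_⟩
    rw [mem_preimage, e.left_inv h0]; exact h0V
  · intro X hX
    rw [← hcoe X]
    refine ⟨⟨e.map_source hX.1, ?_⟩, e.left_inv hX.1⟩
    rw [mem_preimage, e.left_inv hX.1]; exact hX
  · intro B hB
    exact ⟨hB.2, e.right_inv hB.1⟩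
  · intro B hB
    refine (hW B ?_).contDiffWithinAt
    have : NormedSpace.exp (e.symm B) = B := e.right_inv hB.1
    rw [← this]
    exact hB.2.2.2.2
  · intro B hB hBK
    obtain ⟨hBu, hBd⟩ := Matrix.mem_specialUnitaryGroup_iff.1 hBK
    have hE : NormedSpace.exp (e.symm B) = B := e.right_inv hB.1
    have hs1 : e.symm B ∈ e.source := hB.2.1
    have hs2 : -(e.symm B)ᴴ ∈ e.source := hB.2.2.1
    have hs3 : (e.symm B).trace ∈ f.source := hB.2.2.2.1
    constructor
    · have : e (-(e.symm B)ᴴ) = e (e.symm B) := by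
        rw [hcoe, hcoe, hE, Matrix.exp_neg, Matrix.exp_conjTranspose, hE]
        apply Matrix.inv_eq_left_inv
        rw [← Matrix.star_eq_conjTranspose]
        exact Matrix.mem_unitaryGroup_iff.1 hBu
      have := e.injOn hs2 hs1 this
      rw [neg_eq_iff_eq_neg] at this
      exact this
    · have : f (e.symm B).trace = f 0 := by
        rw [hfcoe, hfcoe, ← det_exp, hE, hBd, NormedSpace.exp_zero]
      exact f.injOn hs3 h0' this

variable (m 𝕜) in
/-- Exponential coordinates around the identity of the special unitary group. -/
theorem exists_logChart :
    ∃ φ : OpenPartialHomeomorph (Matrix.specialUnitaryGroup (Fin m) 𝕜) (SkewLie m 𝕜),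
      1 ∈ φ.source ∧ 0 ∈ φ.target ∧
      (∀ X, (φ.symm X : Matrix (Fin m) (Fin m) 𝕜) = NormedSpace.exp X.1) ∧
      ∃ (U : Set (Matrix (Fin m) (Fin m) 𝕜)) (L : Matrix (Fin m) (Fin m) 𝕜 → SkewLie m 𝕜),
        IsOpen U ∧ ContDiffOn ℝ ω L U ∧ ∀ B ∈ φ.source, B.1 ∈ U ∧ φ B = L B.1 := by
  obtain ⟨U, V, L, hU, hV, h1, h0, hVU, hUV, hL, hmem⟩ := exists_log m 𝕜
  obtain ⟨P, hP⟩ := LinearMap.exists_leftInverse_of_injective (skewSubmodule m 𝕜).subtype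
    (by simp)
  have hP' : ∀ X : SkewLie m 𝕜, P X.1 = X := fun X => LinearMap.congr_fun hP X
  let Pc : Matrix (Fin m) (Fin m) 𝕜 →L[ℝ] SkewLie m 𝕜 :=
    LinearMap.toContinuousLinearMap (F' := SkewLie m 𝕜) P
  have hPc : ∀ X : SkewLie m 𝕜, Pc X.1 = X := hP'
  have hPm : ∀ B ∈ U, B ∈ Matrix.specialUnitaryGroup (Fin m) 𝕜 → (Pc (L B)).1 = L B := by
    intro B hB hBK
    exact congrArg Subtype.val (hPc ⟨L B, hmem B hB hBK⟩)
  have hsub : Continuous (fun X : SkewLie m 𝕜 => (X.1 : Matrix (Fin m) (Fin m) 𝕜)) :=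
    continuous_subtype_val (p := fun X => X ∈ skewSubmodule m 𝕜)
  have hexp : Continuous (NormedSpace.exp : Matrix (Fin m) (Fin m) 𝕜 → _) :=
    NormedSpace.exp_continuous
  let φ : OpenPartialHomeomorph (Matrix.specialUnitaryGroup (Fin m) 𝕜) (SkewLie m 𝕜) :=
    { toFun := fun B => Pc (L B.1)
      invFun := fun X => ⟨NormedSpace.exp X.1, exp_mem_specialUnitaryGroup X.2⟩
      source := Subtype.val ⁻¹' U
      target := (fun X : SkewLie m 𝕜 => X.1) ⁻¹' V
      map_source' := by
        intro B hB
        show (Pc (L B.1)).1 ∈ V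
        rw [hPm B.1 hB B.2]
        exact (hUV B.1 hB).1
      map_target' := by
        intro X hX
        exact (hVU X.1 hX).1
      left_inv' := by
        intro B hB
        apply Subtype.ext
        show NormedSpace.exp (Pc (L B.1)).1 = B.1
        rw [hPm B.1 hB B.2]
        exact (hUV B.1 hB).2
      right_inv' := by
        intro X hX
        show Pc (L (NormedSpace.exp X.1)) = X
        rw [(hVU X.1 hX).2]
        exact hPc X
      open_source := hU.preimage continuous_subtype_val
      open_target := hV.preimage hsub
      continuousOn_toFun := Pc.continuous.comp_continuousOn
        (hL.continuousOn.comp continuous_subtype_val.continuousOn fun B hB => hB)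
      continuousOn_invFun := ((hexp.comp hsub).subtype_mk _).continuousOn }
  exact ⟨φ, h1, h0, fun X => rfl, U, fun B => Pc (L B), hU, Pc.contDiff.comp_contDiffOn hL,
    fun B hB => ⟨hB, rfl⟩⟩

variable (m 𝕜) in
/-- A chart around `1` whose inverse is the matrix exponential. -/
def logChart : OpenPartialHomeomorph (Matrix.specialUnitaryGroup (Fin m) 𝕜) (SkewLie m 𝕜) :=
  (exists_logChart m 𝕜).choose

/-- The smooth structure: the chart around `A` is the inverse of `X ↦ A * exp X`. -/
instance : ChartedSpace (SkewLie m 𝕜) (Matrix.specialUnitaryGroup (Fin m) 𝕜) where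
  atlas := {φ | ∃ A : Matrix.specialUnitaryGroup (Fin m) 𝕜,
    φ = (Homeomorph.mulLeft A⁻¹).transOpenPartialHomeomorph (logChart m 𝕜)}
  chartAt A := (Homeomorph.mulLeft A⁻¹).transOpenPartialHomeomorph (logChart m 𝕜)
  mem_chart_source A := by
    have := (exists_logChart m 𝕜).choose_spec.1
    simpa [logChart] using this
  chart_mem_atlas A := ⟨A, rfl⟩

theorem contDiff_exp_skew :
    ContDiff ℝ ω (fun X : SkewLie m 𝕜 => (NormedSpace.exp X.1 : Matrix (Fin m) (Fin m) 𝕜)) := by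
  have h1 : ContDiff ℝ ω (NormedSpace.exp : Matrix (Fin m) (Fin m) 𝕜 → _) :=
    contDiff_iff_contDiffAt.2 fun X => (NormedSpace.exp_analytic (𝕂 := ℝ) X).contDiffAt
  exact h1.comp (skewSubmodule m 𝕜).subtypeL.contDiff

theorem coe_inv (A : Matrix.specialUnitaryGroup (Fin m) 𝕜) :
    ((A⁻¹ : Matrix.specialUnitaryGroup (Fin m) 𝕜) : Matrix (Fin m) (Fin m) 𝕜) = A.1ᴴ := rfl

theorem chart_symm_apply (A : Matrix.specialUnitaryGroup (Fin m) 𝕜) (X : SkewLie m 𝕜) :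
    (((Homeomorph.mulLeft A⁻¹).transOpenPartialHomeomorph (logChart m 𝕜)).symm X).1 =
      A.1 * NormedSpace.exp X.1 := by
  have := (exists_logChart m 𝕜).choose_spec.2.2.1 X
  rw [← this]
  simp [Homeomorph.transOpenPartialHomeomorph, logChart, Homeomorph.mulLeft_symm]

/-- Around each point of its source, a chart is the restriction of an analytic map
on an open set of matrices. -/
theorem chart_eq (A : Matrix.specialUnitaryGroup (Fin m) 𝕜) :
    ∃ (U : Set (Matrix (Fin m) (Fin m) 𝕜)) (L : Matrix (Fin m) (Fin m) 𝕜 → SkewLie m 𝕜),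
      IsOpen U ∧ ContDiffOn ℝ ω L U ∧
      ∀ B ∈ ((Homeomorph.mulLeft A⁻¹).transOpenPartialHomeomorph (logChart m 𝕜)).source,
        B.1 ∈ U ∧
        (Homeomorph.mulLeft A⁻¹).transOpenPartialHomeomorph (logChart m 𝕜) B = L B.1 := by
  obtain ⟨U, L, hU, hL, h⟩ := (exists_logChart m 𝕜).choose_spec.2.2.2
  have hmul : ContDiff ℝ ω (fun B : Matrix (Fin m) (Fin m) 𝕜 => A.1ᴴ * B) :=
    contDiff_const.mul contDiff_id
  refine ⟨(fun B => A.1ᴴ * B) ⁻¹' U, fun B => L (A.1ᴴ * B), hU.preimage hmul.continuous,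
    hL.comp hmul.contDiffOn fun B hB => hB, ?_⟩
  intro B hB
  exact h (A⁻¹ * B) hB

instance : IsManifold 𝓘(ℝ, SkewLie m 𝕜) ω (Matrix.specialUnitaryGroup (Fin m) 𝕜) := by
  refine isManifold_of_contDiffOn _ _ _ ?_
  rintro _ _ ⟨A, rfl⟩ ⟨B, rfl⟩
  obtain ⟨U, L, hU, hL, h⟩ := chart_eq B
  simp only [modelWithCornersSelf_coe, modelWithCornersSelf_coe_symm, Function.id_comp,
    Function.comp_id, preimage_id, range_id, inter_univ, OpenPartialHomeomorph.coe_trans]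
  have hg : ContDiff ℝ ω (fun X : SkewLie m 𝕜 =>
      (A.1 * NormedSpace.exp X.1 : Matrix (Fin m) (Fin m) 𝕜)) :=
    contDiff_const.mul contDiff_exp_skew
  have key : ∀ X ∈ (((Homeomorph.mulLeft A⁻¹).transOpenPartialHomeomorph (logChart m 𝕜)).symm.trans
      ((Homeomorph.mulLeft B⁻¹).transOpenPartialHomeomorph (logChart m 𝕜))).source,
      A.1 * NormedSpace.exp X.1 ∈ U ∧
      ((Homeomorph.mulLeft B⁻¹).transOpenPartialHomeomorph (logChart m 𝕜))
        (((Homeomorph.mulLeft A⁻¹).transOpenPartialHomeomorph (logChart m 𝕜)).symm X) =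
        L (A.1 * NormedSpace.exp X.1) := by
    intro X hX
    rw [OpenPartialHomeomorph.trans_source] at hX
    have := h _ hX.2
    rwa [chart_symm_apply] at this
  refine (hL.comp hg.contDiffOn (fun X hX => (key X hX).1)).congr ?_
  intro X hX
  exact (key X hX).2

variable (m 𝕜) in
/-- Square matrices as a normed algebra (the norm serves only to speak of smooth maps). -/
def NormedMatrix : Type _ := Matrix (Fin m) (Fin m) 𝕜

instance : NormedRing (NormedMatrix m 𝕜) := inferInstanceAs (NormedRing (Matrix (Fin m) (Fin m) 𝕜))
instance : NormedAlgebra ℝ (NormedMatrix m 𝕜) :=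
  inferInstanceAs (NormedAlgebra ℝ (Matrix (Fin m) (Fin m) 𝕜))
instance : FiniteDimensional ℝ (NormedMatrix m 𝕜) :=
  inferInstanceAs (FiniteDimensional ℝ (Matrix (Fin m) (Fin m) 𝕜))

/-- The inclusion of the special unitary group into the square matrices. -/
def toMatrix (B : Matrix.specialUnitaryGroup (Fin m) 𝕜) : NormedMatrix m 𝕜 := B.1

theorem contMDiff_coe : ContMDiff 𝓘(ℝ, SkewLie m 𝕜) 𝓘(ℝ, NormedMatrix m 𝕜) ω (toMatrix (m := m) (𝕜 := 𝕜)) := by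
  intro A
  rw [contMDiffAt_iff]
  have hc : Continuous fun B : Matrix.specialUnitaryGroup (Fin m) 𝕜 => B.1 :=
    continuous_subtype_val
  refine ⟨hc.continuousAt, ?_⟩
  have hg : ContDiff ℝ ω (fun X : SkewLie m 𝕜 =>
      (A.1 * NormedSpace.exp X.1 : Matrix (Fin m) (Fin m) 𝕜)) :=
    contDiff_const.mul contDiff_exp_skew
  refine hg.contDiffWithinAt.congr_of_eventuallyEq (Filter.Eventually.of_forall ?_) ?_
  · intro X; exact chart_symm_apply A X
  · exact chart_symm_apply A _

theorem contMDiff_of_coe {E' H' M : Type*} [NormedAddCommGroup E'] [NormedSpace ℝ E']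
    [TopologicalSpace H'] [TopologicalSpace M] [ChartedSpace H' M] {I : ModelWithCorners ℝ E' H'}
    {f : M → Matrix.specialUnitaryGroup (Fin m) 𝕜}
    (hf : ContMDiff I 𝓘(ℝ, NormedMatrix m 𝕜) ω (fun x => toMatrix (f x))) :
    ContMDiff I 𝓘(ℝ, SkewLie m 𝕜) ω f := by
  have hc : Continuous f := continuous_induced_rng.2 hf.continuous
  intro x
  rw [contMDiffAt_iff_target]
  refine ⟨hc.continuousAt, ?_⟩
  obtain ⟨U, L, hU, hL, h⟩ := chart_eq (f x)
  have hx : f x ∈ (chartAt (SkewLie m 𝕜) (f x)).source := mem_chart_source _ _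
  have h1 : ContMDiffAt (M := NormedMatrix m 𝕜) 𝓘(ℝ, NormedMatrix m 𝕜)
      𝓘(ℝ, SkewLie m 𝕜) ω L (toMatrix (f x)) :=
    ((hL.contDiffAt (hU.mem_nhds (h _ hx).1))).contMDiffAt
  refine (ContMDiffAt.comp x h1 hf.contMDiffAt).congr_of_eventuallyEq ?_
  have : ∀ᶠ y in 𝓝 x, f y ∈ (chartAt (SkewLie m 𝕜) (f x)).source :=
    hc.continuousAt.eventually ((chartAt (SkewLie m 𝕜) (f x)).open_source.mem_nhds hx)
  filter_upwards [this] with y hy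
  exact (h _ hy).2

instance : LieGroup 𝓘(ℝ, SkewLie m 𝕜) ω (Matrix.specialUnitaryGroup (Fin m) 𝕜) where
  contMDiff_mul := by
    apply contMDiff_of_coe
    have hmul : ContDiff ℝ ω (fun p : NormedMatrix m 𝕜 × NormedMatrix m 𝕜 =>
      p.1 * p.2) := contDiff_fst.mul contDiff_snd
    exact hmul.contMDiff.comp
      (((contMDiff_coe (m := m) (𝕜 := 𝕜)).comp contMDiff_fst).prodMk_space
        ((contMDiff_coe (m := m) (𝕜 := 𝕜)).comp contMDiff_snd))
  contMDiff_inv := by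
    apply contMDiff_of_coe
    let T : NormedMatrix m 𝕜 →L[ℝ] NormedMatrix m 𝕜 :=
      LinearMap.toContinuousLinearMap (E := NormedMatrix m 𝕜) (F' := NormedMatrix m 𝕜)
        { toFun := fun X : Matrix (Fin m) (Fin m) 𝕜 => Xᴴ
          map_add' := Matrix.conjTranspose_add
          map_smul' := fun c X => (Matrix.conjTranspose_smul c _).trans (by rw [star_trivial]; rfl) }
    exact T.contDiff.contMDiff.comp contMDiff_coe

instance : LieGroup 𝓘(ℝ, SkewLie m 𝕜) ∞ (Matrix.specialUnitaryGroup (Fin m) 𝕜) :=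
  LieGroup.of_le (n := ω) le_top

end LieGroup

section Curvature

variable {E : Type*} [NormedAddCommGroup E] [NormedSpace ℝ E]

/-- `koszul D X Y Z = (D X Y Z + D Y X Z - D Z X Y) / 2`. For `D` the derivative of a metric `g`
at a point of an open subset of `E`, this is `g (∇_X Y) Z` for constant vector fields `X`, `Y`. -/
def koszul (D : E →L[ℝ] E →L[ℝ] E →L[ℝ] ℝ) : E →L[ℝ] E →L[ℝ] E →L[ℝ] ℝ :=
  (1 / 2 : ℝ) • (D + D.flip - ((ContinuousLinearMap.flipₗᵢ ℝ E E ℝ).toContinuousLinearEquiv :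
    (E →L[ℝ] E →L[ℝ] ℝ) →L[ℝ] E →L[ℝ] E →L[ℝ] ℝ).comp D.flip)

/-- The Christoffel symbol of a metric `g` in coordinates, as a bilinear map `E × E → E`. -/
def christoffel (g : E → E →L[ℝ] E →L[ℝ] ℝ) (u : E) : E →L[ℝ] E →L[ℝ] E :=
  (ContinuousLinearMap.compL ℝ E (E →L[ℝ] ℝ) E (g u).inverse).comp (koszul (fderiv ℝ g u))

/-- The curvature endomorphism `R(X, Y) = ∇_X ∇_Y - ∇_Y ∇_X` (for constant `X`, `Y`) of a metric
in coordinates. -/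
def riemann (g : E → E →L[ℝ] E →L[ℝ] ℝ) (u X Y : E) : E →L[ℝ] E :=
  fderiv ℝ (christoffel g) u X Y - fderiv ℝ (christoffel g) u Y X +
    (christoffel g u X).comp (christoffel g u Y) - (christoffel g u Y).comp (christoffel g u X)

/-- The linear map `X ↦ R(X, Y) Z`. -/
def riemannLeft (g : E → E →L[ℝ] E →L[ℝ] ℝ) (u Y Z : E) : E →ₗ[ℝ] E where
  toFun X := riemann g u X Y Z
  map_add' X X' := by simp [riemann]; abel
  map_smul' c X := by simp [riemann, smul_sub, smul_add]

/-- The Ricci tensor `Ric(Y, Z) = tr (X ↦ R(X, Y) Z)` of a metric in coordinates. -/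
def ricci (g : E → E →L[ℝ] E →L[ℝ] ℝ) (u : E) : E →ₗ[ℝ] E →ₗ[ℝ] ℝ :=
  LinearMap.mk₂ ℝ (fun Y Z => LinearMap.trace ℝ E (riemannLeft g u Y Z))
    (fun Y Y' Z => by
      rw [← map_add]; congr 1; ext X; simp [riemannLeft, riemann]; abel)
    (fun c Y Z => by
      rw [← map_smul]; congr 1; ext X; simp [riemannLeft, riemann, smul_sub, smul_add])
    (fun Y Z Z' => by
      rw [← map_add]; congr 1; ext X; simp [riemannLeft])
    (fun c Y Z => by
      rw [← map_smul]; congr 1; ext X; simp [riemannLeft])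

variable [FiniteDimensional ℝ E]

/-- The Ricci endomorphism, `g (Ric♯ Y, Z) = Ric(Y, Z)`. -/
def ricciEnd (g : E → E →L[ℝ] E →L[ℝ] ℝ) (u : E) : E →ₗ[ℝ] E :=
  (g u).inverse.toLinearMap ∘ₗ
    (LinearMap.toContinuousLinearMap (𝕜 := ℝ) (E := E) (F' := ℝ)).toLinearMap ∘ₗ ricci g u

end Curvature

section Manifold

variable {E H : Type*} [NormedAddCommGroup E] [NormedSpace ℝ E] [TopologicalSpace H]
  {E' H' : Type*} [NormedAddCommGroup E'] [NormedSpace ℝ E'] [TopologicalSpace H']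

/-- A field of bilinear forms on the tangent spaces of `M`. Smoothness and positivity are not part
of the type. -/
abbrev MetricField (I : ModelWithCorners ℝ E H) (M : Type*) [TopologicalSpace M]
    [ChartedSpace H M] : Type _ :=
  ∀ x : M, TangentSpace I x →L[ℝ] TangentSpace I x →L[ℝ] ℝ

/-- The bilinear form `(v, w) ↦ B (A v) (A w)`. -/
def pullForm {V W : Type*} [AddCommGroup V] [Module ℝ V] [TopologicalSpace V]
    [IsTopologicalAddGroup V] [ContinuousConstSMul ℝ V]
    [AddCommGroup W] [Module ℝ W] [TopologicalSpace W]
    [IsTopologicalAddGroup W] [ContinuousConstSMul ℝ W]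
    (B : W →L[ℝ] W →L[ℝ] ℝ) (A : V →L[ℝ] W) : V →L[ℝ] V →L[ℝ] ℝ :=
  (ContinuousLinearMap.precomp ℝ A).comp (B.comp A)

variable (I : ModelWithCorners ℝ E H) (J : ModelWithCorners ℝ E' H')
  {M : Type*} [TopologicalSpace M] [ChartedSpace H M]
  {N : Type*} [TopologicalSpace N] [ChartedSpace H' N]

/-- The pullback `f^* g`. -/
def pullbackMetric (f : M → N) (g : MetricField J N) : MetricField I M :=
  fun x => pullForm (g (f x)) (mfderiv I J f x)

/-- The coordinate expression of `g` in the preferred chart at `p`. -/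
def metricInChart (g : MetricField I M) (p : M) : E → E →L[ℝ] E →L[ℝ] ℝ :=
  pullbackMetric 𝓘(ℝ, E) I (extChartAt I p).symm g

/-- The scalar curvature of `g` at `p`. -/
def scalarCurvature [FiniteDimensional ℝ E] (g : MetricField I M) (p : M) : ℝ :=
  LinearMap.trace ℝ E (ricciEnd (metricInChart I g p) (extChartAt I p p))

/-- The squared norm `‖Ric‖²` with respect to `g` of the Ricci tensor of `g` at `p`. -/
def ricciNormSq [FiniteDimensional ℝ E] (g : MetricField I M) (p : M) : ℝ :=
  LinearMap.trace ℝ E (ricciEnd (metricInChart I g p) (extChartAt I p p) ∘ₗ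
    ricciEnd (metricInChart I g p) (extChartAt I p p))

/-- The set of points in which the scalar curvature of `g` attains its maximum. -/
def maxScalarSet [FiniteDimensional ℝ E] (g : MetricField I M) : Set M :=
  {p | ∀ q, scalarCurvature I g q ≤ scalarCurvature I g p}

/-- Each point of `(M, g)` has an open neighbourhood which is isometric to an open subset of
`(N, g')`. -/
def IsLocallyIsometricTo (g : MetricField I M) (g' : MetricField J N) : Prop :=
  ∀ p : M, ∃ e : OpenPartialHomeomorph M N, p ∈ e.source ∧
    ContMDiffOn I J ∞ e e.source ∧ ContMDiffOn J I ∞ e.symm e.target ∧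
    ∀ x ∈ e.source, pullbackMetric I J e g' x = g x

/-- The product metric. -/
def prodMetric (g : MetricField I M) (g' : MetricField J N) : MetricField (I.prod J) (M × N) :=
  fun p => pullbackMetric (I.prod J) I Prod.fst g p + pullbackMetric (I.prod J) J Prod.snd g' p

end Manifold

section Group

variable {E H : Type*} [NormedAddCommGroup E] [NormedSpace ℝ E] [TopologicalSpace H]
  {E' H' : Type*} [NormedAddCommGroup E'] [NormedSpace ℝ E'] [TopologicalSpace H']
  (I : ModelWithCorners ℝ E H) (J : ModelWithCorners ℝ E' H')
  {G : Type*} [TopologicalSpace G] [ChartedSpace H G] [Group G]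
  {T : Type*} [TopologicalSpace T] [ChartedSpace H' T] [Group T]

/-- Invariance of `g` under the left translations `x ↦ a * x`. -/
def IsLeftInvariant (g : MetricField I G) : Prop :=
  ∀ a : G, pullbackMetric I I (fun x => a * x) g = g

/-- Invariance of `g` under the right translations `x ↦ x * a`. -/
def IsRightInvariant (g : MetricField I G) : Prop :=
  ∀ a : G, pullbackMetric I I (fun x => x * a) g = g

/-- `Ad_a`, the differential at `1` of the conjugation by `a`. -/
def Ad (a : G) : GroupLieAlgebra I G →L[ℝ] GroupLieAlgebra I G :=
  (mfderiv I I (fun x : G => a * x * a⁻¹) 1 : E →L[ℝ] E)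

/-- The differential `T_x G → T_1 G` of the left translation by `x⁻¹`. -/
def maurerCartan (x : G) : TangentSpace I x →L[ℝ] GroupLieAlgebra I G :=
  (mfderiv I I (fun y : G => x⁻¹ * y) x : E →L[ℝ] E)

/-- The connection form `ω(X, Z) = λ(X) + Z` on `G × T`, where the linear map `lam` from the Lie
algebra of `G` to that of `T` is viewed as a left invariant `1`-form on `G`, and the
tangent spaces of `T` are identified with its Lie algebra by left translation. -/
def connectionForm (lam : GroupLieAlgebra I G →L[ℝ] GroupLieAlgebra J T) (p : G × T) :
    TangentSpace (I.prod J) p →L[ℝ] GroupLieAlgebra J T :=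
  (lam.comp (maurerCartan I p.1)).comp (mfderiv (I.prod J) I Prod.fst p) +
    (maurerCartan J p.2).comp (mfderiv (I.prod J) J Prod.snd p)

/-- The metric `g_λ` on `G × T` associated with a metric `h` on `G`, a metric `k` on `T` and `lam`:
`g_λ(v, w) = h(π_* v, π_* w) + ⟨ω(v), ω(w)⟩`. It induces `k` on the fibres `{x} × T` (for
`k` left invariant), the projection to `(G, h)` is a Riemannian submersion, and `ker ω` is
orthogonal to the fibres. -/
def metricOfForm (h : MetricField I G) (k : MetricField J T)
    (lam : GroupLieAlgebra I G →L[ℝ] GroupLieAlgebra J T) : MetricField (I.prod J) (G × T) :=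
  fun p => pullbackMetric (I.prod J) I Prod.fst h p + pullForm (k 1) (connectionForm I J lam p)

/-- `(X, Y) ↦ λ(X) + λ'(Y)` on the Lie algebra of `G × G`. -/
def sumForm (lam lam' : GroupLieAlgebra I G →L[ℝ] GroupLieAlgebra J T) :
    GroupLieAlgebra (I.prod I) (G × G) →L[ℝ] GroupLieAlgebra J T :=
  ((lam : E →L[ℝ] E').coprod (lam' : E →L[ℝ] E') : E × E →L[ℝ] E')

end Group

/-- The group of `m × m` matrices `A` over `𝕜` with `A * Aᴴ = 1` and `det A = 1`. For `𝕜 = ℝ` this is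
`SO(m)` (by definition `Matrix.specialOrthogonalGroup`), and for `𝕜 = ℂ` it is `SU(m)`. -/
abbrev GroupK (m : ℕ) (𝕜 : Type*) [RCLike 𝕜] : Type _ := Matrix.specialUnitaryGroup (Fin m) 𝕜

/-- The model of `GroupK m 𝕜` as a manifold. -/
abbrev modelK (m : ℕ) (𝕜 : Type*) [RCLike 𝕜] : ModelWithCorners ℝ (SkewLie m 𝕜) (SkewLie m 𝕜) :=
  𝓘(ℝ, SkewLie m 𝕜)

/-- The class function `φ(x) = exp (2 ε Re(tr x) / m)`. -/
def classFun {m : ℕ} {𝕜 : Type*} [RCLike 𝕜] (ε : ℝ)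
    (x : GroupK m 𝕜) : ℝ :=
  Real.exp (2 * ε * RCLike.re (x : Matrix (Fin m) (Fin m) 𝕜).trace / m)

end IsoConf

end

open IsoConf Bundle

noncomputable section
namespace IsoConf

/-! ### Christoffel symbols and curvature in a moving frame -/

section Cartan

variable {E F : Type*} [NormedAddCommGroup E] [NormedSpace ℝ E]
  [NormedAddCommGroup F] [NormedSpace ℝ F]

/-! Every metric involved is a function times a left invariant metric on a unimodular Lie group, so
curvature reduces to algebra at the identity. Let `n` be the dimension of `G = (K × K) × H`, let `S`
be the scalar curvature of `g_λ̄`, and let `e_i` be an orthonormal left invariant frame. For a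
conformal factor `e^{2f}` the scalar curvature is `e^{-2f} (S - 2(n-1) ∑ e_i e_i f - (n-1)(n-2)
|df|²)` (`trace_ricciEnd_conformal`).

Here `f = (ε/m) Re tr ρ` with `ρ` a projection from `G` to `K`. The Casimir element of the standard
representation commutes with the Lie algebra, hence is a scalar `-μ` with `μ > 0`
(`exists_casimir`), so `∑ e_i e_i f = -μ f`. With `c = (n-1) μ` the scalar curvature becomes
`e^{-2f} (S + 2cf - q)`. The gradient term `q` is nonnegative and vanishes where `ρ = 1`.

The function `t ↦ e^{-2t} (S + 2ct)` increases as long as `S + 2ct < c`. Comparing the Killing form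
with the trace form of the standard representation gives `S ≤ 3c/4` (`sum_bracket_sq_le`,
`scalar_totalForm_le`); the form `λ̄` enters `S` only through a nonpositive term. Since `f ≤ ε <
1/8`, the whole range of `f` lies in the increasing regime, and `f = ε` happens exactly where `ρ =
1`, because a unitary matrix with real trace `m` is the identity. So the maximum set is the kernel
of the projection (`maxScalarSet_classFun`), a copy of `K × H` to which `g_λ̄` restricts as `g_λ'`
or `g_λ`, scaled by `e^{2ε}`.

Both conformal metrics have the same maximal value, as `S`, `μ` and `n` are the same. A local
isometry preserves scalar curvature, so it maps one maximum set into the other and induces a local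
isometry between the two copies of `K × H` (`exists_ricciNormSq_eq`). Their Ricci tensors have
different constant norms, a contradiction.

Curvature is defined in charts through Christoffel symbols. Cartan's structure equation
`frame_riemann` is used twice: with the differential of a chart expression as frame it gives
naturality under local isometries, and with the Maurer-Cartan form as frame it gives the conformal
formula. -/

theorem koszul_apply (D : E →L[ℝ] E →L[ℝ] E →L[ℝ] ℝ) (X Y Z : E) :
    koszul D X Y Z = 1 / 2 * (D X Y Z + D Y X Z - D Z X Y) := by
  simp [koszul]

theorem pullForm_apply (B : F →L[ℝ] F →L[ℝ] ℝ) (A : E →L[ℝ] F) (v w : E) :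
    pullForm B A v w = B (A v) (A w) := rfl

theorem isInvertible_of_pos [FiniteDimensional ℝ E] {B : E →L[ℝ] E →L[ℝ] ℝ}
    (h : ∀ v, v ≠ 0 → 0 < B v v) : B.IsInvertible := by
  have hinj : Function.Injective B.toLinearMap := by
    rw [injective_iff_map_eq_zero]
    intro v hv
    by_contra hne
    have := h v hne
    have h2 : B v = 0 := hv
    simp [h2] at this
  have hdim : Module.finrank ℝ E = Module.finrank ℝ (E →L[ℝ] ℝ) := by
    rw [← (LinearMap.toContinuousLinearMap (𝕜 := ℝ) (E := E) (F' := ℝ)).finrank_eq]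
    exact (Subspace.dual_finrank_eq (K := ℝ) (V := E)).symm
  refine ⟨(LinearEquiv.ofInjectiveOfFinrankEq B.toLinearMap hinj hdim).toContinuousLinearEquiv, ?_⟩
  ext v w
  rfl

/-- The Christoffel symbol of `G (A ·) (A ·)` is determined by a torsion-free connection `θ`
which is compatible with `G`. -/
theorem frame_christoffel {g : E → E →L[ℝ] E →L[ℝ] ℝ} {u : E} {A : E →L[ℝ] F}
    {A' : E →L[ℝ] E →L[ℝ] F} {G : F →L[ℝ] F →L[ℝ] ℝ} {dG : E →L[ℝ] F →L[ℝ] F →L[ℝ] ℝ}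
    {θ : E →L[ℝ] F →L[ℝ] F} (hinv : (g u).IsInvertible) (hA : A.IsInvertible)
    (hg : ∀ X Y, g u X Y = G (A X) (A Y))
    (hdg : ∀ W X Y, fderiv ℝ g u W X Y = dG W (A X) (A Y) + G (A' W X) (A Y) + G (A X) (A' W Y))
    (hsymm : ∀ a b, G a b = G b a)
    (hmet : ∀ W a b, dG W a b = G (θ W a) b + G a (θ W b))
    (htor : ∀ X Y, A' X Y + θ X (A Y) = A' Y X + θ Y (A X)) (X Y : E) :
    A (christoffel g u X Y) = A' X Y + θ X (A Y) := by
  -- Compatibility removes the derivatives of `G`. The torsion equation, applied to the pairs `(Y,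
  -- X)`, `(Z, X)` and `(Z, Y)`, then makes everything cancel except twice the wanted term.
  have key : koszul (fderiv ℝ g u) X Y = g u (A.inverse (A' X Y + θ X (A Y))) := by
    ext Z
    rw [koszul_apply, hdg, hdg, hdg, hg, hA.self_apply_inverse, hmet, hmet, hmet]
    have h1 : G (A' Y X) (A Z) = G (A' X Y) (A Z) + G (θ X (A Y)) (A Z) - G (θ Y (A X)) (A Z) := by
      have := congrArg (fun v => G v (A Z)) (htor X Y)
      simp only [map_add, add_apply] at this
      linarith
    have h2 : G (A' X Z) (A Y) = G (A' Z X) (A Y) + G (θ Z (A X)) (A Y) - G (θ X (A Z)) (A Y) := by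
      have := congrArg (fun v => G v (A Y)) (htor Z X)
      simp only [map_add, add_apply] at this
      linarith
    have h3 : G (A' Y Z) (A X) = G (A' Z Y) (A X) + G (θ Z (A Y)) (A X) - G (θ Y (A Z)) (A X) := by
      have := congrArg (fun v => G v (A X)) (htor Z Y)
      simp only [map_add, add_apply] at this
      linarith
    rw [hsymm (A Y) (A' X Z), hsymm (A X) (A' Y Z), hsymm (A X) (A' Z Y), hsymm (A Y) (θ X (A Z)),
      hsymm (A X) (θ Y (A Z)), hsymm (A X) (θ Z (A Y)), h1, h2, h3, map_add,
      add_apply]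
    ring
  have : christoffel g u X Y = (g u).inverse (koszul (fderiv ℝ g u) X Y) := rfl
  rw [this, key, hinv.inverse_apply_self, hA.self_apply_inverse]

set_option synthInstance.maxHeartbeats 100000 in
theorem contDiff_koszul {n : WithTop ℕ∞} : ContDiff ℝ n (koszul (E := E)) := by
  have hflip : ContDiff ℝ n (fun D : E →L[ℝ] E →L[ℝ] E →L[ℝ] ℝ => D.flip) :=
    (ContinuousLinearMap.flipₗᵢ ℝ E E (E →L[ℝ] ℝ)).contDiff
  exact ((contDiff_id.add hflip).sub (contDiff_const.clm_comp hflip)).const_smul _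

theorem differentiableAt_christoffel [CompleteSpace E] {g : E → E →L[ℝ] E →L[ℝ] ℝ} {u : E}
    (hg : ContDiffAt ℝ 2 g u) (hinv : (g u).IsInvertible) :
    DifferentiableAt ℝ (christoffel g) u := by
  obtain ⟨e, he⟩ := hinv
  have h1 : ContDiffAt ℝ 1 (fun u => (g u).inverse) u := by
    have h3 : ContDiffAt ℝ 1 ContinuousLinearMap.inverse (g u) := by
      rw [← he]; exact contDiffAt_map_inverse e
    exact h3.comp u (hg.of_le (by norm_num))
  have h2 : ContDiffAt ℝ 1 (fun u => koszul (fderiv ℝ g u)) u :=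
    contDiff_koszul.contDiffAt.comp u (hg.fderiv_right (by norm_num))
  have h4 : ContDiffAt ℝ 1 (christoffel g) u :=
    ((ContinuousLinearMap.compL ℝ E (E →L[ℝ] ℝ) E).contDiff.contDiffAt.comp u h1).clm_comp h2
  exact h4.differentiableAt (by norm_num)

theorem fderiv_pullForm {A : E → E →L[ℝ] F} {G : E → F →L[ℝ] F →L[ℝ] ℝ} {u : E}
    (hA : DifferentiableAt ℝ A u) (hG : DifferentiableAt ℝ G u) (W X Y : E) :
    fderiv ℝ (fun u => pullForm (G u) (A u)) u W X Y = fderiv ℝ G u W (A u X) (A u Y) +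
      G u (fderiv ℝ A u W X) (A u Y) + G u (A u X) (fderiv ℝ A u W Y) := by
  have hpre : HasFDerivAt (fun u => ContinuousLinearMap.precomp ℝ (A u))
      (((ContinuousLinearMap.compL ℝ E F ℝ).flip).comp (fderiv ℝ A u)) u :=
    ((ContinuousLinearMap.compL ℝ E F ℝ).flip).hasFDerivAt.comp u hA.hasFDerivAt
  have := (hpre.clm_comp (hG.hasFDerivAt.clm_comp hA.hasFDerivAt)).fderiv
  have h2 : (fun u => pullForm (G u) (A u)) = fun u =>
    (ContinuousLinearMap.precomp ℝ (A u)).comp ((G u).comp (A u)) := rfl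
  rw [h2, this]
  simp
  ring

theorem contDiffAt_pullForm {n : WithTop ℕ∞} {V : Type*} [NormedAddCommGroup V] [NormedSpace ℝ V]
    {A : V → E →L[ℝ] F} {G : V → F →L[ℝ] F →L[ℝ] ℝ} {u : V}
    (hA : ContDiffAt ℝ n A u) (hG : ContDiffAt ℝ n G u) :
    ContDiffAt ℝ n (fun u => pullForm (G u) (A u)) u :=
  ((((ContinuousLinearMap.compL ℝ E F ℝ).flip).contDiff.contDiffAt.comp u hA).clm_comp
    (hG.clm_comp hA) :)

/-- Cartan's second structure equation: the curvature of `G (A ·) (A ·)` in terms of a torsion-free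
metric connection form `θ`. -/
theorem frame_riemann [CompleteSpace E] {g : E → E →L[ℝ] E →L[ℝ] ℝ} {u : E} {A : E → E →L[ℝ] F}
    {G : E → F →L[ℝ] F →L[ℝ] ℝ} {θ : E → E →L[ℝ] F →L[ℝ] F}
    (hgc : ContDiffAt ℝ 2 g u) (hAc : ContDiffAt ℝ 2 A u) (hGc : ContDiffAt ℝ 1 G u)
    (hθc : DifferentiableAt ℝ θ u)
    (hinv : ∀ᶠ v in 𝓝 u, (g v).IsInvertible) (hA : ∀ᶠ v in 𝓝 u, (A v).IsInvertible)
    (hg : ∀ᶠ v in 𝓝 u, g v = pullForm (G v) (A v))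
    (hsymm : ∀ᶠ v in 𝓝 u, ∀ a b, G v a b = G v b a)
    (hmet : ∀ᶠ v in 𝓝 u, ∀ W a b, fderiv ℝ G v W a b = G v (θ v W a) b + G v a (θ v W b))
    (htor : ∀ᶠ v in 𝓝 u, ∀ X Y,
      fderiv ℝ A v X Y + θ v X (A v Y) = fderiv ℝ A v Y X + θ v Y (A v X)) (X Y Z : E) :
    A u (riemann g u X Y Z) = fderiv ℝ θ u X Y (A u Z) - fderiv ℝ θ u Y X (A u Z) +
      θ u X (θ u Y (A u Z)) - θ u Y (θ u X (A u Z)) := by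
  have hA1 : ∀ᶠ v in 𝓝 u, DifferentiableAt ℝ A v :=
    ((hAc.of_le (by norm_num : (1 : WithTop ℕ∞) ≤ 2)).eventually (by simp)).mono
      fun v hv => hv.differentiableAt (by norm_num)
  have hG1 : ∀ᶠ v in 𝓝 u, DifferentiableAt ℝ G v :=
    (hGc.eventually (by simp)).mono fun v hv => hv.differentiableAt (by norm_num)
  have hchr : ∀ᶠ v in 𝓝 u, ∀ X Y,
      A v (christoffel g v X Y) = fderiv ℝ A v X Y + θ v X (A v Y) := by
    filter_upwards [hinv, hA, hg.eventually_nhds, hsymm, hmet, htor, hA1, hG1]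
      with v h1 h2 h3 h4 h5 h6 h7 h8
    refine frame_christoffel (G := G v) (dG := fderiv ℝ G v) h1 h2 ?_ ?_ h4 h5 h6
    · intro X Y; rw [h3.self_of_nhds]; rfl
    · intro W X Y
      rw [Filter.EventuallyEq.fderiv_eq h3]
      exact fderiv_pullForm h7 h8 W X Y
  have hΓ := differentiableAt_christoffel hgc hinv.self_of_nhds
  have hAd := hA1.self_of_nhds
  have hA2 : DifferentiableAt ℝ (fderiv ℝ A) u :=
    (hAc.fderiv_right (m := 1) (by norm_num)).differentiableAt (by norm_num)
  have hsym2 : ∀ X Y, fderiv ℝ (fderiv ℝ A) u X Y = fderiv ℝ (fderiv ℝ A) u Y X := fun X Y =>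
    hAc.isSymmSndFDerivAt (by simp) X Y
  -- Derivative of the identity `hchr`. After antisymmetrising in `W` and `X`, the second derivative
  -- of `A` disappears by symmetry.
  have hder : ∀ W X Z, fderiv ℝ A u W (christoffel g u X Z) +
      A u (fderiv ℝ (christoffel g) u W X Z) = fderiv ℝ (fderiv ℝ A) u W X Z +
        fderiv ℝ θ u W X (A u Z) + θ u X (fderiv ℝ A u W Z) := by
    intro W X Z
    have hc : HasFDerivAt (fun v => christoffel g v X Z)
        (((ContinuousLinearMap.apply ℝ E Z).comp (ContinuousLinearMap.apply ℝ (E →L[ℝ] E) X)).comp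
          (fderiv ℝ (christoffel g) u)) u :=
      ((ContinuousLinearMap.apply ℝ E Z).comp
        (ContinuousLinearMap.apply ℝ (E →L[ℝ] E) X)).hasFDerivAt.comp u hΓ.hasFDerivAt
    have h1 := hAd.hasFDerivAt.clm_apply hc
    have ha : HasFDerivAt (fun v => fderiv ℝ A v X Z)
        (((ContinuousLinearMap.apply ℝ F Z).comp (ContinuousLinearMap.apply ℝ (E →L[ℝ] F) X)).comp
          (fderiv ℝ (fderiv ℝ A) u)) u :=
      ((ContinuousLinearMap.apply ℝ F Z).comp
        (ContinuousLinearMap.apply ℝ (E →L[ℝ] F) X)).hasFDerivAt.comp u hA2.hasFDerivAt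
    have hw : HasFDerivAt (fun v => θ v X)
        ((ContinuousLinearMap.apply ℝ (F →L[ℝ] F) X).comp (fderiv ℝ θ u)) u :=
      (ContinuousLinearMap.apply ℝ (F →L[ℝ] F) X).hasFDerivAt.comp u hθc.hasFDerivAt
    have hz : HasFDerivAt (fun v => A v Z)
        ((ContinuousLinearMap.apply ℝ F Z).comp (fderiv ℝ A u)) u :=
      (ContinuousLinearMap.apply ℝ F Z).hasFDerivAt.comp u hAd.hasFDerivAt
    have h2 := ha.add (hw.clm_apply hz)
    have h3 := h1.unique (h2.congr_of_eventuallyEq (hchr.mono fun v hv => hv X Z))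
    have h4 := congrArg (fun T => T W) h3
    simp at h4
    rw [add_comm, h4]
    abel
  have hch := hchr.self_of_nhds
  have e1 := hder X Y Z
  have e2 := hder Y X Z
  have e3 := hch X (christoffel g u Y Z)
  have e4 := hch Y (christoffel g u X Z)
  rw [hch Y Z, map_add] at e3
  rw [hch X Z, map_add] at e4
  rw [hsym2 Y X] at e2
  have e1' := eq_sub_of_add_eq' e1
  have e2' := eq_sub_of_add_eq' e2
  have : riemann g u X Y Z = fderiv ℝ (christoffel g) u X Y Z - fderiv ℝ (christoffel g) u Y X Z +
    christoffel g u X (christoffel g u Y Z) - christoffel g u Y (christoffel g u X Z) := rfl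
  rw [this, map_sub, map_add, map_sub, e1', e2', e3, e4]
  abel

end Cartan

/-! ### Naturality and scaling of curvature on open subsets of a vector space -/

section Naturality

variable {E : Type*} [NormedAddCommGroup E] [NormedSpace ℝ E]

theorem apply_christoffel {g : E → E →L[ℝ] E →L[ℝ] ℝ} {u : E} (hinv : (g u).IsInvertible)
    (X Y Z : E) : g u (christoffel g u X Y) Z = koszul (fderiv ℝ g u) X Y Z := by
  have : christoffel g u X Y = (g u).inverse (koszul (fderiv ℝ g u) X Y) := rfl
  rw [this, hinv.self_apply_inverse]

/-- No differentiability is needed: where it fails, `fderiv` takes the default value `0`, which is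
symmetric. -/
theorem fderiv_symm {g : E → E →L[ℝ] E →L[ℝ] ℝ} {u : E}
    (hsymm : ∀ᶠ v in 𝓝 u, ∀ a b, g v a b = g v b a) (W a b : E) :
    fderiv ℝ g u W a b = fderiv ℝ g u W b a := by
  by_cases hd : DifferentiableAt ℝ g u
  · have h : ∀ a b, HasFDerivAt (fun v => g v a b) (((ContinuousLinearMap.apply ℝ ℝ b).comp
        (ContinuousLinearMap.apply ℝ (E →L[ℝ] ℝ) a)).comp (fderiv ℝ g u)) u := fun a b =>
      ((ContinuousLinearMap.apply ℝ ℝ b).comp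
        (ContinuousLinearMap.apply ℝ (E →L[ℝ] ℝ) a)).hasFDerivAt.comp u hd.hasFDerivAt
    have := (h a b).unique ((h b a).congr_of_eventuallyEq (hsymm.mono fun v hv => hv a b))
    exact congrArg (fun T => T W) this
  · rw [fderiv_zero_of_not_differentiableAt hd]; rfl

/-- Metric compatibility. Together with `christoffel_symm` (no torsion) it shows that the pulled
back Levi-Civita connection meets the hypotheses of `frame_riemann`. -/
theorem fderiv_eq_christoffel {g : E → E →L[ℝ] E →L[ℝ] ℝ} {u : E}
    (hsymm : ∀ᶠ v in 𝓝 u, ∀ a b, g v a b = g v b a) (hinv : (g u).IsInvertible) (W a b : E) :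
    fderiv ℝ g u W a b = g u (christoffel g u W a) b + g u a (christoffel g u W b) := by
  rw [hsymm.self_of_nhds a, apply_christoffel hinv, apply_christoffel hinv, koszul_apply,
    koszul_apply, fderiv_symm hsymm W b a, fderiv_symm hsymm b W a, fderiv_symm hsymm a W b]
  ring

theorem christoffel_symm {g : E → E →L[ℝ] E →L[ℝ] ℝ} {u : E}
    (hsymm : ∀ᶠ v in 𝓝 u, ∀ a b, g v a b = g v b a) (X Y : E) :
    christoffel g u X Y = christoffel g u Y X := by
  have : koszul (fderiv ℝ g u) X Y = koszul (fderiv ℝ g u) Y X := by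
    ext Z
    rw [koszul_apply, koszul_apply, fderiv_symm hsymm Z X Y]
    ring
  have h : ∀ X Y, christoffel g u X Y = (g u).inverse (koszul (fderiv ℝ g u) X Y) :=
    fun X Y => rfl
  rw [h, h, this]

/-- The invertible operators form an open set. -/
theorem eventually_isInvertible [CompleteSpace E] {V F : Type*} [TopologicalSpace V]
    [NormedAddCommGroup F] [NormedSpace ℝ F] {A : V → E →L[ℝ] F} {u : V} (hA : ContinuousAt A u)
    (h : (A u).IsInvertible) : ∀ᶠ v in 𝓝 u, (A v).IsInvertible := by
  obtain ⟨e, he⟩ := h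
  have := ContinuousLinearEquiv.nhds e
  rw [he] at this
  filter_upwards [hA.eventually_mem this] with v hv
  exact hv

/-- The curvature of a pulled back metric. -/
theorem riemann_pullback [FiniteDimensional ℝ E] {g g' : E → E →L[ℝ] E →L[ℝ] ℝ} {ψ : E → E}
    {u : E} (hψ : ContDiffAt ℝ 3 ψ u) (hg' : ContDiffAt ℝ 2 g' (ψ u))
    (hsymm : ∀ᶠ v in 𝓝 (ψ u), ∀ a b, g' v a b = g' v b a)
    (hpos : ∀ᶠ v in 𝓝 (ψ u), ∀ a, a ≠ 0 → 0 < g' v a a)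
    (hg : ∀ᶠ v in 𝓝 u, g v = pullForm (g' (ψ v)) (fderiv ℝ ψ v))
    (hinv : (fderiv ℝ ψ u).IsInvertible) (X Y Z : E) :
    fderiv ℝ ψ u (riemann g u X Y Z) =
      riemann g' (ψ u) (fderiv ℝ ψ u X) (fderiv ℝ ψ u Y) (fderiv ℝ ψ u Z) := by
  have : CompleteSpace E := FiniteDimensional.complete ℝ E
  have hψc : ContinuousAt ψ u := hψ.continuousAt
  have hDψ : ContDiffAt ℝ 2 (fderiv ℝ ψ) u := hψ.fderiv_right (by norm_num)
  have hDinv : ∀ᶠ v in 𝓝 u, (fderiv ℝ ψ v).IsInvertible :=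
    eventually_isInvertible hDψ.continuousAt hinv
  have hGc : ContDiffAt ℝ 2 (fun v => g' (ψ v)) u := hg'.comp u (hψ.of_le (by norm_num))
  have hgc : ContDiffAt ℝ 2 g u := (contDiffAt_pullForm hDψ hGc).congr_of_eventuallyEq hg
  have hginv : ∀ᶠ v in 𝓝 u, (g v).IsInvertible := by
    filter_upwards [hDinv, hg, hψc.eventually hpos] with v h1 h2 h3
    refine isInvertible_of_pos fun a ha => ?_
    rw [h2, pullForm_apply]
    refine h3 _ fun h0 => ha ?_
    rw [← h1.inverse_apply_self a, h0, map_zero]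
  have hg'inv : ∀ᶠ v in 𝓝 (ψ u), (g' v).IsInvertible := hpos.mono fun v hv => isInvertible_of_pos hv
  have hψd : ∀ᶠ v in 𝓝 u, ContDiffAt ℝ 3 ψ v := hψ.eventually (by simp)
  have hg'd : ∀ᶠ v in 𝓝 (ψ u), ContDiffAt ℝ 2 g' v := hg'.eventually (by simp)
  have hΓ : DifferentiableAt ℝ (christoffel g') (ψ u) :=
    differentiableAt_christoffel hg' hg'inv.self_of_nhds
  have hψu : DifferentiableAt ℝ ψ u := hψ.differentiableAt (by norm_num)
  have hDu : DifferentiableAt ℝ (fderiv ℝ ψ) u := hDψ.differentiableAt (by norm_num)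
  have hθ := ((hΓ.hasFDerivAt.comp u hψu.hasFDerivAt).clm_comp hDu.hasFDerivAt)
  -- The frame is the differential of `ψ`, and the connection form is the Levi-Civita connection of
  -- `g'` pulled back along `ψ`.
  have key := frame_riemann (g := g) (u := u) (A := fderiv ℝ ψ) (G := fun v => g' (ψ v))
    (θ := fun v => (christoffel g' (ψ v)).comp (fderiv ℝ ψ v)) hgc hDψ
    (hGc.of_le (by norm_num)) hθ.differentiableAt hginv hDinv hg (hψc.eventually hsymm)
    (by
      filter_upwards [hψc.eventually hsymm.eventually_nhds, hψc.eventually hg'inv, hψd,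
        hψc.eventually hg'd] with v h1 h2 h3 h4 W a b
      have hd := ((h4.differentiableAt (by norm_num)).hasFDerivAt.comp v
        (h3.differentiableAt (by norm_num)).hasFDerivAt).fderiv
      have hd' : fderiv ℝ (fun v => g' (ψ v)) v = (fderiv ℝ g' (ψ v)).comp (fderiv ℝ ψ v) := hd
      rw [hd']
      exact fderiv_eq_christoffel h1 h2 _ _ _)
    (by
      filter_upwards [hψc.eventually hsymm.eventually_nhds, hψd] with v h1 h3 X Y
      have := (h3.of_le (by norm_num : (2 : WithTop ℕ∞) ≤ 3)).isSymmSndFDerivAt (by simp)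
      rw [this X Y]
      congr 1
      exact christoffel_symm h1 _ _) X Y Z
  have hθd : ∀ X Y, fderiv ℝ (fun v => (christoffel g' (ψ v)).comp (fderiv ℝ ψ v)) u X Y =
      fderiv ℝ (christoffel g') (ψ u) (fderiv ℝ ψ u X) (fderiv ℝ ψ u Y) +
        christoffel g' (ψ u) (fderiv ℝ (fderiv ℝ ψ) u X Y) := by
    intro X Y
    have h1 : fderiv ℝ (fun v => (christoffel g' (ψ v)).comp (fderiv ℝ ψ v)) u = _ := hθ.fderiv
    rw [h1]
    simp
    abel
  -- The second derivative of `ψ` occurs in both antisymmetrised terms and cancels by symmetry.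
  have hs := (hψ.of_le (by norm_num : (2 : WithTop ℕ∞) ≤ 3)).isSymmSndFDerivAt (by simp)
  rw [key, hθd, hθd, hs X Y]
  simp only [riemann, add_apply, sub_apply, ContinuousLinearMap.comp_apply]
  abel

theorem ricci_apply (g : E → E →L[ℝ] E →L[ℝ] ℝ) (u Y Z : E) :
    ricci g u Y Z = LinearMap.trace ℝ E (riemannLeft g u Y Z) := rfl

theorem riemannLeft_apply (g : E → E →L[ℝ] E →L[ℝ] ℝ) (u X Y Z : E) :
    riemannLeft g u Y Z X = riemann g u X Y Z := rfl

/-- A continuous bilinear form as a bilinear map. -/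
def formLin (B : E →L[ℝ] E →L[ℝ] ℝ) : E →ₗ[ℝ] E →ₗ[ℝ] ℝ :=
  ContinuousLinearMap.coeLM ℝ ∘ₗ B.toLinearMap

theorem formLin_apply (B : E →L[ℝ] E →L[ℝ] ℝ) (v w : E) : formLin B v w = B v w := rfl

/-- Also true for degenerate `B`, where both inverses have the default value `0`; so the scaling
rules below need no nondegeneracy. -/
theorem inverse_smul_form {c : ℝ} (hc : c ≠ 0) (B : E →L[ℝ] E →L[ℝ] ℝ) :
    (c • B).inverse = c⁻¹ • B.inverse := by
  by_cases hB : B.IsInvertible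
  · refine ContinuousLinearMap.inverse_eq ?_ ?_
    · ext v w
      simp [hB.self_apply_inverse, hc]
    · ext v
      simp [hB.inverse_apply_self, hc]
  · rw [ContinuousLinearMap.inverse_of_not_isInvertible hB,
      ContinuousLinearMap.inverse_of_not_isInvertible, smul_zero]
    rintro ⟨e, he⟩
    refine hB ⟨e.trans (ContinuousLinearEquiv.smulLeft (Units.mk0 c⁻¹ (inv_ne_zero hc))), ?_⟩
    ext v w
    have := congrArg (fun T => T v w) he
    simp only [ContinuousLinearEquiv.coe_coe] at this
    simp [this, Units.smul_def, hc]

/-- The factor `c` from the derivative of the metric cancels the factor `c⁻¹` from its inverse. -/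
theorem christoffel_smul {c : ℝ} (hc : c ≠ 0) (g : E → E →L[ℝ] E →L[ℝ] ℝ) :
    christoffel (fun u => c • g u) = christoffel g := by
  ext u X Y
  have h : ∀ g : E → E →L[ℝ] E →L[ℝ] ℝ, christoffel g u X Y =
    (g u).inverse (koszul (fderiv ℝ g u) X Y) := fun g => rfl
  have h2 : fderiv ℝ (fun u => c • g u) u = c • fderiv ℝ g u := by
    have := fderiv_const_smul_field (𝕜 := ℝ) (f := g) c
    exact congrFun this u
  have h3 : koszul (c • fderiv ℝ g u) X Y = c • koszul (fderiv ℝ g u) X Y := by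
    ext Z
    simp only [koszul_apply, smul_apply, smul_eq_mul]
    ring
  rw [h, h, h2, h3, inverse_smul_form hc]
  simp [hc]

variable [FiniteDimensional ℝ E]

theorem ricciEnd_def (g : E → E →L[ℝ] E →L[ℝ] ℝ) (u Y : E) :
    ricciEnd g u Y = (g u).inverse (LinearMap.toContinuousLinearMap (ricci g u Y)) := rfl

theorem apply_ricciEnd {g : E → E →L[ℝ] E →L[ℝ] ℝ} {u : E} (hinv : (g u).IsInvertible) (Y Z : E) :
    g u (ricciEnd g u Y) Z = ricci g u Y Z := by
  rw [ricciEnd_def, hinv.self_apply_inverse]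
  rfl

/-- The Ricci endomorphisms of a metric and of its pullback are conjugate. -/
theorem ricciEnd_pullback {g g' : E → E →L[ℝ] E →L[ℝ] ℝ} {ψ : E → E}
    {u : E} (hψ : ContDiffAt ℝ 3 ψ u) (hg' : ContDiffAt ℝ 2 g' (ψ u))
    (hsymm : ∀ᶠ v in 𝓝 (ψ u), ∀ a b, g' v a b = g' v b a)
    (hpos : ∀ᶠ v in 𝓝 (ψ u), ∀ a, a ≠ 0 → 0 < g' v a a)
    (hg : ∀ᶠ v in 𝓝 u, g v = pullForm (g' (ψ v)) (fderiv ℝ ψ v))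
    (hgpos : ∀ a, a ≠ 0 → 0 < g u a a) :
    ∃ L : E ≃ₗ[ℝ] E, ricciEnd g' (ψ u) = L.conj (ricciEnd g u) := by
  -- A vector in the kernel of the differential would have length zero for the positive definite
  -- pullback.
  have hinj : Function.Injective (fderiv ℝ ψ u).toLinearMap := by
    rw [injective_iff_map_eq_zero]
    intro a ha
    by_contra hne
    have h1 := hgpos a hne
    have h2 : fderiv ℝ ψ u a = 0 := ha
    rw [hg.self_of_nhds, pullForm_apply, h2] at h1
    simp at h1
  let L : E ≃ₗ[ℝ] E := LinearEquiv.ofInjectiveEndo _ hinj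
  have hL : ∀ a, L a = fderiv ℝ ψ u a := fun a => rfl
  have hinv : (fderiv ℝ ψ u).IsInvertible := ⟨L.toContinuousLinearEquiv, by ext a; rfl⟩
  have hR := riemann_pullback hψ hg' hsymm hpos hg hinv
  have hric : ∀ Y Z, ricci g' (ψ u) (L Y) (L Z) = ricci g u Y Z := by
    intro Y Z
    rw [ricci_apply, ricci_apply]
    have : riemannLeft g' (ψ u) (L Y) (L Z) = L.conj (riemannLeft g u Y Z) := by
      ext X
      rw [LinearEquiv.conj_apply_apply, riemannLeft_apply, riemannLeft_apply, hL (riemann _ _ _ _ _), hR,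
        ← hL, ← hL, ← hL, LinearEquiv.apply_symm_apply]
    rw [this, LinearMap.trace_conj']
  have hgi : (g u).IsInvertible := isInvertible_of_pos hgpos
  have hgi' : (g' (ψ u)).IsInvertible := isInvertible_of_pos hpos.self_of_nhds
  refine ⟨L, ?_⟩
  have : ∀ Y, ricciEnd g' (ψ u) (L Y) = L (ricciEnd g u Y) := by
    intro Y
    have h2 : g' (ψ u) (ricciEnd g' (ψ u) (L Y)) = g' (ψ u) (L (ricciEnd g u Y)) := by
      ext Z
      obtain ⟨W, rfl⟩ := L.surjective Z
      rw [apply_ricciEnd hgi', hric, ← apply_ricciEnd hgi, hg.self_of_nhds, pullForm_apply]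
      rw [hL, hL]
    have h3 := congrArg (g' (ψ u)).inverse h2
    rwa [hgi'.inverse_apply_self, hgi'.inverse_apply_self] at h3
  ext Y
  rw [LinearEquiv.conj_apply_apply, ← this, LinearEquiv.apply_symm_apply]

/-- The Ricci tensor itself is unchanged under constant scaling; the factor comes from raising one
index. -/
theorem ricciEnd_smul {c : ℝ} (hc : c ≠ 0) (g : E → E →L[ℝ] E →L[ℝ] ℝ) (u : E) :
    ricciEnd (fun u => c • g u) u = c⁻¹ • ricciEnd g u := by
  have h1 : ricci (fun u => c • g u) u = ricci g u := by
    ext Y Z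
    rw [ricci_apply, ricci_apply]
    congr 1
    ext X
    simp only [riemannLeft_apply, riemann, christoffel_smul hc]
  ext Y
  rw [ricciEnd_def, h1, inverse_smul_form hc]
  rfl

variable {ι : Type*} [Fintype ι] [DecidableEq ι]

theorem repr_eq_form {E : Type*} [AddCommGroup E] [Module ℝ E] {B : E →ₗ[ℝ] E →ₗ[ℝ] ℝ}
    (b : Module.Basis ι ℝ E) (hb : ∀ i j, B (b i) (b j) = if i = j then 1 else 0) (x : E) (i : ι) :
    b.repr x i = B x (b i) := by
  conv_rhs => rw [← b.sum_repr x, map_sum]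
  simp only [map_smul, LinearMap.sum_apply, LinearMap.smul_apply, hb]
  simp

theorem trace_eq_sum_form {E : Type*} [AddCommGroup E] [Module ℝ E] {B : E →ₗ[ℝ] E →ₗ[ℝ] ℝ}
    (b : Module.Basis ι ℝ E) (hb : ∀ i j, B (b i) (b j) = if i = j then 1 else 0)
    (T : E →ₗ[ℝ] E) : LinearMap.trace ℝ E T = ∑ i, B (T (b i)) (b i) := by
  rw [LinearMap.trace_eq_matrix_trace ℝ b, Matrix.trace]
  refine Finset.sum_congr rfl fun i _ => ?_
  rw [Matrix.diag_apply, LinearMap.toMatrix_apply, repr_eq_form b hb]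

/-- The trace defining the Ricci tensor does not see the scale of the metric. Only the outer
contraction does, so a basis orthonormal for `B` costs one factor `c⁻¹`. -/
theorem trace_ricciEnd_eq_sum {g : E → E →L[ℝ] E →L[ℝ] ℝ} {u : E} {B : E →L[ℝ] E →L[ℝ] ℝ} {c : ℝ}
    (hinv : (g u).IsInvertible) (hc : c ≠ 0) (hg : g u = c • B)
    (b : Module.Basis ι ℝ E) (hb : ∀ i j, B (b i) (b j) = if i = j then 1 else 0) :
    LinearMap.trace ℝ E (ricciEnd g u) =
      c⁻¹ * ∑ j, ∑ i, B (riemann g u (b i) (b j) (b j)) (b i) := by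
  rw [trace_eq_sum_form (B := formLin B) b hb, Finset.mul_sum]
  refine Finset.sum_congr rfl fun j _ => ?_
  have h1 : B (ricciEnd g u (b j)) (b j) = c⁻¹ * g u (ricciEnd g u (b j)) (b j) := by
    rw [hg]; simp [hc]
  rw [formLin_apply, h1, apply_ricciEnd hinv, ricci_apply, trace_eq_sum_form (B := formLin B) b hb]
  rfl

end Naturality

/-! ### The index computation behind the conformal scalar curvature -/

section Tensor

variable {ι : Type*} [Fintype ι]

theorem sum_cyclic (F : ι → ι → ι → ℝ) :
    ∑ i, ∑ j, ∑ k, F j k i = ∑ i, ∑ j, ∑ k, F i j k := by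
  rw [Finset.sum_comm]
  refine Finset.sum_congr rfl fun j _ => ?_
  rw [Finset.sum_comm]

/-- The curvature contraction of the connection with coefficients `t + s`, where `t` are the
Levi-Civita coefficients of a unimodular bracket with structure constants `c`, and `s` is the
conformal correction with covector `p` and second derivative `q`. -/
theorem conformal_contraction [DecidableEq ι] {c t W : ι → ι → ι → ℝ} {p : ι → ℝ} {q : ι → ι → ℝ}
    (hskew : ∀ i j k, c i j k = -c j i k) (huni : ∀ a, ∑ i, c a i i = 0)
    (ht : ∀ i j k, t i j k = 1 / 2 * (c i j k - c j k i + c k i j))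
    (hW : ∀ i j k, W i j k = t i j k + (p i * (if j = k then 1 else 0) +
      p j * (if i = k then 1 else 0) - (if i = j then 1 else 0) * p k)) :
    ∑ j, ∑ i, ((q i j * (if j = i then 1 else 0) + q i j * (if j = i then 1 else 0) - q i i) -
      (q j i * (if j = i then 1 else 0) + q j j - (if i = j then 1 else 0) * q j i) -
      ∑ k, c i j k * W k j i + ∑ k, W j j k * W i k i - ∑ k, W i j k * W j k i) =
    (-1 / 4 * ∑ i, ∑ j, ∑ k, c i j k * c i j k - 1 / 2 * ∑ i, ∑ j, ∑ k, c i j k * c i k j) -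
      2 * (Fintype.card ι - 1) * ∑ i, q i i -
      (Fintype.card ι - 1) * (Fintype.card ι - 2) * ∑ i, p i * p i := by
  have hcii : ∀ i k, c i i k = 0 := fun i k => by linarith [hskew i i k]
  have huni' : ∀ a, ∑ i, c i a i = 0 := fun a => by
    have : ∀ i, c i a i = -c a i i := fun i => hskew i a i
    simp [this, huni]
  have t1 : ∀ k, ∑ j, t j j k = 0 := fun k => by
    have : ∀ j, t j j k = c k j j := fun j => by
      rw [ht, hcii, hskew j k j]; ring
    simp [this, huni]
  have tskew : ∀ i j k, t i j k = -t i k j := fun i j k => by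
    rw [ht, ht, hskew i k j, hskew k j i, hskew j i k]; ring
  have t0 : ∀ i j, t i j j = 0 := fun i j => by linarith [tskew i j j]
  have t2 : ∀ k, ∑ i, t i k i = 0 := fun k => by
    have : ∀ i, t i k i = -t i i k := fun i => tskew i k i
    simp [this, t1]
  -- Unimodularity kills both traces of `t`, so the traces of `W` are multiples of `p`.
  have hW1 : ∀ k, ∑ j, W j j k = (2 - Fintype.card ι) * p k := fun k => by
    simp only [hW, Finset.sum_add_distrib, Finset.sum_sub_distrib, t1]
    simp
    ring
  have hW2 : ∀ k, ∑ i, W i k i = Fintype.card ι * p k := fun k => by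
    simp only [hW, Finset.sum_add_distrib, Finset.sum_sub_distrib, t2]
    simp
  -- The contraction is split into the product of traces (`P1`), the second derivatives (`P2`), the
  -- bracket term (`P3`) and the remaining quadratic term (`P4`).
  have P1 : ∑ j, ∑ i, ∑ k, W j j k * W i k i =
      (2 - Fintype.card ι) * Fintype.card ι * ∑ i, p i * p i := by
    have : ∀ j, ∑ i, ∑ k, W j j k * W i k i = ∑ k, W j j k * (Fintype.card ι * p k) := by
      intro j
      rw [Finset.sum_comm]
      refine Finset.sum_congr rfl fun k _ => ?_
      rw [← Finset.mul_sum, hW2]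
    simp only [this]
    rw [Finset.sum_comm, Finset.mul_sum]
    refine Finset.sum_congr rfl fun k _ => ?_
    rw [← Finset.sum_mul, hW1]
    ring
  have P2 : ∑ j, ∑ i, ((q i j * (if j = i then 1 else 0) + q i j * (if j = i then 1 else 0) -
      q i i) - (q j i * (if j = i then 1 else 0) + q j j - (if i = j then 1 else 0) * q j i)) =
      -2 * (Fintype.card ι - 1) * ∑ i, q i i := by
    simp only [Finset.sum_add_distrib, Finset.sum_sub_distrib]
    simp [← Finset.mul_sum]
    ring
  have Q : ∑ i, ∑ j, ∑ k, c i j k * c j k i = -∑ i, ∑ j, ∑ k, c i j k * c i k j := by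
    rw [← sum_cyclic]
    simp only [← Finset.sum_neg_distrib]
    rw [← sum_cyclic]
    refine Finset.sum_congr rfl fun i _ => Finset.sum_congr rfl fun j _ =>
      Finset.sum_congr rfl fun k _ => ?_
    rw [hskew k i j]
    ring
  have P3 : ∑ j, ∑ i, ∑ k, c i j k * W k j i =
      1 / 2 * ∑ i, ∑ j, ∑ k, c i j k * c i j k + ∑ i, ∑ j, ∑ k, c i j k * c i k j := by
    rw [Finset.sum_comm]
    have e : ∀ i j k, c i j k * W k j i = (1 / 2 * (c i j k * c i j k) +
        1 / 2 * (c i j k * c i k j) - 1 / 2 * (c i j k * c j k i)) +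
        (c i j k * p k * (if j = i then 1 else 0) + c i j k * p j * (if k = i then 1 else 0) -
        c i j k * p i * (if k = j then 1 else 0)) := fun i j k => by
      rw [hW, ht, hskew k j i, hskew j i k]; ring
    simp only [e, Finset.sum_add_distrib, Finset.sum_sub_distrib, ← Finset.mul_sum, Q]
    have z1 : ∑ i, ∑ j, ∑ k, c i j k * p k * (if j = i then (1 : ℝ) else 0) = 0 := by
      refine Finset.sum_eq_zero fun i _ => Finset.sum_eq_zero fun j _ =>
        Finset.sum_eq_zero fun k _ => ?_
      split_ifs with h
      · rw [h, hcii]; ring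
      · ring
    have z2 : ∑ i, ∑ j, ∑ k, c i j k * p j * (if k = i then (1 : ℝ) else 0) = 0 := by
      rw [Finset.sum_comm]
      refine Finset.sum_eq_zero fun j _ => ?_
      simp [← Finset.sum_mul, huni']
    have z3 : ∑ i, ∑ j, ∑ k, c i j k * p i * (if k = j then (1 : ℝ) else 0) = 0 := by
      refine Finset.sum_eq_zero fun i _ => ?_
      simp [← Finset.sum_mul, huni]
    rw [z1, z2, z3]
    ring
  have P4 : ∑ j, ∑ i, ∑ k, W i j k * W j k i =
      -1 / 4 * ∑ i, ∑ j, ∑ k, c i j k * c i j k - 1 / 2 * ∑ i, ∑ j, ∑ k, c i j k * c i k j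
      + (2 - Fintype.card ι) * ∑ i, p i * p i := by
    rw [Finset.sum_comm]
    -- The product of the two `t` coefficients is a difference of squares in the structure
    -- constants. The mixed terms sum to zero by the trace identities for `t`, and the square of the
    -- conformal correction is the sum `ss`.
    have e : ∀ i j k, W i j k * W j k i = (1 / 4 * (c i j k * c i j k) -
        (1 / 4 * (c k i j * c k i j) + 1 / 4 * (c j k i * c j k i) - 1 / 2 * (c j k i * c k i j))) +
        ((t i j k * p j * (if k = i then 1 else 0) + t i j k * p k * (if j = i then 1 else 0) -
          t i j k * p i * (if j = k then 1 else 0)) +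
        (t j k i * p i * (if j = k then 1 else 0) + t j k i * p j * (if i = k then 1 else 0) -
          t j k i * p k * (if i = j then 1 else 0))) +
        (p i * (if j = k then 1 else 0) + p j * (if i = k then 1 else 0) -
          (if i = j then 1 else 0) * p k) *
        (p j * (if k = i then 1 else 0) + p k * (if j = i then 1 else 0) -
          (if j = k then 1 else 0) * p i) := fun i j k => by
      rw [hW, hW, ht i j k, ht j k i]; ring
    have z1 : ∑ i, ∑ j, ∑ k, t i j k * p j * (if k = i then (1 : ℝ) else 0) = 0 := by
      rw [Finset.sum_comm]
      refine Finset.sum_eq_zero fun j _ => ?_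
      simp [← Finset.sum_mul, t2]
    have z2 : ∑ i, ∑ j, ∑ k, t i j k * p k * (if j = i then (1 : ℝ) else 0) = 0 := by
      have : ∀ i, ∑ j, ∑ k, t i j k * p k * (if j = i then (1 : ℝ) else 0) =
          ∑ k, t i i k * p k := fun i => by
        rw [Finset.sum_comm]; simp
      simp only [this]
      rw [Finset.sum_comm]
      simp [← Finset.sum_mul, t1]
    have z3 : ∑ i, ∑ j, ∑ k, t i j k * p i * (if j = k then (1 : ℝ) else 0) = 0 := by
      simp [t0]
    have e4 : ∑ i, ∑ j, ∑ k, t j k i * p i * (if j = k then (1 : ℝ) else 0) = 0 :=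
      (sum_cyclic fun i j k => t i j k * p k * (if i = j then (1 : ℝ) else 0)).trans
        (by simpa only [eq_comm] using z2)
    have e5 : ∑ i, ∑ j, ∑ k, t j k i * p j * (if i = k then (1 : ℝ) else 0) = 0 :=
      (sum_cyclic fun i j k => t i j k * p i * (if k = j then (1 : ℝ) else 0)).trans
        (by simpa only [eq_comm] using z3)
    have e6 : ∑ i, ∑ j, ∑ k, t j k i * p k * (if i = j then (1 : ℝ) else 0) = 0 :=
      (sum_cyclic fun i j k => t i j k * p j * (if k = i then (1 : ℝ) else 0)).trans z1
    have c1 : ∑ i, ∑ j, ∑ k, c j k i * c j k i = ∑ i, ∑ j, ∑ k, c i j k * c i j k :=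
      sum_cyclic fun i j k => c i j k * c i j k
    have c2 : ∑ i, ∑ j, ∑ k, c k i j * c k i j = ∑ i, ∑ j, ∑ k, c i j k * c i j k :=
      (sum_cyclic fun i j k => c k i j * c k i j).symm.trans rfl
    have c3 : ∑ i, ∑ j, ∑ k, c j k i * c k i j = -∑ i, ∑ j, ∑ k, c i j k * c i k j :=
      (sum_cyclic fun i j k => c i j k * c j k i).trans Q
    have ss : ∑ i, ∑ j, ∑ k, (p i * (if j = k then (1 : ℝ) else 0) + p j * (if i = k then 1 else 0) -
          (if i = j then 1 else 0) * p k) *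
        (p j * (if k = i then 1 else 0) + p k * (if j = i then 1 else 0) -
          (if j = k then 1 else 0) * p i) = (2 - Fintype.card ι) * ∑ i, p i * p i := by
      have : ∀ i j, ∑ k, (p i * (if j = k then (1 : ℝ) else 0) + p j * (if i = k then 1 else 0) -
          (if i = j then 1 else 0) * p k) *
        (p j * (if k = i then 1 else 0) + p k * (if j = i then 1 else 0) -
          (if j = k then 1 else 0) * p i) = p j * p j - p i * p i +
          (if i = j then (1 : ℝ) else 0) * (2 * (p i * p i) - ∑ k, p k * p k) := by
        intro i j
        by_cases h : i = j
        · subst h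
          have : ∀ k, (p i * (if i = k then (1 : ℝ) else 0) + p i * (if i = k then 1 else 0) -
              (if i = i then 1 else 0) * p k) * (p i * (if k = i then 1 else 0) +
              p k * (if i = i then 1 else 0) - (if i = k then 1 else 0) * p i) =
              (if k = i then (1 : ℝ) else 0) * (2 * (p i * p k)) - p k * p k := fun k => by
            by_cases hk : k = i
            · subst hk
              simp
              ring
            · have hk' : ¬ i = k := fun h2 => hk h2.symm
              simp [hk, hk']
          rw [Finset.sum_congr rfl fun k _ => this k, Finset.sum_sub_distrib]
          simp
        · have h' : ¬ j = i := fun h2 => h h2.symm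
          have : ∀ k, (p i * (if j = k then (1 : ℝ) else 0) + p j * (if i = k then 1 else 0) -
              (if i = j then 1 else 0) * p k) * (p j * (if k = i then 1 else 0) +
              p k * (if j = i then 1 else 0) - (if j = k then 1 else 0) * p i) =
              (if k = i then (1 : ℝ) else 0) * (p j * p j) -
              (if k = j then (1 : ℝ) else 0) * (p i * p i) := fun k => by
            simp only [h, h', if_false]
            by_cases hk : k = i
            · subst hk
              simp [h, h']
            · by_cases hk' : k = j
              · subst hk'
                simp [h, h']
              · have h1 : ¬ i = k := fun h2 => hk h2.symm
                have h2 : ¬ j = k := fun h2 => hk' h2.symm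
                simp [hk, hk', h1, h2]
          simp only [this, Finset.sum_sub_distrib]
          simp [h]
      simp only [this, Finset.sum_add_distrib, Finset.sum_sub_distrib]
      simp [← Finset.mul_sum]
      ring
    simp only [e, Finset.sum_add_distrib, Finset.sum_sub_distrib, ← Finset.mul_sum] at ss ⊢
    rw [ss, z1, z2, z3, e4, e5, e6, c1, c2, c3]
    ring
  simp only [Finset.sum_add_distrib, Finset.sum_sub_distrib] at P2 ⊢
  rw [P1, P3, P4]
  linarith [P2]

end Tensor

/-! ### Scalar curvature of a conformal change of a left invariant metric -/

section Conformal

variable {E : Type*} [NormedAddCommGroup E] [NormedSpace ℝ E]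
  {ι : Type*} [Fintype ι] [DecidableEq ι]

/-- `(ℓ, a, c) ↦ ℓ(a) c + ℓ(c) a - B(a, c) ℓ♯`, the change of the Levi-Civita connection under a
conformal change with logarithmic derivative `ℓ`. -/
def conformalShift (B : E →L[ℝ] E →L[ℝ] ℝ) : (E →L[ℝ] ℝ) →L[ℝ] E →L[ℝ] E →L[ℝ] E :=
  (ContinuousLinearMap.smulRightL ℝ E (E →L[ℝ] E)).flip (.id ℝ E) +
    ((ContinuousLinearMap.flipₗᵢ ℝ E E E).toContinuousLinearEquiv :
      (E →L[ℝ] E →L[ℝ] E) →L[ℝ] E →L[ℝ] E →L[ℝ] E).comp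
      ((ContinuousLinearMap.smulRightL ℝ E (E →L[ℝ] E)).flip (.id ℝ E)) -
    (((ContinuousLinearMap.smulRightL ℝ E E).comp B).flip).comp B.inverse

theorem conformalShift_apply (B : E →L[ℝ] E →L[ℝ] ℝ) (l : E →L[ℝ] ℝ) (a c : E) :
    conformalShift B l a c = l a • c + l c • a - B a c • B.inverse l := by
  simp [conformalShift]

theorem apply_conformalShift {B : E →L[ℝ] E →L[ℝ] ℝ} (hB : B.IsInvertible)
    (l : E →L[ℝ] ℝ) (a c d : E) :
    B (conformalShift B l a c) d = l a * B c d + l c * B a d - B a c * l d := by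
  rw [conformalShift_apply]
  simp [hB.self_apply_inverse]

variable [FiniteDimensional ℝ E]

/-- The Levi-Civita connection of a left invariant metric, evaluated on left invariant fields. -/
theorem exists_leviCivita (B : E →L[ℝ] E →L[ℝ] ℝ) (br : E →L[ℝ] E →L[ℝ] E)
    (b : Module.Basis ι ℝ E) (hb : ∀ i j, B (b i) (b j) = if i = j then 1 else 0) :
    ∃ N : E →L[ℝ] E →L[ℝ] E, ∀ a c d,
      B (N a c) d = 1 / 2 * (B (br a c) d - B (br c d) a + B (br d a) c) := by
  let N : E →ₗ[ℝ] E →ₗ[ℝ] E := LinearMap.mk₂ ℝ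
    (fun a c => ∑ k, (1 / 2 * (B (br a c) (b k) - B (br c (b k)) a + B (br (b k) a) c)) • b k)
    (fun a a' c => by
      rw [← Finset.sum_add_distrib]
      refine Finset.sum_congr rfl fun k _ => ?_
      rw [← add_smul]
      simp only [map_add, add_apply]
      congr 1; ring)
    (fun s a c => by
      rw [Finset.smul_sum]
      refine Finset.sum_congr rfl fun k _ => ?_
      rw [smul_smul]
      simp only [map_smul, smul_apply, smul_eq_mul]
      congr 1; ring)
    (fun a c c' => by
      rw [← Finset.sum_add_distrib]
      refine Finset.sum_congr rfl fun k _ => ?_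
      rw [← add_smul]
      simp only [map_add, add_apply]
      congr 1; ring)
    (fun s a c => by
      rw [Finset.smul_sum]
      refine Finset.sum_congr rfl fun k _ => ?_
      rw [smul_smul]
      simp only [map_smul, smul_apply, smul_eq_mul]
      congr 1; ring)
  refine ⟨N.toContinuousBilinearMap, fun a c d => ?_⟩
  have h1 : ∀ k, B (N a c) (b k) =
      1 / 2 * (B (br a c) (b k) - B (br c (b k)) a + B (br (b k) a) c) := by
    intro k
    have : N a c = ∑ k, (1 / 2 * (B (br a c) (b k) - B (br c (b k)) a + B (br (b k) a) c)) • b k :=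
      rfl
    rw [this, map_sum, sum_apply]
    simp only [map_smul, smul_apply, hb, smul_eq_mul]
    simp
  -- Both sides are linear in the last argument, so the formula on basis vectors suffices.
  have h2 : (B (N a c)).toLinearMap = (1 / 2 : ℝ) • ((B (br a c)).toLinearMap -
      (formLin B).flip a ∘ₗ (br c).toLinearMap +
      (formLin B).flip c ∘ₗ (br.flip a).toLinearMap) := by
    refine b.ext fun k => ?_
    simpa [formLin_apply, mul_add] using h1 k
  have := congrArg (fun T => T d) h2
  simpa [formLin_apply, mul_add] using this

/-- The scalar curvature, at the base point, of the conformal change `e^{2f} B(A·, A·)` of a left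
invariant metric on a unimodular group. Here `A` is the Maurer-Cartan form in a chart, and `f₁` is
the derivative of `f` in the left invariant frame. -/
theorem trace_ricciEnd_conformal {A : E → E →L[ℝ] E} {B : E →L[ℝ] E →L[ℝ] ℝ}
    {br : E →L[ℝ] E →L[ℝ] E} {f : E → ℝ} {f₁ : E → E →L[ℝ] ℝ} {u : E}
    (hA : ContDiffAt ℝ 2 A u) (hAu : A u = .id ℝ E) (hf : ContDiffAt ℝ 2 f u)
    (hf₁ : DifferentiableAt ℝ f₁ u)
    (hMC : ∀ᶠ v in 𝓝 u, ∀ X Y, fderiv ℝ A v X Y - fderiv ℝ A v Y X = -br (A v X) (A v Y))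
    (hdf : ∀ᶠ v in 𝓝 u, ∀ X, fderiv ℝ f v X = f₁ v (A v X))
    (hsymm : ∀ a c, B a c = B c a) (hpos : ∀ a, a ≠ 0 → 0 < B a a)
    (hbr : ∀ a c, br a c = -br c a)
    (b : Module.Basis ι ℝ E) (hb : ∀ i j, B (b i) (b j) = if i = j then 1 else 0)
    (huni : ∀ a, ∑ i, B (br a (b i)) (b i) = 0) :
    LinearMap.trace ℝ E (ricciEnd (fun v => Real.exp (2 * f v) • pullForm B (A v)) u) =
      Real.exp (-2 * f u) * ((-1 / 4 * ∑ i, ∑ j, B (br (b i) (b j)) (br (b i) (b j)) -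
        1 / 2 * ∑ i, ∑ j, B (br (b i) (br (b i) (b j))) (b j)) -
        2 * (Fintype.card ι - 1) * ∑ i, fderiv ℝ f₁ u (b i) (b i) -
        (Fintype.card ι - 1) * (Fintype.card ι - 2) * ∑ i, f₁ u (b i) * f₁ u (b i)) := by
  have : CompleteSpace E := FiniteDimensional.complete ℝ E
  obtain ⟨N, hN⟩ := exists_leviCivita B br b hb
  have hBi := isInvertible_of_pos hpos
  set g : E → E →L[ℝ] E →L[ℝ] ℝ := fun v => Real.exp (2 * f v) • pullForm B (A v) with hgdef
  set τ := conformalShift B with hτ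
  -- The Levi-Civita connection of the conformal metric in the left invariant frame. The part `N` is
  -- skew for `B` and carries the torsion `br`. The shift `τ` is symmetric, and its failure to be
  -- skew, `2 ℓ(a) B`, matches the derivative of `e^{2f} B`.
  set W : E → E →L[ℝ] E →L[ℝ] E := fun v => N + τ (f₁ v) with hW
  have hext : ∀ x y : E, (∀ d, B x d = B y d) → x = y := by
    intro x y h
    have : B x = B y := by ext d; exact h d
    rw [← hBi.inverse_apply_self x, this, hBi.inverse_apply_self]
  have hNt : ∀ a c, N a c - N c a = br a c := by
    intro a c
    refine hext _ _ fun d => ?_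
    rw [map_sub, sub_apply, hN, hN, hbr c a, hbr d c, hbr a d]
    simp only [map_neg, neg_apply]
    ring
  have hτs : ∀ l a c, τ l a c = τ l c a := by
    intro l a c
    rw [hτ, conformalShift_apply, conformalShift_apply, hsymm a c]
    abel
  have hWt : ∀ v a c, W v a c - W v c a = br a c := by
    intro v a c
    simp only [hW, add_apply]
    rw [hτs, ← hNt]
    abel
  have hexp : ContDiffAt ℝ 2 (fun v => Real.exp (2 * f v)) u := (contDiffAt_const.mul hf).exp
  have hGc : ContDiffAt ℝ 2 (fun v => Real.exp (2 * f v) • B) u := hexp.smul contDiffAt_const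
  have hgc : ContDiffAt ℝ 2 g u := hexp.smul (contDiffAt_pullForm hA contDiffAt_const)
  have hAinv : ∀ᶠ v in 𝓝 u, (A v).IsInvertible :=
    eventually_isInvertible hA.continuousAt (by rw [hAu]; exact ⟨.refl ℝ E, rfl⟩)
  have hginv : ∀ᶠ v in 𝓝 u, (g v).IsInvertible := by
    filter_upwards [hAinv] with v h1
    refine isInvertible_of_pos fun a ha => ?_
    have : 0 < B (A v a) (A v a) := hpos _ fun h0 => ha (by
      rw [← h1.inverse_apply_self a, h0, map_zero])
    exact mul_pos (Real.exp_pos _) this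
  have hWd : HasFDerivAt W (τ.comp (fderiv ℝ f₁ u)) u :=
    ((τ.hasFDerivAt.comp u hf₁.hasFDerivAt).const_add N :)
  have hAd : DifferentiableAt ℝ A u := hA.differentiableAt (by norm_num)
  have hθ := hWd.clm_comp hAd.hasFDerivAt
  have hfd : ∀ᶠ v in 𝓝 u, DifferentiableAt ℝ f v :=
    (hf.eventually (by simp)).mono fun v hv => hv.differentiableAt (by norm_num)
  have key := frame_riemann (g := g) (u := u) (A := A) (G := fun v => Real.exp (2 * f v) • B)
    (θ := fun v => (W v).comp (A v)) hgc hA (hGc.of_le (by norm_num)) hθ.differentiableAt hginv hAinv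
    (Filter.Eventually.of_forall fun v => by ext; rfl)
    (Filter.Eventually.of_forall fun v a c => by simp [hsymm a c])
    (by
      filter_upwards [hdf, hfd] with v h1 h2 X a c
      have hd : HasFDerivAt (fun v => Real.exp (2 * f v) • B)
          (((Real.exp (2 * f v)) • ((2 : ℝ) • fderiv ℝ f v)).smulRight B) v :=
        ((h2.hasFDerivAt.const_mul 2).exp.smul_const B :)
      rw [hd.fderiv]
      simp only [ContinuousLinearMap.smulRight_apply, smul_apply, smul_eq_mul, h1,
        ContinuousLinearMap.comp_apply, hW, add_apply, map_add]
      rw [hsymm a (N _ c), hsymm a (τ _ _ c), apply_conformalShift hBi, apply_conformalShift hBi,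
        hN, hN, hbr c a, hbr (A v X) a, hbr c (A v X), hsymm c a]
      simp only [map_neg, neg_apply]
      ring)
    (by
      filter_upwards [hMC] with v h1 X Y
      have h2 := h1 X Y
      have h3 := hWt v (A v X) (A v Y)
      simp only [ContinuousLinearMap.comp_apply]
      rw [← h3] at h2
      rw [← sub_eq_zero]
      rw [← sub_eq_zero] at h2
      rw [← h2]
      abel)
  have hθd : ∀ X Y, fderiv ℝ (fun v => (W v).comp (A v)) u X Y =
      τ (fderiv ℝ f₁ u X) Y + W u (fderiv ℝ A u X Y) := by
    intro X Y
    have h1 : fderiv ℝ (fun v => (W v).comp (A v)) u = _ := hθ.fderiv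
    rw [h1]
    simp [hAu]
    abel
  -- At the base point the frame is the identity, and the Maurer-Cartan equation turns the
  -- antisymmetrised derivative of `A` into the bracket.
  have hR : ∀ X Y Z, riemann g u X Y Z = τ (fderiv ℝ f₁ u X) Y Z - τ (fderiv ℝ f₁ u Y) X Z -
      W u (br X Y) Z + W u X (W u Y Z) - W u Y (W u X Z) := by
    intro X Y Z
    have h1 := key X Y Z
    have h2 := hMC.self_of_nhds X Y
    rw [hAu] at h1 h2
    simp only [ContinuousLinearMap.comp_apply, ContinuousLinearMap.id_apply, hθd, add_apply] at h1 h2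
    rw [h1]
    have h3 : W u (br X Y) Z = W u (fderiv ℝ A u Y X) Z - W u (fderiv ℝ A u X Y) Z := by
      have : br X Y = fderiv ℝ A u Y X - fderiv ℝ A u X Y := by
        rw [← neg_sub, h2, neg_neg]
      rw [this, map_sub, sub_apply]
    rw [h3]
    abel
  have hgu : g u = Real.exp (2 * f u) • B := by
    rw [hgdef]
    ext
    simp [pullForm_apply, hAu]
  rw [trace_ricciEnd_eq_sum hginv.self_of_nhds (Real.exp_pos _).ne' hgu b hb, ← Real.exp_neg,
    neg_mul]
  congr 1
  have hexpand : ∀ x : E, x = ∑ k, B x (b k) • b k := by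
    intro x
    conv_lhs => rw [← b.sum_repr x]
    exact Finset.sum_congr rfl fun k _ => by rw [repr_eq_form (B := formLin B) b hb]; rfl
  have hlin : ∀ (T : E →L[ℝ] ℝ) (x : E), T x = ∑ k, B x (b k) * T (b k) := by
    intro T x
    conv_lhs => rw [hexpand x]
    simp
  have hcc := conformal_contraction (c := fun i j k => B (br (b i) (b j)) (b k))
    (t := fun i j k => B (N (b i) (b j)) (b k)) (W := fun i j k => B (W u (b i) (b j)) (b k))
    (p := fun i => f₁ u (b i)) (q := fun i j => fderiv ℝ f₁ u (b i) (b j))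
    (fun i j k => by rw [hbr]; simp) (fun a => huni _) (fun i j k => hN _ _ _)
    (fun i j k => by
      simp only [hW, add_apply, map_add, hτ]
      rw [apply_conformalShift hBi, hb, hb, hb])
  have e1 : ∀ i j, ∑ k, B (br (b i) (b j)) (b k) * B (br (b i) (b j)) (b k) =
      B (br (b i) (b j)) (br (b i) (b j)) := fun i j => (hlin _ _).symm
  have e2 : ∀ i j, ∑ k, B (br (b i) (b j)) (b k) * B (br (b i) (b k)) (b j) =
      B (br (b i) (br (b i) (b j))) (b j) := fun i j =>
    (hlin ((B.flip (b j)).comp (br (b i))) _).symm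
  simp only [e1, e2] at hcc
  rw [← hcc]
  refine Finset.sum_congr rfl fun j _ => Finset.sum_congr rfl fun i _ => ?_
  rw [hR]
  simp only [map_sub, map_add, sub_apply, add_apply]
  have e3 : B (W u (br (b i) (b j)) (b j)) (b i) =
      ∑ k, B (br (b i) (b j)) (b k) * B (W u (b k) (b j)) (b i) :=
    hlin ((B.flip (b i)).comp ((W u).flip (b j))) _
  have e4 : B (W u (b i) (W u (b j) (b j))) (b i) =
      ∑ k, B (W u (b j) (b j)) (b k) * B (W u (b i) (b k)) (b i) :=
    hlin ((B.flip (b i)).comp (W u (b i))) _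
  have e5 : B (W u (b j) (W u (b i) (b j))) (b i) =
      ∑ k, B (W u (b i) (b j)) (b k) * B (W u (b j) (b k)) (b i) :=
    hlin ((B.flip (b i)).comp (W u (b j))) _
  rw [e3, e4, e5, apply_conformalShift hBi, apply_conformalShift hBi, hb, hb, hb, hb]
  simp only [if_true, one_mul, mul_one]

end Conformal

/-! ### Curvature invariants on manifolds and local isometries -/

section ManifoldNaturality

variable {E H H' : Type*} [NormedAddCommGroup E] [NormedSpace ℝ E] [TopologicalSpace H]
  [TopologicalSpace H'] {I : ModelWithCorners ℝ E H} {J : ModelWithCorners ℝ E H'}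
  {M : Type*} [TopologicalSpace M] [ChartedSpace H M]
  {N : Type*} [TopologicalSpace N] [ChartedSpace H' N]

/-- A smooth Riemannian metric. -/
structure IsSmoothMetric (g : MetricField I M) : Prop where
  symm : ∀ x v w, g x v w = g x w v
  pos : ∀ x v, v ≠ 0 → 0 < g x v v
  smooth : ∀ p, ContDiffAt ℝ ∞ (metricInChart I g p) (extChartAt I p p)

/-- All tangent spaces are by definition the model space, so values at equal points can be compared
without transporting vectors. -/
theorem metricField_congr (g : MetricField I M) {x y : M} (h : x = y) {v w v' w' : E}
    (hv : v = v') (hw : w = w') :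
    (g x : E →L[ℝ] E →L[ℝ] ℝ) v w = (g y : E →L[ℝ] E →L[ℝ] ℝ) v' w' := by
  subst h hv hw; rfl

theorem metricInChart_apply (g : MetricField I M) (p : M) (u v w : E) :
    metricInChart I g p u v w = (g ((extChartAt I p).symm u) : E →L[ℝ] E →L[ℝ] ℝ)
      ((mfderiv 𝓘(ℝ, E) I (extChartAt I p).symm u : E →L[ℝ] E) v)
      ((mfderiv 𝓘(ℝ, E) I (extChartAt I p).symm u : E →L[ℝ] E) w) := rfl

theorem ricciNormSq_smul [FiniteDimensional ℝ E] {c : ℝ} (hc : c ≠ 0) (g : MetricField I M) (p : M) :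
    ricciNormSq I (fun x => c • g x) p = (c⁻¹ * c⁻¹) * ricciNormSq I g p := by
  have : metricInChart I (fun x => c • g x) p = fun u => c • metricInChart I g p u := rfl
  rw [ricciNormSq, ricciNormSq, this, ricciEnd_smul hc, LinearMap.smul_comp, LinearMap.comp_smul,
    smul_smul, map_smul, smul_eq_mul]

variable [I.Boundaryless] [J.Boundaryless]

theorem mdifferentiableAt_extChartAt_symm [IsManifold I ∞ M] {p : M} {u : E}
    (hu : u ∈ (extChartAt I p).target) :
    MDifferentiableAt 𝓘(ℝ, E) I (extChartAt I p).symm u :=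
  ((contMDiffOn_extChartAt_symm (n := ∞) p).contMDiffAt
    ((isOpen_extChartAt_target p).mem_nhds hu)).mdifferentiableAt (by simp)

theorem isInvertible_mfderiv_extChartAt_symm [IsManifold I ∞ M] {p : M} {u : E}
    (hu : u ∈ (extChartAt I p).target) :
    (mfderiv 𝓘(ℝ, E) I (extChartAt I p).symm u).IsInvertible := by
  have : IsManifold I 1 M := IsManifold.of_le (n := ∞) (by simp)
  have := isInvertible_mfderivWithin_extChartAt_symm hu
  rwa [I.range_eq_univ, mfderivWithin_univ] at this

theorem eventually_mem_target (p : M) :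
    ∀ᶠ u in 𝓝 (extChartAt I p p), u ∈ (extChartAt I p).target :=
  (isOpen_extChartAt_target p).mem_nhds (mem_extChartAt_target p)

theorem metricInChart_pos [IsManifold I ∞ M] {g : MetricField I M}
    (hg : ∀ x v, v ≠ 0 → 0 < g x v v) {p : M} {u : E} (hu : u ∈ (extChartAt I p).target) (v : E)
    (hv : v ≠ 0) : 0 < metricInChart I g p u v v := by
  rw [metricInChart_apply]
  refine hg _ _ fun h0 => hv ?_
  have := (isInvertible_mfderiv_extChartAt_symm hu).inverse_apply_self v
  rw [← this]
  have h1 : mfderiv 𝓘(ℝ, E) I (extChartAt I p).symm u v = 0 := h0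
  rw [h1, map_zero]
  rfl

/-- Naturality of the Ricci endomorphism under local isometries. -/
theorem exists_conj_ricciEnd [FiniteDimensional ℝ E] [IsManifold I ∞ M] [IsManifold J ∞ N]
    {F : M → N} {p : M} (hF : ContMDiffAt I J ∞ F p) {g : MetricField I M} {g' : MetricField J N}
    (hg : ∀ x v, v ≠ 0 → 0 < g x v v) (hg' : IsSmoothMetric g')
    (h : ∀ᶠ x in 𝓝 p, pullbackMetric I J F g' x = g x) :
    ∃ L : E ≃ₗ[ℝ] E, ricciEnd (metricInChart J g' (F p)) (extChartAt J (F p) (F p)) =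
      L.conj (ricciEnd (metricInChart I g p) (extChartAt I p p)) := by
  set φ := extChartAt I p with hφ
  set χ := extChartAt J (F p) with hχ
  set ψ : E → E := χ ∘ F ∘ φ.symm with hψdef
  have hφs : φ.symm (φ p) = p := extChartAt_to_inv p
  have hψp : ψ (φ p) = χ (F p) := by simp only [hψdef, Function.comp_apply, hφs]
  have hψ : ContDiffAt ℝ ∞ ψ (φ p) := by
    have := (contMDiffAt_iff.1 hF).2
    rwa [I.range_eq_univ, contDiffWithinAt_univ] at this
  have hsc : ContinuousAt φ.symm (φ p) := continuousAt_extChartAt_symm p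
  have hsc' : Filter.Tendsto φ.symm (𝓝 (φ p)) (𝓝 p) := by
    have := hsc.tendsto
    rwa [hφs] at this
  have hFm : ∀ᶠ x in 𝓝 p, MDifferentiableAt I J F x := by
    have h1 : ContMDiffAt I J 1 F p := hF.of_le (by simp)
    have : IsManifold I 1 M := IsManifold.of_le (n := ∞) (by simp)
    have : IsManifold J 1 N := IsManifold.of_le (n := ∞) (by simp)
    exact ((contMDiffAt_iff_contMDiffAt_nhds (by simp)).1 h1).mono
      fun x hx => hx.mdifferentiableAt (by simp)
  have hFs : ∀ᶠ x in 𝓝 p, F x ∈ χ.source :=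
    hF.continuousAt.eventually ((isOpen_extChartAt_source (F p)).mem_nhds (mem_extChartAt_source _))
  have hψd : ∀ᶠ u in 𝓝 (φ p), DifferentiableAt ℝ ψ u :=
    ((hψ.of_le (m := 1) (by simp)).eventually (by simp)).mono fun u hu =>
      hu.differentiableAt (by norm_num)
  -- The chain rule is applied to `F ∘ φ.symm` and to `χ.symm ∘ ψ`, which agree near `u`. This
  -- reduces the claim to a pullback on the model space.
  have hpull : ∀ᶠ u in 𝓝 (φ p), metricInChart I g p u =
      pullForm (metricInChart J g' (F p) (ψ u)) (fderiv ℝ ψ u) := by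
    filter_upwards [eventually_mem_target (I := I) p, hsc'.eventually h, hsc'.eventually hFm,
      hsc'.eventually hFs.eventually_nhds, hψd] with u h1 h2 h3 h4 h5
    have hds := mdifferentiableAt_extChartAt_symm (I := I) h1
    have hψt : ψ u ∈ χ.target := χ.map_source h4.self_of_nhds
    have hds' := mdifferentiableAt_extChartAt_symm (I := J) hψt
    have hev : χ.symm ∘ ψ =ᶠ[𝓝 u] F ∘ φ.symm := by
      have hc : ContinuousAt φ.symm u := hds.continuousAt
      filter_upwards [hc.eventually h4] with v hv
      exact χ.left_inv hv
    have hψm : MDifferentiableAt 𝓘(ℝ, E) 𝓘(ℝ, E) ψ u := h5.mdifferentiableAt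
    have e1 : ∀ v : E, (mfderiv I J F (φ.symm u) : E →L[ℝ] E)
        ((mfderiv 𝓘(ℝ, E) I φ.symm u : E →L[ℝ] E) v) =
        (mfderiv 𝓘(ℝ, E) J χ.symm (ψ u) : E →L[ℝ] E) (fderiv ℝ ψ u v) := by
      intro v
      have a1 := mfderiv_comp_apply u h3 hds v
      have a2 := mfderiv_comp_apply u hds' hψm v
      rw [mfderiv_eq_fderiv] at a2
      have a3 : (mfderiv 𝓘(ℝ, E) J (χ.symm ∘ ψ) u : E →L[ℝ] E) =
        (mfderiv 𝓘(ℝ, E) J (F ∘ φ.symm) u : E →L[ℝ] E) := hev.mfderiv_eq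
      exact a1.symm.trans ((congrArg (fun T : E →L[ℝ] E => T v) a3).symm.trans a2)
    ext v w
    rw [metricInChart_apply, pullForm_apply, metricInChart_apply, ← hφ, ← hχ, ← e1, ← e1]
    have h2' : (g (φ.symm u) : E →L[ℝ] E →L[ℝ] ℝ) =
      pullForm (g' (F (φ.symm u)) : E →L[ℝ] E →L[ℝ] ℝ) (mfderiv I J F (φ.symm u) : E →L[ℝ] E) :=
      h2.symm
    rw [h2']
    exact metricField_congr g' hev.self_of_nhds.symm rfl rfl
  have hψ3 : ContDiffAt ℝ 3 ψ (φ p) := hψ.of_le ENat.LEInfty.out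
  have key := ricciEnd_pullback (g := metricInChart I g p) (g' := metricInChart J g' (F p)) hψ3
    (by rw [hψp]; exact (hg'.smooth (F p)).of_le ENat.LEInfty.out)
    (Filter.Eventually.of_forall fun v a b => hg'.symm _ _ _)
    (by
      rw [hψp]
      filter_upwards [eventually_mem_target (I := J) (F p)] with v hv a ha
      exact metricInChart_pos hg'.pos hv a ha) hpull
    (fun a ha => metricInChart_pos hg (mem_extChartAt_target p) a ha)
  rwa [hψp] at key

theorem scalarCurvature_eq [FiniteDimensional ℝ E] [IsManifold I ∞ M] [IsManifold J ∞ N]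
    {F : M → N} {p : M} (hF : ContMDiffAt I J ∞ F p) {g : MetricField I M} {g' : MetricField J N}
    (hg : ∀ x v, v ≠ 0 → 0 < g x v v) (hg' : IsSmoothMetric g')
    (h : ∀ᶠ x in 𝓝 p, pullbackMetric I J F g' x = g x) :
    scalarCurvature I g p = scalarCurvature J g' (F p) := by
  obtain ⟨L, hL⟩ := exists_conj_ricciEnd hF hg hg' h
  rw [scalarCurvature, scalarCurvature, hL, LinearMap.trace_conj']

theorem ricciNormSq_eq [FiniteDimensional ℝ E] [IsManifold I ∞ M] [IsManifold J ∞ N]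
    {F : M → N} {p : M} (hF : ContMDiffAt I J ∞ F p) {g : MetricField I M} {g' : MetricField J N}
    (hg : ∀ x v, v ≠ 0 → 0 < g x v v) (hg' : IsSmoothMetric g')
    (h : ∀ᶠ x in 𝓝 p, pullbackMetric I J F g' x = g x) :
    ricciNormSq I g p = ricciNormSq J g' (F p) := by
  obtain ⟨L, hL⟩ := exists_conj_ricciEnd hF hg hg' h
  rw [ricciNormSq, ricciNormSq, hL, ← LinearMap.trace_conj' _ L]
  congr 1
  exact LinearEquiv.conj_comp L _ _

end ManifoldNaturality

/-! ### The Maurer-Cartan form and left invariant metrics -/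

section MaurerCartan

variable {E H : Type*} [NormedAddCommGroup E] [NormedSpace ℝ E] [TopologicalSpace H]
  {E' H' : Type*} [NormedAddCommGroup E'] [NormedSpace ℝ E'] [TopologicalSpace H']
  {I : ModelWithCorners ℝ E H} {J : ModelWithCorners ℝ E' H'}

/-- The chart point `q` is a separate variable, so the lemma applies when it equals `f u` only up to
a proof. -/
theorem mfderiv_eq_fderiv_chart {M : Type*} [TopologicalSpace M] [ChartedSpace H M] {f : E' → M}
    {u : E'} {q : M} (hf : MDifferentiableAt 𝓘(ℝ, E') I f u) (hq : f u = q) :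
    (mfderiv 𝓘(ℝ, E') I f u : E' →L[ℝ] E) = fderiv ℝ (fun v => extChartAt I q (f v)) u := by
  subst hq
  have key : ∀ D : E' →L[ℝ] E, HasFDerivWithinAt (fun v => extChartAt I (f u) (f v)) D
      (range 𝓘(ℝ, E')) u → D = fderiv ℝ (fun v => extChartAt I (f u) (f v)) u := by
    intro D h1
    rw [ModelWithCorners.range_eq_univ, hasFDerivWithinAt_univ] at h1
    exact h1.fderiv.symm
  exact key _ hf.hasMFDerivAt.2

variable {G : Type*} [TopologicalSpace G] [ChartedSpace H G] [Group G]
  {T : Type*} [TopologicalSpace T] [ChartedSpace H' T] [Group T]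

/-- The Maurer-Cartan form with values in the model space. -/
def mcForm (I : ModelWithCorners ℝ E H) (x : G) : E →L[ℝ] E := maurerCartan I x

/-- The Maurer-Cartan form in the preferred chart at `p`. -/
def mcChart (I : ModelWithCorners ℝ E H) (p : G) (u : E) : E →L[ℝ] E :=
  (mcForm I ((extChartAt I p).symm u)).comp
    (mfderiv 𝓘(ℝ, E) I (extChartAt I p).symm u : E →L[ℝ] E)

/-- The left invariant metric which equals `B` at `1`. -/
def leftInvMetric (I : ModelWithCorners ℝ E H) (B : E →L[ℝ] E →L[ℝ] ℝ) : MetricField I G :=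
  fun x => (pullForm B (mcForm I x) : E →L[ℝ] E →L[ℝ] ℝ)

theorem mfderiv_one_mul (x : G) (v : E) :
    (mfderiv I I (fun y : G => (1 : G) * y) x : E →L[ℝ] E) v = v := by
  have h2 : (fun y => 1 * y) = (id : G → G) := by ext y; simp
  exact (congrArg (fun T : E →L[ℝ] E => T v) (mfderiv_congr h2)).trans (by rw [mfderiv_id]; rfl)

/-- A left invariant metric in a chart is a constant form evaluated on the Maurer-Cartan frame, the
shape required by `trace_ricciEnd_conformal`. -/
theorem metricInChart_leftInvMetric (B : E →L[ℝ] E →L[ℝ] ℝ) (Φ : G → ℝ) (p : G) :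
    metricInChart I (fun x => Φ x • leftInvMetric I B x) p =
      fun u => Φ ((extChartAt I p).symm u) • pullForm B (mcChart I p u) := rfl

section

variable [LieGroup I ∞ G]

theorem mdifferentiableAt_mul_left (a x : G) : MDifferentiableAt I I (fun y => a * y) x :=
  (contMDiff_mul_left (I := I) (n := ∞) (a := a)).mdifferentiableAt (by simp)

theorem mfderiv_mul_left_comp (a c x : G) (v : E) :
    (mfderiv I I (fun y => a * y) (c * x) : E →L[ℝ] E)
      ((mfderiv I I (fun y => c * y) x : E →L[ℝ] E) v) =
    (mfderiv I I (fun y => a * c * y) x : E →L[ℝ] E) v := by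
  have h := mfderiv_comp_apply x (mdifferentiableAt_mul_left (I := I) a (c * x))
    (mdifferentiableAt_mul_left (I := I) c x) v
  have h2 : (fun y => a * y) ∘ (fun y => c * y) = fun y : G => a * c * y := by
    ext y; simp [mul_assoc]
  exact h.symm.trans (congrArg (fun T : E →L[ℝ] E => T v) (mfderiv_congr h2))

theorem mcForm_mul_left (a x : G) (v : E) :
    mcForm I (a * x) ((mfderiv I I (fun y => a * y) x : E →L[ℝ] E) v) = mcForm I x v := by
  refine (mfderiv_mul_left_comp (a * x)⁻¹ a x v).trans ?_
  rw [show (a * x)⁻¹ * a = x⁻¹ by group]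
  rfl

/-- Translation by `x` undoes translation by `x⁻¹`. -/
theorem mcForm_injective (x : G) : Function.Injective (mcForm I x) := by
  rw [injective_iff_map_eq_zero]
  intro v hv
  have h1 := mfderiv_mul_left_comp (I := I) x x⁻¹ x v
  have h2 : (mfderiv I I (fun y => x⁻¹ * y) x : E →L[ℝ] E) v = 0 := hv
  rw [h2, map_zero] at h1
  rw [mul_inv_cancel] at h1
  rw [mfderiv_one_mul] at h1
  exact h1.symm

theorem pullback_leftInvMetric (B : E →L[ℝ] E →L[ℝ] ℝ) (a : G) :
    pullbackMetric I I (fun x => a * x) (leftInvMetric I B) = leftInvMetric I B := by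
  funext x
  refine ContinuousLinearMap.ext fun v => ContinuousLinearMap.ext fun w => ?_
  exact congrArg₂ (fun s t => B s t) (mcForm_mul_left (I := I) a x v)
    (mcForm_mul_left (I := I) a x w)

theorem pullback_smul_leftInvMetric (B : E →L[ℝ] E →L[ℝ] ℝ) (Φ : G → ℝ) (a : G) :
    pullbackMetric I I (fun x => a * x) (fun x => Φ x • leftInvMetric I B x) =
      fun x => Φ (a * x) • leftInvMetric I B x := by
  funext x
  rw [← congrFun (pullback_leftInvMetric B a) x]
  rfl

/-- The Maurer-Cartan form is natural under homomorphisms. -/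
theorem mcForm_map [LieGroup J ∞ T] (ρ : G →* T) (hρ : MDifferentiable I J ρ) (x : G) (v : E) :
    mcForm J (ρ x) ((mfderiv I J ρ x : E →L[ℝ] E') v) =
      (mfderiv I J ρ 1 : E →L[ℝ] E') (mcForm I x v) := by
  have h1 := mfderiv_comp_apply x (mdifferentiableAt_mul_left (I := J) (ρ x)⁻¹ (ρ x)) (hρ x) v
  have h2 := mfderiv_comp_apply x (hρ (x⁻¹ * x)) (mdifferentiableAt_mul_left (I := I) x⁻¹ x) v
  have h3 : (fun y => (ρ x)⁻¹ * y) ∘ ρ = ρ ∘ fun y => x⁻¹ * y := by ext y; simp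
  have h4 : (mfderiv I J ρ (x⁻¹ * x) : E →L[ℝ] E') = (mfderiv I J ρ 1 : E →L[ℝ] E') :=
    mfderiv_congr_point (by simp)
  refine h1.symm.trans ((congrArg (fun T : E →L[ℝ] E' => T v) (mfderiv_congr h3)).trans
    (h2.trans ?_))
  exact congrArg (fun T : E →L[ℝ] E' => T (mcForm I x v)) h4

variable [I.Boundaryless]

theorem mcChart_eq_fderiv {p : G} {u : E} (hu : u ∈ (extChartAt I p).target) :
    mcChart I p u = fderiv ℝ (fun v => extChartAt I (1 : G)
      (((extChartAt I p).symm u)⁻¹ * (extChartAt I p).symm v)) u := by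
  set x := (extChartAt I p).symm u with hx
  have hs := mdifferentiableAt_extChartAt_symm (I := I) hu
  have hm := mdifferentiableAt_mul_left (I := I) x⁻¹ x
  have hf : MDifferentiableAt 𝓘(ℝ, E) I (fun v => x⁻¹ * (extChartAt I p).symm v) u :=
    hm.comp u hs
  rw [← mfderiv_eq_fderiv_chart hf (by simp [hx])]
  exact (mfderiv_comp u hm hs).symm

/-- The point `u` is both a parameter of the map `v ↦ x(u)⁻¹ x(v)` and the point at which that map
is differentiated. Joint smoothness of this two-variable map gives smoothness of its partial
derivative along the diagonal. -/
theorem contDiffAt_mcChart (p : G) :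
    ContDiffAt ℝ ∞ (mcChart I p) (extChartAt I p p) := by
  set φ := extChartAt I p with hφ
  set u₀ := φ p with hu₀
  have hp : φ.symm u₀ = p := extChartAt_to_inv p
  have hs : ContMDiffAt 𝓘(ℝ, E) I ∞ φ.symm u₀ :=
    (contMDiffOn_extChartAt_symm (n := ∞) p).contMDiffAt
      ((isOpen_extChartAt_target p).mem_nhds (mem_extChartAt_target p))
  have h1 : ContMDiffAt 𝓘(ℝ, E × E) I ∞ (fun z : E × E => φ.symm z.1) (u₀, u₀) :=
    ContMDiffAt.comp (u₀, u₀) (I' := 𝓘(ℝ, E)) hs contDiff_fst.contMDiff.contMDiffAt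
  have h2 : ContMDiffAt 𝓘(ℝ, E × E) I ∞ (fun z : E × E => φ.symm z.2) (u₀, u₀) :=
    ContMDiffAt.comp (u₀, u₀) (I' := 𝓘(ℝ, E)) hs contDiff_snd.contMDiff.contMDiffAt
  have h3 : ContMDiffAt 𝓘(ℝ, E × E) I ∞ (fun z : E × E => (φ.symm z.1)⁻¹ * φ.symm z.2) (u₀, u₀) :=
    h1.inv.mul h2
  have h4 : ContMDiffAt 𝓘(ℝ, E × E) 𝓘(ℝ, E) ∞
      (fun z : E × E => extChartAt I (1 : G) ((φ.symm z.1)⁻¹ * φ.symm z.2)) (u₀, u₀) := by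
    refine ContMDiffAt.comp (u₀, u₀) (I' := I) ?_ h3
    simp only [hp, inv_mul_cancel]
    exact contMDiffAt_extChartAt
  have h5 := (contMDiffAt_iff_contDiffAt.1 h4)
  have h6 : ContDiffAt ℝ ∞ (fun u => fderiv ℝ (fun v => extChartAt I (1 : G)
      ((φ.symm u)⁻¹ * φ.symm v)) u) u₀ :=
    ContDiffAt.fderiv (f := fun u v => extChartAt I (1 : G) ((φ.symm u)⁻¹ * φ.symm v))
      (g := fun u => u) (n := ∞) h5 contDiffAt_id (by simp)
  refine h6.congr_of_eventuallyEq ?_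
  filter_upwards [eventually_mem_target (I := I) p] with u hu
  exact mcChart_eq_fderiv hu

theorem mcChart_one : mcChart I (1 : G) (extChartAt I (1 : G) 1) = .id ℝ E := by
  rw [mcChart_eq_fderiv (mem_extChartAt_target 1), extChartAt_to_inv]
  have : (fun v => extChartAt I (1 : G) ((1 : G)⁻¹ * (extChartAt I 1).symm v))
      =ᶠ[𝓝 (extChartAt I (1 : G) 1)] id := by
    filter_upwards [eventually_mem_target (I := I) (1 : G)] with u hu
    rw [inv_one, one_mul]
    exact (extChartAt I (1 : G)).right_inv hu
  rw [this.fderiv_eq, fderiv_id]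

theorem contDiffAt_comp_extChartAt_symm {Φ : G → ℝ} (hΦ : ContMDiff I 𝓘(ℝ, ℝ) ∞ Φ) (p : G) :
    ContDiffAt ℝ ∞ (fun u => Φ ((extChartAt I p).symm u)) (extChartAt I p p) := by
  have hs : ContMDiffAt 𝓘(ℝ, E) I ∞ (extChartAt I p).symm (extChartAt I p p) :=
    (contMDiffOn_extChartAt_symm (n := ∞) p).contMDiffAt
      ((isOpen_extChartAt_target p).mem_nhds (mem_extChartAt_target p))
  exact (contMDiffAt_iff_contDiffAt.1 (ContMDiffAt.comp _ hΦ.contMDiffAt hs) :)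

theorem isSmoothMetric_smul_leftInvMetric {B : E →L[ℝ] E →L[ℝ] ℝ} (hsymm : ∀ a c, B a c = B c a)
    (hpos : ∀ a, a ≠ 0 → 0 < B a a) {Φ : G → ℝ} (hΦ : ContMDiff I 𝓘(ℝ, ℝ) ∞ Φ)
    (hΦpos : ∀ x, 0 < Φ x) :
    IsSmoothMetric (I := I) (M := G) (fun x => Φ x • leftInvMetric I B x) where
  symm x v w := congrArg (fun t => Φ x * t) (hsymm (mcForm I x v) (mcForm I x w))
  pos x v hv := by
    refine mul_pos (hΦpos x) (hpos (mcForm I x v) fun h => hv ?_)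
    exact (injective_iff_map_eq_zero (mcForm I x)).1 (mcForm_injective x) v h
  smooth p := by
    rw [metricInChart_leftInvMetric]
    exact (contDiffAt_comp_extChartAt_symm hΦ p).smul
      (contDiffAt_pullForm (contDiffAt_mcChart p) contDiffAt_const)

theorem isSmoothMetric_leftInvMetric {B : E →L[ℝ] E →L[ℝ] ℝ} (hsymm : ∀ a c, B a c = B c a)
    (hpos : ∀ a, a ≠ 0 → 0 < B a a) :
    IsSmoothMetric (I := I) (M := G) (leftInvMetric I B) := by
  have := isSmoothMetric_smul_leftInvMetric (I := I) (G := G) hsymm hpos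
    (Φ := fun _ => 1) contMDiff_const (fun _ => one_pos)
  simpa using this

/-- Left translations are isometries and act transitively. -/
theorem ricciNormSq_leftInvMetric [FiniteDimensional ℝ E] {B : E →L[ℝ] E →L[ℝ] ℝ}
    (hsymm : ∀ a c, B a c = B c a) (hpos : ∀ a, a ≠ 0 → 0 < B a a) (p : G) :
    ricciNormSq I (leftInvMetric (G := G) I B) p = ricciNormSq I (leftInvMetric (G := G) I B) 1 := by
  have hs := isSmoothMetric_leftInvMetric (I := I) (G := G) hsymm hpos
  have := ricciNormSq_eq (F := fun x => p * x) (p := (1 : G)) (g := leftInvMetric I B)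
    (contMDiff_mul_left (I := I) (n := ∞) (a := p)).contMDiffAt hs.pos hs
    (Filter.Eventually.of_forall fun x => congrFun (pullback_leftInvMetric B p) x)
  rw [this, mul_one]

/-- Left translation moves the base point to `1` at the cost of translating the conformal factor.
Hence the curvature only has to be computed at `1`, where the Maurer-Cartan frame is the identity.
-/
theorem scalarCurvature_smul_leftInvMetric [FiniteDimensional ℝ E] {B : E →L[ℝ] E →L[ℝ] ℝ}
    (hsymm : ∀ a c, B a c = B c a) (hpos : ∀ a, a ≠ 0 → 0 < B a a) {Φ : G → ℝ}
    (hΦ : ContMDiff I 𝓘(ℝ, ℝ) ∞ Φ) (hΦpos : ∀ x, 0 < Φ x) (p : G) :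
    scalarCurvature I (fun x => Φ x • leftInvMetric (G := G) I B x) p =
      scalarCurvature I (fun x => Φ (p * x) • leftInvMetric (G := G) I B x) 1 := by
  have hs := isSmoothMetric_smul_leftInvMetric (I := I) (G := G) hsymm hpos hΦ hΦpos
  have hl : ContMDiff I I ∞ (fun x : G => p * x) := contMDiff_mul_left
  have hs' := isSmoothMetric_smul_leftInvMetric (I := I) (G := G) hsymm hpos
    (hΦ.comp hl) (fun x => hΦpos (p * x))
  have := scalarCurvature_eq (F := fun x => p * x) (p := (1 : G))
    (g := fun x => Φ (p * x) • leftInvMetric (G := G) I B x) hl.contMDiffAt hs'.pos hs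
    (Filter.Eventually.of_forall fun x => congrFun (pullback_smul_leftInvMetric B Φ p) x)
  rw [this, mul_one]

end

end MaurerCartan

/-! ### The Maurer-Cartan equation, for products and under homomorphisms -/

section StructureEquation

variable {E H : Type*} [NormedAddCommGroup E] [NormedSpace ℝ E] [TopologicalSpace H]
  {E' H' : Type*} [NormedAddCommGroup E'] [NormedSpace ℝ E'] [TopologicalSpace H']
  {I : ModelWithCorners ℝ E H} {J : ModelWithCorners ℝ E' H'}
  {G : Type*} [TopologicalSpace G] [ChartedSpace H G] [Group G]
  {T : Type*} [TopologicalSpace T] [ChartedSpace H' T] [Group T]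

variable (I G) in
/-- The Maurer-Cartan equation: `br` is the Lie bracket of `G`. -/
def HasBracket (br : E →L[ℝ] E →L[ℝ] E) : Prop :=
  ∀ᶠ u in 𝓝 (extChartAt I (1 : G) 1), ∀ X Y,
    fderiv ℝ (mcChart I (1 : G)) u X Y - fderiv ℝ (mcChart I (1 : G)) u Y X =
      -br (mcChart I (1 : G) u X) (mcChart I (1 : G) u Y)

/-- The bracket of a product. -/
def brProd (br : E →L[ℝ] E →L[ℝ] E) (br' : E' →L[ℝ] E' →L[ℝ] E') :
    (E × E') →L[ℝ] (E × E') →L[ℝ] E × E' :=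
  (ContinuousLinearMap.compL ℝ (E × E') E (E × E') (.inl ℝ E E')).comp
      ((ContinuousLinearMap.precomp E (.fst ℝ E E')).comp (br.comp (.fst ℝ E E'))) +
    (ContinuousLinearMap.compL ℝ (E × E') E' (E × E') (.inr ℝ E E')).comp
      ((ContinuousLinearMap.precomp E' (.snd ℝ E E')).comp (br'.comp (.snd ℝ E E')))

theorem brProd_apply (br : E →L[ℝ] E →L[ℝ] E) (br' : E' →L[ℝ] E' →L[ℝ] E') (x y : E × E') :
    brProd br br' x y = (br x.1 y.1, br' x.2 y.2) := by
  simp [brProd]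

theorem extChartAt_prod_symm_apply {M N : Type*} [TopologicalSpace M] [ChartedSpace H M]
    [TopologicalSpace N] [ChartedSpace H' N] (p : M × N) (w : E × E') :
    (extChartAt (I.prod J) p).symm w =
      ((extChartAt I p.1).symm w.1, (extChartAt J p.2).symm w.2) := by
  rw [extChartAt_prod]; rfl

variable [LieGroup I ∞ G] [LieGroup J ∞ T]

theorem mcForm_prod (p : G × T) : mcForm (I.prod J) p = (mcForm I p.1).prodMap (mcForm J p.2) := by
  have h := mfderiv_prodMap (p := p) (mdifferentiableAt_mul_left (I := I) p.1⁻¹ p.1)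
    (mdifferentiableAt_mul_left (I := J) p.2⁻¹ p.2)
  exact h

variable [I.Boundaryless] [J.Boundaryless]

theorem mcChart_prod (p : G × T) {w : E × E'} (h1 : w.1 ∈ (extChartAt I p.1).target)
    (h2 : w.2 ∈ (extChartAt J p.2).target) :
    mcChart (I.prod J) p w = (mcChart I p.1 w.1).prodMap (mcChart J p.2 w.2) := by
  have e : (extChartAt (I.prod J) p).symm =
      Prod.map (extChartAt I p.1).symm (extChartAt J p.2).symm := by
    ext w <;> rw [extChartAt_prod_symm_apply] <;> rfl
  have h := mfderiv_prodMap (p := w) (mdifferentiableAt_extChartAt_symm (I := I) h1)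
    (mdifferentiableAt_extChartAt_symm (I := J) h2)
  have h3 : (mfderiv 𝓘(ℝ, E × E') (I.prod J) (extChartAt (I.prod J) p).symm w :
      E × E' →L[ℝ] E × E') = (mfderiv 𝓘(ℝ, E) I (extChartAt I p.1).symm w.1 :
      E →L[ℝ] E).prodMap (mfderiv 𝓘(ℝ, E') J (extChartAt J p.2).symm w.2 : E' →L[ℝ] E') := by
    rw [modelWithCornersSelf_prod, ← chartedSpaceSelf_prod, e]
    exact h
  rw [mcChart, h3, mcForm_prod, extChartAt_prod_symm_apply]
  rfl

theorem eventually_mcChart_prod (p : G × T) :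
    ∀ᶠ w in 𝓝 (extChartAt (I.prod J) p p),
      mcChart (I.prod J) p w = (mcChart I p.1 w.1).prodMap (mcChart J p.2 w.2) := by
  have h0 : extChartAt (I.prod J) p p = (extChartAt I p.1 p.1, extChartAt J p.2 p.2) := by
    rw [extChartAt_prod]; rfl
  rw [h0, nhds_prod_eq]
  filter_upwards [(eventually_mem_target (I := I) p.1).prod_mk (eventually_mem_target (I := J) p.2)]
    with w hw
  exact mcChart_prod p hw.1 hw.2

theorem fderiv_prodMap {A : E → E →L[ℝ] E} {A' : E' → E' →L[ℝ] E'} {w : E × E'}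
    (hA : DifferentiableAt ℝ A w.1) (hA' : DifferentiableAt ℝ A' w.2) (X Y : E × E') :
    fderiv ℝ (fun w : E × E' => (A w.1).prodMap (A' w.2)) w X Y =
      (fderiv ℝ A w.1 X.1 Y.1, fderiv ℝ A' w.2 X.2 Y.2) := by
  have h1 : HasFDerivAt (fun w : E × E' => (A w.1, A' w.2))
      (((fderiv ℝ A w.1).comp (.fst ℝ E E')).prod ((fderiv ℝ A' w.2).comp (.snd ℝ E E'))) w :=
    (hA.hasFDerivAt.comp w hasFDerivAt_fst).prodMk (hA'.hasFDerivAt.comp w hasFDerivAt_snd)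
  have h2 := (ContinuousLinearMap.prodMapL ℝ E E E' E').hasFDerivAt.comp w h1
  have h3 : fderiv ℝ (fun w : E × E' => (A w.1).prodMap (A' w.2)) w = _ := h2.fderiv
  rw [h3]
  rfl

theorem eventually_differentiableAt_mcChart (p : G) :
    ∀ᶠ u in 𝓝 (extChartAt I p p), ContDiffAt ℝ 1 (mcChart I p) u :=
  ((contDiffAt_mcChart p).of_le ENat.LEInfty.out).eventually (by simp)

theorem HasBracket.prod {br : E →L[ℝ] E →L[ℝ] E} {br' : E' →L[ℝ] E' →L[ℝ] E'}
    (h : HasBracket I G br) (h' : HasBracket J T br') :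
    HasBracket (I.prod J) (G × T) (brProd br br') := by
  have h0 : extChartAt (I.prod J) (1 : G × T) 1 = (extChartAt I (1 : G) 1, extChartAt J (1 : T) 1) := by
    rw [extChartAt_prod]; rfl
  have h1 := (h.and (eventually_differentiableAt_mcChart (1 : G))).prod_mk
    (h'.and (eventually_differentiableAt_mcChart (1 : T)))
  rw [← nhds_prod_eq, ← h0] at h1
  filter_upwards [h1, (eventually_mcChart_prod (I := I) (J := J) (1 : G × T)).eventually_nhds]
    with w hw he X Y
  have he' : mcChart (I.prod J) (1 : G × T) =ᶠ[𝓝 w] fun w =>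
    (mcChart I (1 : G) w.1).prodMap (mcChart J (1 : T) w.2) := he
  have hA := hw.1.2.differentiableAt (by norm_num)
  have hA' := hw.2.2.differentiableAt (by norm_num)
  rw [he'.fderiv_eq, fderiv_prodMap hA hA', fderiv_prodMap hA hA', he'.self_of_nhds, brProd_apply]
  have e1 := hw.1.1 X.1 Y.1
  have e2 := hw.2.1 X.2 Y.2
  exact Prod.ext e1 e2

/-- The Maurer-Cartan form in charts is natural under homomorphisms. -/
theorem eventually_mcChart_map (ρ : G →* T) (hρ : ContMDiff I J ∞ ρ) :
    ContDiffAt ℝ ∞ (fun u => extChartAt J (1 : T) (ρ ((extChartAt I (1 : G)).symm u)))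
        (extChartAt I (1 : G) 1) ∧
      ∀ᶠ u in 𝓝 (extChartAt I (1 : G) 1), ∀ X,
        mcChart J (1 : T) (extChartAt J (1 : T) (ρ ((extChartAt I (1 : G)).symm u)))
          (fderiv ℝ (fun u => extChartAt J (1 : T) (ρ ((extChartAt I (1 : G)).symm u))) u X) =
        (mfderiv I J ρ 1 : E →L[ℝ] E') (mcChart I (1 : G) u X) := by
  set φ := extChartAt I (1 : G) with hφ
  set χ := extChartAt J (1 : T) with hχ
  set ψ : E → E' := fun u => χ (ρ (φ.symm u)) with hψdef
  have hs : φ.symm (φ 1) = 1 := extChartAt_to_inv 1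
  have hψ : ContDiffAt ℝ ∞ ψ (φ 1) := by
    have := (contMDiffAt_iff.1 (hρ 1)).2
    rw [I.range_eq_univ, contDiffWithinAt_univ] at this
    have h1 : extChartAt J (ρ (1 : G)) = χ := by rw [map_one]
    rw [h1] at this
    exact this
  refine ⟨hψ, ?_⟩
  have hsc : Filter.Tendsto φ.symm (𝓝 (φ 1)) (𝓝 1) := by
    have := (continuousAt_extChartAt_symm (I := I) (1 : G)).tendsto
    rwa [← hφ, hs] at this
  have hρ1 : Filter.Tendsto ρ (𝓝 1) (𝓝 1) := by
    have := (hρ 1).continuousAt.tendsto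
    rwa [map_one] at this
  have hsrc : ∀ᶠ y in 𝓝 (1 : T), y ∈ χ.source := extChartAt_source_mem_nhds 1
  have hψd : ∀ᶠ u in 𝓝 (φ 1), DifferentiableAt ℝ ψ u :=
    ((hψ.of_le (m := 1) (by simp)).eventually (by simp)).mono fun u hu =>
      hu.differentiableAt (by norm_num)
  filter_upwards [eventually_mem_target (I := I) (1 : G),
    (hsc.eventually (hρ1.eventually hsrc)).eventually_nhds, hψd] with u h1 h2 h3 X
  have hds := mdifferentiableAt_extChartAt_symm (I := I) h1
  have hds' := mdifferentiableAt_extChartAt_symm (I := J) (χ.map_source h2.self_of_nhds)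
  have hρm : MDifferentiableAt I J ρ (φ.symm u) := hρ.mdifferentiableAt (by simp)
  have hev : χ.symm ∘ ψ =ᶠ[𝓝 u] ρ ∘ φ.symm := by
    filter_upwards [h2] with v hv
    exact χ.left_inv hv
  have a1 := mfderiv_comp_apply u hρm hds X
  have a2 := mfderiv_comp_apply u (f := ψ) hds' h3.mdifferentiableAt X
  rw [mfderiv_eq_fderiv] at a2
  have a3 : (mfderiv 𝓘(ℝ, E) J (χ.symm ∘ ψ) u : E →L[ℝ] E') =
    (mfderiv 𝓘(ℝ, E) J (ρ ∘ φ.symm) u : E →L[ℝ] E') := hev.mfderiv_eq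
  have a4 : (mfderiv 𝓘(ℝ, E') J χ.symm (ψ u) : E' →L[ℝ] E') (fderiv ℝ ψ u X) =
      (mfderiv I J ρ (φ.symm u) : E →L[ℝ] E') ((mfderiv 𝓘(ℝ, E) I φ.symm u : E →L[ℝ] E) X) :=
    a2.symm.trans ((congrArg (fun T : E →L[ℝ] E' => T X) a3).trans a1)
  have a5 : χ.symm (ψ u) = ρ (φ.symm u) := hev.self_of_nhds
  have a6 := mcForm_map ρ (hρ.mdifferentiable (by simp)) (φ.symm u)
    ((mfderiv 𝓘(ℝ, E) I φ.symm u : E →L[ℝ] E) X)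
  rw [← a4, ← a5] at a6
  exact a6

end StructureEquation

/-! ### Commutative Lie groups -/

section Commutative

variable {E H : Type*} [NormedAddCommGroup E] [NormedSpace ℝ E] [TopologicalSpace H]
  {I : ModelWithCorners ℝ E H} [I.Boundaryless]
  {G : Type*} [TopologicalSpace G] [ChartedSpace H G] [CommGroup G] [LieGroup I ∞ G]

theorem eventually_isInvertible_mcChart [FiniteDimensional ℝ E] :
    ∀ᶠ u in 𝓝 (extChartAt I (1 : G) 1), (mcChart I (1 : G) u).IsInvertible := by
  have : CompleteSpace E := FiniteDimensional.complete ℝ E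
  refine eventually_isInvertible (contDiffAt_mcChart (I := I) (1 : G)).continuousAt ?_
  rw [mcChart_one]
  exact ⟨.refl ℝ E, rfl⟩

/-- The bracket of a commutative Lie group vanishes. -/
theorem hasBracket_zero [FiniteDimensional ℝ E] : HasBracket I G 0 := by
  set u₀ := extChartAt I (1 : G) 1 with hu₀
  set A := mcChart I (1 : G) with hA
  set φ := extChartAt I (1 : G) with hφ
  -- Commutativity makes multiplication a homomorphism. Its differential at `1` is the sum, so the
  -- Maurer-Cartan form pulls back to the sum of its two copies; this is `hform`.
  let ρ : G × G →* G := mulMonoidHom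
  have hρ : ContMDiff (I.prod I) I ∞ ρ := contMDiff_mul I ∞
  obtain ⟨hψ, hmap⟩ := eventually_mcChart_map ρ hρ
  set ψ : E × E → E := fun w => φ (ρ ((extChartAt (I.prod I) (1 : G × G)).symm w)) with hψdef
  have h0 : extChartAt (I.prod I) (1 : G × G) 1 = (u₀, u₀) := by rw [extChartAt_prod]; rfl
  rw [h0] at hψ hmap
  have hρ1 : ∀ X Y : E, (mfderiv (I.prod I) I ρ 1 : E × E →L[ℝ] E) (X, Y) = X + Y := by
    intro X Y
    have h := mfderiv_prod_eq_add_apply (f := ρ) (p := (1 : G × G)) (v := (X, Y))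
      (hρ.mdifferentiableAt (by simp))
    refine h.trans ?_
    have e1 : (fun z : G => ρ (z, (1 : G × G).2)) = id := by ext z; simp [ρ]
    have e2 : (fun z : G => ρ ((1 : G × G).1, z)) = id := by ext z; simp [ρ]
    have e3 : (mfderiv I I (fun z : G => ρ (z, (1 : G × G).2)) (1 : G) : E →L[ℝ] E) = .id ℝ E :=
      (mfderiv_congr e1).trans (by rw [mfderiv_id]; rfl)
    have e4 : (mfderiv I I (fun z : G => ρ ((1 : G × G).1, z)) (1 : G) : E →L[ℝ] E) = .id ℝ E :=
      (mfderiv_congr e2).trans (by rw [mfderiv_id]; rfl)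
    exact congrArg₂ (fun S T : E →L[ℝ] E => S X + T Y) e3 e4
  have hprod := eventually_mcChart_prod (I := I) (J := I) (1 : G × G)
  rw [h0] at hprod
  have hform : ∀ᶠ w in 𝓝 (u₀, u₀), ∀ X, A (ψ w) (fderiv ℝ ψ w X) = A w.1 X.1 + A w.2 X.2 := by
    filter_upwards [hmap, hprod] with w h1 h2 X
    rw [h1 X, h2]
    exact hρ1 _ _
  have hψ2 : ∀ᶠ w in 𝓝 (u₀, u₀), ContDiffAt ℝ 2 ψ w :=
    (hψ.of_le ENat.LEInfty.out).eventually (by simp)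
  have hAd : ∀ᶠ u in 𝓝 u₀, ContDiffAt ℝ 1 A u := eventually_differentiableAt_mcChart (1 : G)
  have hc : ContinuousAt (fun u : E => (u, u₀)) u₀ := by fun_prop
  have hAd₀ := hAd.self_of_nhds.differentiableAt (by norm_num)
  filter_upwards [hc.eventually hform.eventually_nhds, hc.eventually hψ2, hAd,
    eventually_isInvertible_mcChart (I := I) (G := G),
    eventually_mem_target (I := I) (1 : G)] with u h1 h2 h3 h4 h5 X Y
  have hψu : ψ (u, u₀) = u := by
    have e : (extChartAt (I.prod I) (1 : G × G)).symm (u, u₀) = (φ.symm u, 1) := by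
      rw [extChartAt_prod_symm_apply]
      exact Prod.ext rfl (extChartAt_to_inv (I := I) (1 : G))
    have e2 : ρ (φ.symm u, 1) = φ.symm u := by simp [ρ]
    simp only [hψdef, e, e2]
    exact φ.right_inv h5
  have hAu := h3.differentiableAt (by norm_num)
  have hψd := h2.differentiableAt (by norm_num)
  have hψdd : DifferentiableAt ℝ (fderiv ℝ ψ) (u, u₀) :=
    (h2.fderiv_right (m := 1) (by norm_num)).differentiableAt (by norm_num)
  have hsym := h2.isSymmSndFDerivAt (by simp)
  have hAψ : HasFDerivAt (fun w => A (ψ w)) ((fderiv ℝ A u).comp (fderiv ℝ ψ (u, u₀))) (u, u₀) := by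
    have h6 : HasFDerivAt A (fderiv ℝ A u) (ψ (u, u₀)) := by rw [hψu]; exact hAu.hasFDerivAt
    exact h6.comp (u, u₀) hψd.hasFDerivAt
  have hder : ∀ W V : E × E, fderiv ℝ A u (fderiv ℝ ψ (u, u₀) W) (fderiv ℝ ψ (u, u₀) V) +
      A u (fderiv ℝ (fderiv ℝ ψ) (u, u₀) W V) =
      fderiv ℝ A u W.1 V.1 + fderiv ℝ A u₀ W.2 V.2 := by
    intro W V
    have d1 : HasFDerivAt (fun w => fderiv ℝ ψ w V)
        ((ContinuousLinearMap.apply ℝ E V).comp (fderiv ℝ (fderiv ℝ ψ) (u, u₀))) (u, u₀) :=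
      (ContinuousLinearMap.apply ℝ E V).hasFDerivAt.comp (u, u₀) hψdd.hasFDerivAt
    have d2 := hAψ.clm_apply d1
    have d3 : HasFDerivAt (fun w : E × E => A w.1 V.1) (((ContinuousLinearMap.apply ℝ E V.1).comp
        (fderiv ℝ A u)).comp (.fst ℝ E E)) (u, u₀) :=
      HasFDerivAt.comp (g := fun v => A v V.1) (u, u₀)
        ((ContinuousLinearMap.apply ℝ E V.1).hasFDerivAt.comp u hAu.hasFDerivAt)
        (hasFDerivAt_fst (p := (u, u₀)))
    have d4 : HasFDerivAt (fun w : E × E => A w.2 V.2) (((ContinuousLinearMap.apply ℝ E V.2).comp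
        (fderiv ℝ A u₀)).comp (.snd ℝ E E)) (u, u₀) :=
      HasFDerivAt.comp (g := fun v => A v V.2) (u, u₀)
        ((ContinuousLinearMap.apply ℝ E V.2).hasFDerivAt.comp u₀ hAd₀.hasFDerivAt)
        (hasFDerivAt_snd (p := (u, u₀)))
    have d5 := d2.unique ((d3.add d4).congr_of_eventuallyEq (h1.mono fun w hw => hw V))
    have d6 := congrArg (fun T => T W) d5
    simp [hψu] at d6
    rw [← d6]
    abel
  have hid := h1.self_of_nhds
  have hinj : ∀ a c, A u a = A u c → a = c := fun a c h => by
    rw [← h4.inverse_apply_self a, h, h4.inverse_apply_self]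
  have hX : fderiv ℝ ψ (u, u₀) (X, 0) = X := by
    refine hinj _ _ ?_
    have := hid (X, 0)
    rw [hψu] at this
    simpa using this
  have hY : fderiv ℝ ψ (u, u₀) (0, A u Y) = Y := by
    refine hinj _ _ ?_
    have := hid (0, A u Y)
    rw [hψu] at this
    have h7 : A u₀ = .id ℝ E := mcChart_one
    simpa [h7] using this
  -- Mixed second derivatives in the two orders: the right-hand side of `hder` vanishes for both,
  -- and the Hessian of `ψ` is symmetric. The second factor is taken at the base point, where `A` is
  -- the identity, so the direction `A u Y` there is carried to `Y` at `u`.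
  have f1 := hder (X, 0) (0, A u Y)
  have f2 := hder (0, A u Y) (X, 0)
  rw [hX, hY, hsym (X, 0) (0, A u Y)] at f1
  rw [hX, hY] at f2
  simp only [map_zero, zero_apply, add_zero] at f1 f2
  simp only [zero_apply, neg_zero]
  rw [eq_neg_of_add_eq_zero_left f1, eq_neg_of_add_eq_zero_left f2, sub_self]

end Commutative

theorem mfderiv_eq_fderiv_symm {E H F M : Type*} [NormedAddCommGroup E] [NormedSpace ℝ E]
    [TopologicalSpace H] [NormedAddCommGroup F] [NormedSpace ℝ F] {I : ModelWithCorners ℝ E H}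
    [I.Boundaryless] [TopologicalSpace M] [ChartedSpace H M] {f : M → F} {x : M}
    (hf : MDifferentiableAt I 𝓘(ℝ, F) f x) :
    (mfderiv I 𝓘(ℝ, F) f x : E →L[ℝ] F) =
      fderiv ℝ (fun u => f ((extChartAt I x).symm u)) (extChartAt I x x) := by
  have key : ∀ D : E →L[ℝ] F, HasFDerivWithinAt (fun u => f ((extChartAt I x).symm u)) D
      (range I) (extChartAt I x x) →
      D = fderiv ℝ (fun u => f ((extChartAt I x).symm u)) (extChartAt I x x) := by
    intro D h1
    rw [ModelWithCorners.range_eq_univ, hasFDerivWithinAt_univ] at h1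
    exact h1.fderiv.symm
  exact key _ hf.hasMFDerivAt.2

/-! ### The bracket of the matrix group -/

section GroupK

attribute [local instance] Matrix.linftyOpNormedRing Matrix.linftyOpNormedAlgebra

variable {m : ℕ} {𝕜 : Type*} [RCLike 𝕜]

variable (m 𝕜) in
/-- The inclusion of the skew-Hermitian traceless matrices into the square matrices. -/
def inclMat : SkewLie m 𝕜 →L[ℝ] NormedMatrix m 𝕜 := (skewSubmodule m 𝕜).subtypeL

theorem inclMat_injective : Function.Injective (inclMat m 𝕜) :=
  fun _ _ h => Subtype.ext h

/-- The commutator of skew-Hermitian traceless matrices. -/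
def commLin : SkewLie m 𝕜 →ₗ[ℝ] SkewLie m 𝕜 →ₗ[ℝ] SkewLie m 𝕜 :=
  LinearMap.mk₂ ℝ (fun X Y => ⟨X.1 * Y.1 - Y.1 * X.1, by
      constructor
      · rw [Matrix.conjTranspose_sub, Matrix.conjTranspose_mul, Matrix.conjTranspose_mul, X.2.1,
          Y.2.1]
        simp
      · rw [Matrix.trace_sub, Matrix.trace_mul_comm, sub_self]⟩)
    (fun X X' Y => Subtype.ext (by
      change (X.1 + X'.1) * Y.1 - Y.1 * (X.1 + X'.1) =
        (X.1 * Y.1 - Y.1 * X.1) + (X'.1 * Y.1 - Y.1 * X'.1)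
      noncomm_ring))
    (fun c X Y => Subtype.ext (by
      change (c • X.1) * Y.1 - Y.1 * (c • X.1) = c • (X.1 * Y.1 - Y.1 * X.1)
      rw [Matrix.smul_mul, Matrix.mul_smul, smul_sub]))
    (fun X Y Y' => Subtype.ext (by
      change X.1 * (Y.1 + Y'.1) - (Y.1 + Y'.1) * X.1 =
        (X.1 * Y.1 - Y.1 * X.1) + (X.1 * Y'.1 - Y'.1 * X.1)
      noncomm_ring))
    (fun c X Y => Subtype.ext (by
      change X.1 * (c • Y.1) - (c • Y.1) * X.1 = c • (X.1 * Y.1 - Y.1 * X.1)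
      rw [Matrix.smul_mul, Matrix.mul_smul, smul_sub]))

variable (m 𝕜) in
/-- The Lie bracket of `𝔰𝔬(m)` or `𝔰𝔲(m)`. -/
def brK : SkewLie m 𝕜 →L[ℝ] SkewLie m 𝕜 →L[ℝ] SkewLie m 𝕜 := commLin.toContinuousBilinearMap

theorem inclMat_brK (X Y : SkewLie m 𝕜) : inclMat m 𝕜 (brK m 𝕜 X Y) =
    inclMat m 𝕜 X * inclMat m 𝕜 Y - inclMat m 𝕜 Y * inclMat m 𝕜 X := rfl

theorem logChart_one : logChart m 𝕜 1 = 0 := by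
  obtain ⟨h1, h0, hexp, -⟩ := (exists_logChart m 𝕜).choose_spec
  have h2 : (logChart m 𝕜).symm 0 = 1 := by
    apply Subtype.ext
    refine (hexp 0).trans ?_
    exact NormedSpace.exp_zero
  rw [← h2]
  exact (logChart m 𝕜).right_inv h0

theorem chartAt_self (A : GroupK m 𝕜) : chartAt (SkewLie m 𝕜) A A = 0 := by
  change logChart m 𝕜 (A⁻¹ * A) = 0
  rw [inv_mul_cancel, logChart_one]

theorem extChartAt_self (A : GroupK m 𝕜) : extChartAt (modelK m 𝕜) A A = 0 := chartAt_self A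

theorem toMatrix_mul (A B : GroupK m 𝕜) : toMatrix (A * B) = toMatrix A * toMatrix B := rfl

theorem mdifferentiableAt_toMatrix (A : GroupK m 𝕜) :
    MDifferentiableAt (modelK m 𝕜) 𝓘(ℝ, NormedMatrix m 𝕜) toMatrix A :=
  contMDiff_coe.mdifferentiableAt (by simp)

/-- The inverse of the chart at `1` is the exponential, whose derivative at `0` is the identity. -/
theorem mfderiv_toMatrix_one :
    (mfderiv (modelK m 𝕜) 𝓘(ℝ, NormedMatrix m 𝕜) toMatrix (1 : GroupK m 𝕜) :
      SkewLie m 𝕜 →L[ℝ] NormedMatrix m 𝕜) = inclMat m 𝕜 := by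
  rw [mfderiv_eq_fderiv_symm (mdifferentiableAt_toMatrix (m := m) (𝕜 := 𝕜) 1), extChartAt_self]
  have h1 : (fun u : SkewLie m 𝕜 => toMatrix ((extChartAt (modelK m 𝕜) (1 : GroupK m 𝕜)).symm u)) =
      fun u => (NormedSpace.exp (inclMat m 𝕜 u) : NormedMatrix m 𝕜) := by
    funext u
    have := chart_symm_apply (1 : GroupK m 𝕜) u
    refine this.trans ?_
    exact one_mul _
  rw [h1]
  have h2 : HasFDerivAt (NormedSpace.exp : NormedMatrix m 𝕜 → NormedMatrix m 𝕜)
      (1 : NormedMatrix m 𝕜 →L[ℝ] NormedMatrix m 𝕜) (inclMat m 𝕜 0) := by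
    have : CompleteSpace (NormedMatrix m 𝕜) := FiniteDimensional.complete ℝ _
    rw [map_zero]
    exact hasFDerivAt_exp_zero
  exact (h2.comp 0 (inclMat m 𝕜).hasFDerivAt).fderiv

/-- Factor the inclusion as `B ↦ A (A⁻¹ B)`: the outer multiplication is linear on matrices, and the
inner translation has the Maurer-Cartan form as differential. -/
theorem mfderiv_toMatrix (A : GroupK m 𝕜) (v : SkewLie m 𝕜) :
    (mfderiv (modelK m 𝕜) 𝓘(ℝ, NormedMatrix m 𝕜) toMatrix A :
      SkewLie m 𝕜 →L[ℝ] NormedMatrix m 𝕜) v =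
    toMatrix A * inclMat m 𝕜 (mcForm (modelK m 𝕜) A v) := by
  let L : NormedMatrix m 𝕜 →L[ℝ] NormedMatrix m 𝕜 :=
    ContinuousLinearMap.mul ℝ (NormedMatrix m 𝕜) (toMatrix A)
  have h1 : (toMatrix : GroupK m 𝕜 → NormedMatrix m 𝕜) = L ∘ toMatrix ∘ fun B => A⁻¹ * B := by
    funext B
    change toMatrix B = toMatrix A * toMatrix (A⁻¹ * B)
    rw [← toMatrix_mul, mul_inv_cancel_left]
  have hm := mdifferentiableAt_mul_left (I := modelK m 𝕜) A⁻¹ A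
  have h2 := mfderiv_comp_apply A (mdifferentiableAt_toMatrix (A⁻¹ * A)) hm v
  have h3 := mfderiv_comp_apply (g := L) A L.mdifferentiableAt
    ((mdifferentiableAt_toMatrix (A⁻¹ * A)).comp A hm) v
  rw [ContinuousLinearMap.mfderiv_eq] at h3
  have h4 : (mfderiv (modelK m 𝕜) 𝓘(ℝ, NormedMatrix m 𝕜) toMatrix (A⁻¹ * A) :
      SkewLie m 𝕜 →L[ℝ] NormedMatrix m 𝕜) = inclMat m 𝕜 :=
    (mfderiv_congr_point (by simp)).trans mfderiv_toMatrix_one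
  have h5 : (mfderiv (modelK m 𝕜) 𝓘(ℝ, NormedMatrix m 𝕜)
      (toMatrix ∘ fun B : GroupK m 𝕜 => A⁻¹ * B) A : SkewLie m 𝕜 →L[ℝ] NormedMatrix m 𝕜) v =
      inclMat m 𝕜 (mcForm (modelK m 𝕜) A v) :=
    h2.trans (congrArg (fun T : SkewLie m 𝕜 →L[ℝ] NormedMatrix m 𝕜 =>
      T (mcForm (modelK m 𝕜) A v)) h4)
  exact (congrArg (fun T : SkewLie m 𝕜 →L[ℝ] NormedMatrix m 𝕜 => T v) (mfderiv_congr h1)).trans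
    (h3.trans (congrArg L h5))

/-- The group in the chart at `1`, as a matrix-valued map. -/
def chartMat (u : SkewLie m 𝕜) : NormedMatrix m 𝕜 :=
  toMatrix ((extChartAt (modelK m 𝕜) (1 : GroupK m 𝕜)).symm u)

theorem fderiv_chartMat {u : SkewLie m 𝕜}
    (hu : u ∈ (extChartAt (modelK m 𝕜) (1 : GroupK m 𝕜)).target) (X : SkewLie m 𝕜) :
    fderiv ℝ chartMat u X =
      chartMat u * inclMat m 𝕜 (mcChart (modelK m 𝕜) (1 : GroupK m 𝕜) u X) := by
  have hs := mdifferentiableAt_extChartAt_symm (I := modelK m 𝕜) hu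
  have h := mfderiv_comp_apply u (mdifferentiableAt_toMatrix _) hs X
  rw [mfderiv_eq_fderiv] at h
  exact h.trans (mfderiv_toMatrix _ _)

theorem contDiffAt_chartMat :
    ContDiffAt ℝ ∞ (chartMat (m := m) (𝕜 := 𝕜)) (extChartAt (modelK m 𝕜) (1 : GroupK m 𝕜) 1) := by
  have hs : ContMDiffAt 𝓘(ℝ, SkewLie m 𝕜) (modelK m 𝕜) ∞
      (extChartAt (modelK m 𝕜) (1 : GroupK m 𝕜)).symm (extChartAt (modelK m 𝕜) (1 : GroupK m 𝕜) 1) :=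
    (contMDiffOn_extChartAt_symm (n := ∞) (1 : GroupK m 𝕜)).contMDiffAt
      ((isOpen_extChartAt_target (1 : GroupK m 𝕜)).mem_nhds (mem_extChartAt_target _))
  have h2 : ContMDiff (modelK m 𝕜) 𝓘(ℝ, NormedMatrix m 𝕜) ∞ (toMatrix (m := m) (𝕜 := 𝕜)) :=
    contMDiff_coe.of_le le_top
  exact contMDiffAt_iff_contDiffAt.1 (ContMDiffAt.comp _ h2.contMDiffAt hs)

theorem toMatrix_inv_mul (A : GroupK m 𝕜) : toMatrix A⁻¹ * toMatrix A = 1 := by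
  rw [← toMatrix_mul, inv_mul_cancel]; rfl

/-- The matrix-valued chart `x` satisfies `dx = x ω`. Differentiating again, using symmetry of the
second derivative and cancelling the invertible `x`, gives the Maurer-Cartan equation with the
commutator. -/
theorem hasBracket_brK : HasBracket (modelK m 𝕜) (GroupK m 𝕜) (brK m 𝕜) := by
  have hc2 : ∀ᶠ u in 𝓝 (extChartAt (modelK m 𝕜) (1 : GroupK m 𝕜) 1),
      ContDiffAt ℝ 2 (chartMat (m := m) (𝕜 := 𝕜)) u :=
    ((contDiffAt_chartMat (m := m) (𝕜 := 𝕜)).of_le ENat.LEInfty.out).eventually (by simp)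
  have ht := (eventually_mem_target (I := modelK m 𝕜) (1 : GroupK m 𝕜))
  filter_upwards [hc2, ht, ht.eventually_nhds,
    eventually_differentiableAt_mcChart (I := modelK m 𝕜) (1 : GroupK m 𝕜)] with u h1 h2 h3 h4 X Y
  set A := mcChart (modelK m 𝕜) (1 : GroupK m 𝕜) with hA
  have hAd : DifferentiableAt ℝ A u := h4.differentiableAt (by norm_num)
  have hcd := h1.differentiableAt (by norm_num)
  have hcdd : DifferentiableAt ℝ (fderiv ℝ (chartMat (m := m) (𝕜 := 𝕜))) u :=
    (h1.fderiv_right (m := 1) (by norm_num)).differentiableAt (by norm_num)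
  have hsym := h1.isSymmSndFDerivAt (by simp)
  have hder : ∀ W V : SkewLie m 𝕜, fderiv ℝ (fderiv ℝ (chartMat (m := m) (𝕜 := 𝕜))) u W V =
      chartMat u * inclMat m 𝕜 (fderiv ℝ A u W V) +
      chartMat u * inclMat m 𝕜 (A u W) * inclMat m 𝕜 (A u V) := by
    intro W V
    have d1 : HasFDerivAt (fun v => fderiv ℝ (chartMat (m := m) (𝕜 := 𝕜)) v V)
        ((ContinuousLinearMap.apply ℝ (NormedMatrix m 𝕜) V).comp
          (fderiv ℝ (fderiv ℝ chartMat) u)) u :=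
      (ContinuousLinearMap.apply ℝ (NormedMatrix m 𝕜) V).hasFDerivAt.comp u hcdd.hasFDerivAt
    have d2 : HasFDerivAt (fun v => inclMat m 𝕜 (A v V))
        (((inclMat m 𝕜).comp (ContinuousLinearMap.apply ℝ (SkewLie m 𝕜) V)).comp (fderiv ℝ A u)) u :=
      ((inclMat m 𝕜).comp (ContinuousLinearMap.apply ℝ (SkewLie m 𝕜) V)).hasFDerivAt.comp u
        hAd.hasFDerivAt
    have d3 := hcd.hasFDerivAt.mul' d2
    have d4 := d1.unique (d3.congr_of_eventuallyEq (h3.mono fun v hv => fderiv_chartMat hv V))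
    have d5 := congrArg (fun T => T W) d4
    simp [fderiv_chartMat h2] at d5
    rw [d5]
  refine inclMat_injective ?_
  have e1 := hder X Y
  have e2 := hder Y X
  rw [hsym X Y, e2] at e1
  have e3 : chartMat u * (inclMat m 𝕜 (fderiv ℝ A u X Y) - inclMat m 𝕜 (fderiv ℝ A u Y X)) =
      chartMat u * -(inclMat m 𝕜 (A u X) * inclMat m 𝕜 (A u Y) -
        inclMat m 𝕜 (A u Y) * inclMat m 𝕜 (A u X)) := by
    rw [mul_sub, mul_neg, mul_sub, ← mul_assoc, ← mul_assoc, sub_eq_iff_eq_add, ← sub_eq_zero]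
    rw [← sub_eq_zero] at e1
    rw [← neg_eq_zero, ← e1]
    abel
  have e4 := congrArg (fun S => toMatrix ((extChartAt (modelK m 𝕜) (1 : GroupK m 𝕜)).symm u)⁻¹ * S) e3
  simp only [← mul_assoc] at e4
  rw [chartMat, toMatrix_inv_mul, one_mul, one_mul] at e4
  rw [map_sub, map_neg, inclMat_brK]
  exact e4

end GroupK

/-! ### Dimension and Killing form, over the real and complex numbers together -/

section MatrixTrace

variable {m : ℕ} {𝕜 : Type*} [RCLike 𝕜]

/-- The trace of a real linear endomorphism of the square matrices over `𝕜`. -/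
theorem trace_real_matrix (f : Matrix (Fin m) (Fin m) 𝕜 →ₗ[ℝ] Matrix (Fin m) (Fin m) 𝕜) :
    LinearMap.trace ℝ _ f = ∑ a, ∑ b, (RCLike.re (f (Matrix.single a b 1) a b) +
      RCLike.im (f (Matrix.single a b RCLike.I) a b)) := by
  let e : Fin m → Fin m → Matrix (Fin m) (Fin m) 𝕜 →ₗ[ℝ] 𝕜 := fun a b =>
    Matrix.entryLinearMap ℝ 𝕜 a b
  have hf : f = ∑ a, ∑ b, ((RCLike.reLm.comp (e a b)).smulRight (f (Matrix.single a b 1)) +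
      (RCLike.imLm.comp (e a b)).smulRight (f (Matrix.single a b RCLike.I))) := by
    ext1 A
    conv_lhs => rw [Matrix.matrix_eq_sum_single A]
    simp only [map_sum, LinearMap.sum_apply, LinearMap.add_apply, LinearMap.smulRight_apply]
    refine Finset.sum_congr rfl fun a _ => Finset.sum_congr rfl fun b _ => ?_
    change f _ = RCLike.re (A a b) • f _ + RCLike.im (A a b) • f _
    rw [← map_smul, ← map_smul, ← map_add, Matrix.smul_single, Matrix.smul_single,
      ← Matrix.single_add]
    congr 2
    rw [RCLike.real_smul_eq_coe_mul, RCLike.real_smul_eq_coe_mul, mul_one, RCLike.re_add_im]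
  conv_lhs => rw [hf]
  simp only [map_sum, map_add, LinearMap.trace_smulRight]
  rfl

variable (m 𝕜) in
/-- The inclusion of the skew-Hermitian traceless matrices, as a linear map. -/
def skewIncl : SkewLie m 𝕜 →ₗ[ℝ] Matrix (Fin m) (Fin m) 𝕜 := (skewSubmodule m 𝕜).subtype

theorem skewIncl_apply (X : SkewLie m 𝕜) : skewIncl m 𝕜 X = X.1 := rfl

/-- The projection of the square matrices onto the skew-Hermitian traceless ones. -/
def skewProj (hm : m ≠ 0) : Matrix (Fin m) (Fin m) 𝕜 →ₗ[ℝ] SkewLie m 𝕜 where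
  toFun A := ⟨(1 / 2 : ℝ) • ((A - Aᴴ) - (((m : ℝ)⁻¹) • (A - Aᴴ).trace) • (1 : Matrix (Fin m) (Fin m) 𝕜)), by
    have hm' : (m : 𝕜) ≠ 0 := Nat.cast_ne_zero.2 hm
    constructor
    · simp only [Matrix.conjTranspose_smul, Matrix.conjTranspose_sub,
        Matrix.conjTranspose_conjTranspose, Matrix.conjTranspose_one, Matrix.trace_sub,
        Matrix.trace_conjTranspose, star_trivial, star_smul, star_sub, star_star]
      rw [← smul_neg]
      congr 1
      rw [neg_sub, ← neg_sub (Aᴴ) A, ← neg_sub (star A.trace) A.trace, smul_neg, neg_smul]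
      abel
    · rw [Matrix.trace_smul, Matrix.trace_sub, Matrix.trace_smul, Matrix.trace_one,
        RCLike.real_smul_eq_coe_mul (m : ℝ)⁻¹, Fintype.card_fin, smul_eq_mul]
      push_cast
      field_simp
      simp⟩
  map_add' A A' := Subtype.ext (by
    change (_ : Matrix (Fin m) (Fin m) 𝕜) = _ + _
    simp only [Matrix.conjTranspose_add, Matrix.trace_sub, Matrix.trace_add]
    rw [← smul_add]
    congr 1
    simp only [smul_sub, smul_add, add_smul, sub_smul]
    abel)
  map_smul' c A := Subtype.ext (by
    change (_ : Matrix (Fin m) (Fin m) 𝕜) = c • _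
    simp only [Matrix.conjTranspose_smul, star_trivial, ← smul_sub, Matrix.trace_smul]
    rw [smul_comm c]
    congr 1
    rw [smul_comm _ c, smul_assoc c, ← smul_sub])

theorem skewProj_val (hm : m ≠ 0) (A : Matrix (Fin m) (Fin m) 𝕜) :
    ((skewProj hm A).1 : Matrix (Fin m) (Fin m) 𝕜) =
    (1 / 2 : ℝ) • ((A - Aᴴ) - (((m : ℝ)⁻¹) • (A - Aᴴ).trace) • (1 : Matrix (Fin m) (Fin m) 𝕜)) := rfl

theorem skewProj_incl (hm : m ≠ 0) (X : SkewLie m 𝕜) : skewProj hm (skewIncl m 𝕜 X) = X := by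
  apply Subtype.ext
  rw [skewProj_val, skewIncl_apply, X.2.1, sub_neg_eq_add, Matrix.trace_add, X.2.2]
  simp only [add_zero, smul_zero, zero_smul, sub_zero]
  rw [← two_smul ℝ, smul_smul]
  norm_num

/-- Cyclicity of the trace and `skewProj_incl`. Traces on the Lie algebra can then be computed in
the space of all matrices, where the matrix units give a basis. -/
theorem trace_skew (hm : m ≠ 0) (T : SkewLie m 𝕜 →ₗ[ℝ] SkewLie m 𝕜) :
    LinearMap.trace ℝ _ T = LinearMap.trace ℝ _ ((skewIncl m 𝕜 ∘ₗ T) ∘ₗ skewProj hm) := by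
  rw [LinearMap.trace_comp_comm']
  congr 1
  ext1 X
  exact (skewProj_incl hm (T X)).symm

/-- The number `im I` is `0` in the real case and `1` in the complex case. Keeping it as a parameter
lets one computation serve both families of groups. -/
theorem im_I_mul (z : 𝕜) : RCLike.im (RCLike.I * z) = RCLike.im (RCLike.I : 𝕜) * RCLike.re z := by
  rw [RCLike.mul_im, RCLike.I_re]; ring

theorem im_mul_I_mul (z w : 𝕜) : RCLike.im (z * RCLike.I * w) =
    RCLike.im (RCLike.I : 𝕜) * RCLike.re (z * w) := by
  rw [mul_right_comm, mul_comm, im_I_mul]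

theorem im_mul_I (z : 𝕜) : RCLike.im (z * RCLike.I) = RCLike.im (RCLike.I : 𝕜) * RCLike.re z := by
  rw [mul_comm, im_I_mul]

/-- The dimension is the trace of the identity. The formula specialises to `m(m-1)/2` and `m² - 1`.
-/
theorem finrank_skewLie (hm : m ≠ 0) : (Module.finrank ℝ (SkewLie m 𝕜) : ℝ) =
    (m ^ 2 - m) / 2 + RCLike.im (RCLike.I : 𝕜) * ((m ^ 2 + m) / 2 - 1) := by
  rw [← LinearMap.trace_id, trace_skew hm, trace_real_matrix]
  have hm' : (m : ℝ) ≠ 0 := Nat.cast_ne_zero.2 hm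
  have key : ∀ a b : Fin m, RCLike.re ((((skewIncl m 𝕜 ∘ₗ LinearMap.id) ∘ₗ skewProj hm)
        (Matrix.single a b (1 : 𝕜))) a b) +
      RCLike.im ((((skewIncl m 𝕜 ∘ₗ LinearMap.id) ∘ₗ skewProj hm)
        (Matrix.single a b (RCLike.I : 𝕜))) a b) =
      (1 / 2 + RCLike.im (RCLike.I : 𝕜) * (1 / 2)) + if a = b then
        (-1 / 2 + RCLike.im (RCLike.I : 𝕜) * (1 / 2 - (m : ℝ)⁻¹)) else 0 := by
    intro a b
    simp only [LinearMap.comp_apply, LinearMap.id_apply, skewIncl_apply, skewProj_val,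
      Matrix.conjTranspose_single, Matrix.smul_apply, Matrix.sub_apply, Matrix.trace_sub,
      RCLike.smul_re, RCLike.smul_im, map_sub, star_one, RCLike.star_def, RCLike.conj_I]
    by_cases hab : a = b
    · subst hab
      simp only [Matrix.single_apply_same, Matrix.trace_single_eq_same, Matrix.one_apply_eq,
        smul_eq_mul, mul_one, RCLike.smul_re, RCLike.smul_im, map_sub, map_neg, RCLike.one_re,
        if_true]
      ring
    · have hba : ¬ b = a := fun h => hab h.symm
      simp [hab, hba, Matrix.trace_single_eq_of_ne]
      ring
  simp only [key, Finset.sum_add_distrib, Finset.sum_const, Finset.card_univ, Fintype.card_fin,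
    Finset.sum_ite_eq, Finset.mem_univ, if_true, nsmul_eq_mul]
  field_simp
  ring

theorem trace_sq_re (X : SkewLie m 𝕜) :
    RCLike.re ((X.1 * X.1 : Matrix (Fin m) (Fin m) 𝕜).trace) = -∑ a, ∑ b, ‖X.1 a b‖ ^ 2 := by
  have h : (X.1 * X.1 : Matrix (Fin m) (Fin m) 𝕜) = -(X.1 * X.1ᴴ) := by rw [X.2.1]; simp
  rw [h, Matrix.trace_neg, Matrix.trace]
  simp only [Matrix.diag_apply, Matrix.mul_apply, Matrix.conjTranspose_apply, map_neg, map_sum]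
  congr 1
  refine Finset.sum_congr rfl fun a _ => Finset.sum_congr rfl fun b _ => ?_
  rw [RCLike.star_def, RCLike.mul_conj]
  norm_cast

theorem mul_single_mul (M N : Matrix (Fin m) (Fin m) 𝕜) (i j p q : Fin m) (c : 𝕜) :
    (M * Matrix.single i j c * N) p q = M p i * c * N j q := by
  simp [Matrix.mul_apply, Matrix.single_apply, ite_and]

/-- Here `f` is `ad_M²` after the skew part `A ↦ (A - Aᴴ)/2`. The sum of `Re (M a a * M b b)` coming
from `A ↦ M A M` is the real part of the squared trace of `M`, hence zero. -/
theorem trace_matrix_ad_sq {M : Matrix (Fin m) (Fin m) 𝕜} (hM : M.trace = 0)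
    {f : Matrix (Fin m) (Fin m) 𝕜 →ₗ[ℝ] Matrix (Fin m) (Fin m) 𝕜}
    (hf : ∀ A, f A = (1 / 2 : ℝ) • (M * M * (A - Aᴴ) - (2 : ℝ) • (M * (A - Aᴴ) * M) +
      (A - Aᴴ) * (M * M))) :
    LinearMap.trace ℝ _ f =
    ((1 + RCLike.im (RCLike.I : 𝕜)) * m - (1 - RCLike.im (RCLike.I : 𝕜))) *
      RCLike.re ((M * M).trace) +
    (1 - RCLike.im (RCLike.I : 𝕜)) * ∑ a, ∑ b, RCLike.re (M a b * M a b) := by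
  rw [trace_real_matrix]
  have hl : ∀ (i j p q : Fin m) (c : 𝕜), (M * M * Matrix.single i j c) p q =
      (M * M) p i * c * (1 : Matrix (Fin m) (Fin m) 𝕜) j q := by
    intro i j p q c
    rw [← mul_single_mul, mul_one]
  have hr : ∀ (i j p q : Fin m) (c : 𝕜), (Matrix.single i j c * (M * M)) p q =
      (1 : Matrix (Fin m) (Fin m) 𝕜) p i * c * (M * M) j q := by
    intro i j p q c
    rw [← mul_single_mul, one_mul]
  have key : ∀ a b : Fin m, RCLike.re (f (Matrix.single a b 1) a b) +
      RCLike.im (f (Matrix.single a b RCLike.I) a b) =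
      (1 + RCLike.im (RCLike.I : 𝕜)) * (RCLike.re ((M * M) a a) / 2 + RCLike.re ((M * M) b b) / 2 -
        RCLike.re (M a a * M b b)) +
      (1 - RCLike.im (RCLike.I : 𝕜)) * RCLike.re (M a b * M a b) - if a = b then
        (1 - RCLike.im (RCLike.I : 𝕜)) * RCLike.re ((M * M) a a) else 0 := by
    intro a b
    simp only [hf, Matrix.conjTranspose_single, star_one, RCLike.star_def, RCLike.conj_I, mul_sub,
      sub_mul, Matrix.smul_apply, Matrix.sub_apply, Matrix.add_apply, smul_sub, hl, hr,
      mul_single_mul, Matrix.one_apply_eq, mul_one, one_mul, RCLike.smul_re, RCLike.smul_im,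
      map_sub, map_add, mul_neg, neg_mul, map_neg, im_mul_I_mul,
      im_mul_I, im_I_mul]
    by_cases hab : a = b
    · subst hab
      simp only [Matrix.one_apply_eq, mul_one, one_mul, if_true]
      ring
    · simp only [Matrix.one_apply_ne hab, hab, if_false, mul_zero,
        zero_mul, map_zero]
      ring
  have htr : ∑ a, ∑ b, RCLike.re (M a a * M b b) = 0 := by
    simp_rw [← map_sum, ← Finset.mul_sum, ← Finset.sum_mul]
    have h0 : ∑ a, M a a = 0 := hM
    rw [h0, zero_mul, map_zero]
  have hQ : ∑ a, RCLike.re ((M * M) a a) = RCLike.re ((M * M).trace) := by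
    rw [Matrix.trace, map_sum]; rfl
  simp only [key, Finset.sum_add_distrib, Finset.sum_sub_distrib, ← Finset.mul_sum,
    Finset.sum_const, Finset.card_univ, Fintype.card_fin, Finset.sum_ite_eq, Finset.mem_univ,
    if_true, nsmul_eq_mul, htr, ← Finset.sum_div, hQ]
  ring

/-- The scalar matrix subtracted in `skewProj` drops out of commutators. This is the Killing form:
over the reals the last sum is `-tr X²` and the total is `(m-2) tr X²`; over the complex numbers it
is `2m tr X²`. -/
theorem trace_ad_sq (hm : m ≠ 0) (X : SkewLie m 𝕜) :
    LinearMap.trace ℝ _ ((brK m 𝕜 X : SkewLie m 𝕜 →ₗ[ℝ] SkewLie m 𝕜) ∘ₗ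
      (brK m 𝕜 X : SkewLie m 𝕜 →ₗ[ℝ] SkewLie m 𝕜)) =
    ((1 + RCLike.im (RCLike.I : 𝕜)) * m - (1 - RCLike.im (RCLike.I : 𝕜))) *
      RCLike.re ((X.1 * X.1 : Matrix (Fin m) (Fin m) 𝕜).trace) +
    (1 - RCLike.im (RCLike.I : 𝕜)) * ∑ a, ∑ b, RCLike.re (X.1 a b * X.1 a b) := by
  rw [trace_skew hm]
  refine trace_matrix_ad_sq (M := X.1) X.2.2 fun A => ?_
  change X.1 * (X.1 * (skewProj hm A).1 - (skewProj hm A).1 * X.1) -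
    (X.1 * (skewProj hm A).1 - (skewProj hm A).1 * X.1) * X.1 = _
  rw [skewProj_val]
  generalize (X.1 : Matrix (Fin m) (Fin m) 𝕜) = M
  generalize A - Aᴴ = D
  generalize ((m : ℝ)⁻¹) • D.trace = c
  simp only [mul_sub, sub_mul, mul_smul_comm, smul_mul_assoc, mul_one, one_mul, smul_sub, smul_add,
    mul_assoc]
  module

theorem im_I_nonneg : 0 ≤ RCLike.im (RCLike.I : 𝕜) ∧ RCLike.im (RCLike.I : 𝕜) ≤ 1 := by
  rcases RCLike.I_eq_zero_or_im_I_eq_one (K := 𝕜) with h | h <;> simp [h]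

/-- The trace form of the adjoint representation is bounded by the trace form of the standard one. -/
theorem neg_trace_ad_sq_le (hm : m ≠ 0) (X : SkewLie m 𝕜) :
    -LinearMap.trace ℝ _ ((brK m 𝕜 X : SkewLie m 𝕜 →ₗ[ℝ] SkewLie m 𝕜) ∘ₗ
      (brK m 𝕜 X : SkewLie m 𝕜 →ₗ[ℝ] SkewLie m 𝕜)) ≤
    (1 + RCLike.im (RCLike.I : 𝕜)) * m *
      -RCLike.re ((X.1 * X.1 : Matrix (Fin m) (Fin m) 𝕜).trace) := by
  rw [trace_ad_sq hm]
  -- The trace of `X²` is minus the sum of the squared norms of the entries, a lower bound for the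
  -- sum of their squares. It absorbs exactly the `1 - im I` terms.
  have h1 : RCLike.re ((X.1 * X.1 : Matrix (Fin m) (Fin m) 𝕜).trace) ≤
      ∑ a, ∑ b, RCLike.re (X.1 a b * X.1 a b) := by
    rw [trace_sq_re, ← Finset.sum_neg_distrib]
    refine Finset.sum_le_sum fun a _ => ?_
    rw [← Finset.sum_neg_distrib]
    refine Finset.sum_le_sum fun b _ => ?_
    have := RCLike.abs_re_le_norm (X.1 a b * X.1 a b)
    rw [norm_mul, ← pow_two ‖X.1 a b‖] at this
    exact (abs_le.1 this).1
  have h2 := (im_I_nonneg (𝕜 := 𝕜)).2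
  nlinarith

/-- In the real case this is `m² - 3m + 3 ≥ 0`, in the complex case `m² ≥ 3/2`. The factor `2 dim K
+ 1` is one less than the dimension of `K × K × H`. -/
theorem one_add_im_mul_sq_le (hm : 3 ≤ m) : (1 + RCLike.im (RCLike.I : 𝕜)) * m ^ 2 ≤
    3 / 2 * (2 * (Module.finrank ℝ (SkewLie m 𝕜) : ℝ) + 1) := by
  rw [finrank_skewLie (by omega)]
  have h1 := (im_I_nonneg (𝕜 := 𝕜)).1
  have h2 := (im_I_nonneg (𝕜 := 𝕜)).2
  have h3 : (3 : ℝ) ≤ m := by exact_mod_cast hm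
  have h4 : 0 ≤ RCLike.im (RCLike.I : 𝕜) * ((m : ℝ) ^ 2 / 2 + 3 / 2 * m - 3) :=
    mul_nonneg h1 (by nlinarith)
  nlinarith [sq_nonneg ((m : ℝ) - 3 / 2)]

end MatrixTrace

/-! ### The Casimir element of the standard representation -/

section Casimir

variable {m : ℕ} {𝕜 : Type*} [RCLike 𝕜]

/-- The skew-symmetric matrix `E_pq - E_qp`. -/
def skewSingle {p q : Fin m} (hpq : p ≠ q) : SkewLie m 𝕜 :=
  ⟨Matrix.single p q 1 - Matrix.single q p 1, by
    constructor
    · simp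
    · simp [Matrix.trace_single_eq_of_ne, hpq, hpq.symm]⟩

theorem skewSingle_val {p q : Fin m} (hpq : p ≠ q) :
    ((skewSingle hpq).1 : Matrix (Fin m) (Fin m) 𝕜) =
      Matrix.single p q 1 - Matrix.single q p 1 := rfl

theorem nontrivial_skewLie (hm : 3 ≤ m) : Nontrivial (SkewLie m 𝕜) := by
  have h01 : (⟨0, by omega⟩ : Fin m) ≠ ⟨1, by omega⟩ := by simp
  refine ⟨skewSingle h01, 0, fun h => ?_⟩
  have h2 := congrArg (fun X : SkewLie m 𝕜 => X.1 ⟨0, by omega⟩ ⟨1, by omega⟩) h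
  have h3 : ((skewSingle h01).1 : Matrix (Fin m) (Fin m) 𝕜) ⟨0, by omega⟩ ⟨1, by omega⟩ = 0 := h2
  simp [skewSingle_val] at h3

/-- A matrix that commutes with the Lie algebra is a multiple of the identity. -/
theorem eq_smul_one_of_commute (hm : 3 ≤ m) {C : Matrix (Fin m) (Fin m) 𝕜}
    (hC : ∀ Z : SkewLie m 𝕜, Z.1 * C = C * Z.1) :
    C = C ⟨0, by omega⟩ ⟨0, by omega⟩ • (1 : Matrix (Fin m) (Fin m) 𝕜) := by
  have h1 : ∀ p q r s : Fin m, p ≠ q →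
      (if r = p then C q s else 0) - (if r = q then C p s else 0) =
      (if q = s then C r p else 0) - (if p = s then C r q else 0) := by
    intro p q r s hpq
    have h := congrArg (fun M : Matrix (Fin m) (Fin m) 𝕜 => M r s) (hC (skewSingle hpq))
    simp only [skewSingle_val, sub_mul, mul_sub, Matrix.sub_apply] at h
    have hl : ∀ i j : Fin m, (Matrix.single i j (1 : 𝕜) * C) r s = if r = i then C j s else 0 := by
      intro i j
      rw [← one_mul (Matrix.single i j (1 : 𝕜)), mul_single_mul, Matrix.one_apply]
      simp
    have hr : ∀ i j : Fin m, (C * Matrix.single i j (1 : 𝕜)) r s = if j = s then C r i else 0 := by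
      intro i j
      rw [← mul_one (C * _), mul_single_mul, Matrix.one_apply]
      simp
    rw [hl, hl, hr, hr] at h
    exact h
  have hoff : ∀ r p : Fin m, r ≠ p → C r p = 0 := by
    intro r p hrp
    -- A third index exists since `3 ≤ m`. The entry `(r, q)` of the commutation relation with `E_pq
    -- - E_qp` isolates `C r p`.
    obtain ⟨q, hq⟩ : ∃ q : Fin m, q ∉ ({r, p} : Finset (Fin m)) := by
      by_contra! h
      have h2 : (Finset.univ : Finset (Fin m)).card ≤ ({r, p} : Finset (Fin m)).card :=
        Finset.card_le_card fun q _ => h q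
      have h3 : ({r, p} : Finset (Fin m)).card ≤ 2 := Finset.card_le_two
      rw [Finset.card_univ, Fintype.card_fin] at h2
      omega
    simp only [Finset.mem_insert, Finset.mem_singleton, not_or] at hq
    have := h1 p q r q (fun h => hq.2 h.symm)
    simpa [hrp, Ne.symm hq.1, Ne.symm hq.2] using this.symm
  have hdiag : ∀ p q : Fin m, C p p = C q q := by
    intro p q
    by_cases hpq : p = q
    · rw [hpq]
    · have := h1 p q p q hpq
      simpa [hpq] using this.symm
  ext r s
  rw [Matrix.smul_apply, Matrix.one_apply]
  by_cases hrs : r = s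
  · subst hrs
    simpa using hdiag _ _
  · simpa [hrs] using hoff r s hrs

variable {B : SkewLie m 𝕜 →L[ℝ] SkewLie m 𝕜 →L[ℝ] ℝ} {ι : Type*} [Fintype ι] [DecidableEq ι]
  {b : Module.Basis ι ℝ (SkewLie m 𝕜)}

/-- In an orthonormal basis the matrix `a` of `ad Z` is antisymmetric by invariance. The commutator
is the contraction of `a` with the symmetric products `b_j b_i + b_i b_j`, hence zero. -/
theorem commute_casimir (hsymm : ∀ X Y, B X Y = B Y X)
    (had : ∀ Z X Y, B (brK m 𝕜 Z X) Y = -B X (brK m 𝕜 Z Y))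
    (hb : ∀ i j, B (b i) (b j) = if i = j then 1 else 0) (Z : SkewLie m 𝕜) :
    Z.1 * (∑ i, (b i).1 * (b i).1 : Matrix (Fin m) (Fin m) 𝕜) = (∑ i, (b i).1 * (b i).1) * Z.1 := by
  let a : ι → ι → ℝ := fun i j => B (brK m 𝕜 Z (b i)) (b j)
  have ha : ∀ i j, a i j = -a j i := fun i j => by
    change B _ _ = -B _ _
    rw [had, hsymm]
  have hexp : ∀ i, (Z.1 * (b i).1 - (b i).1 * Z.1 : Matrix (Fin m) (Fin m) 𝕜) =
      ∑ j, a i j • (b j).1 := by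
    intro i
    have h1 : brK m 𝕜 Z (b i) = ∑ j, a i j • b j := by
      conv_lhs => rw [← b.sum_repr (brK m 𝕜 Z (b i))]
      refine Finset.sum_congr rfl fun j _ => ?_
      rw [repr_eq_form (B := formLin B) b hb]
      rfl
    have h2 := congrArg (skewIncl m 𝕜) h1
    rw [map_sum] at h2
    simp only [map_smul] at h2
    exact h2
  have h0 : (∑ i, ∑ j, a i j • ((b j).1 * (b i).1 + (b i).1 * (b j).1 :
      Matrix (Fin m) (Fin m) 𝕜)) = 0 := by
    have h1 : (∑ i, ∑ j, a i j • ((b j).1 * (b i).1 + (b i).1 * (b j).1 :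
        Matrix (Fin m) (Fin m) 𝕜)) = -∑ i, ∑ j, a i j • ((b j).1 * (b i).1 + (b i).1 * (b j).1 :
        Matrix (Fin m) (Fin m) 𝕜) := by
      conv_lhs => rw [Finset.sum_comm]
      rw [← Finset.sum_neg_distrib]
      refine Finset.sum_congr rfl fun i _ => ?_
      rw [← Finset.sum_neg_distrib]
      refine Finset.sum_congr rfl fun j _ => ?_
      rw [ha j i, neg_smul, add_comm]
    have h2 := add_eq_zero_iff_eq_neg.2 h1
    rw [← two_smul ℝ] at h2
    exact (smul_eq_zero.1 h2).resolve_left two_ne_zero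
  rw [← sub_eq_zero, ← h0, Finset.mul_sum, Finset.sum_mul, ← Finset.sum_sub_distrib]
  refine Finset.sum_congr rfl fun i _ => ?_
  have e1 : (∑ j, a i j • ((b j).1 * (b i).1) : Matrix (Fin m) (Fin m) 𝕜) =
      (∑ j, a i j • (b j).1) * (b i).1 := by
    rw [Finset.sum_mul]; simp only [smul_mul_assoc]
  have e2 : (∑ j, a i j • ((b i).1 * (b j).1) : Matrix (Fin m) (Fin m) 𝕜) =
      (b i).1 * ∑ j, a i j • (b j).1 := by
    rw [Finset.mul_sum]; simp only [mul_smul_comm]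
  simp only [smul_add, Finset.sum_add_distrib]
  rw [e1, e2, ← hexp i]
  noncomm_ring

/-- The Casimir operator of the standard representation is a negative multiple of the identity. -/
theorem exists_casimir (hm : 3 ≤ m) (hsymm : ∀ X Y, B X Y = B Y X)
    (had : ∀ Z X Y, B (brK m 𝕜 Z X) Y = -B X (brK m 𝕜 Z Y))
    (hb : ∀ i j, B (b i) (b j) = if i = j then 1 else 0) :
    ∃ μ : ℝ, 0 < μ ∧ (∑ i, (b i).1 * (b i).1 : Matrix (Fin m) (Fin m) 𝕜) =
      (-μ) • (1 : Matrix (Fin m) (Fin m) 𝕜) := by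
  set C : Matrix (Fin m) (Fin m) 𝕜 := ∑ i, (b i).1 * (b i).1 with hCdef
  have hC := eq_smul_one_of_commute hm (commute_casimir hsymm had hb)
  rw [← hCdef] at hC
  set c := C ⟨0, by omega⟩ ⟨0, by omega⟩ with hc
  -- The Casimir matrix is Hermitian, so its scalar is real; its trace is minus a positive sum of
  -- squares, so the scalar is negative.
  have hCH : Cᴴ = C := by
    rw [hCdef, Matrix.conjTranspose_sum]
    refine Finset.sum_congr rfl fun i _ => ?_
    rw [Matrix.conjTranspose_mul, (b i).2.1]
    simp
  have hcr : ((RCLike.re c : ℝ) : 𝕜) = c := by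
    rw [← RCLike.conj_eq_iff_re, hc]
    exact congrArg (fun M : Matrix (Fin m) (Fin m) 𝕜 => M ⟨0, by omega⟩ ⟨0, by omega⟩) hCH
  have hCr : C = RCLike.re c • (1 : Matrix (Fin m) (Fin m) 𝕜) := by
    rw [hC, ← hcr]
    ext i j
    simp [RCLike.real_smul_eq_coe_mul]
  have htr : RCLike.re C.trace = RCLike.re c * m := by
    rw [hCr, Matrix.trace_smul, RCLike.smul_re, Matrix.trace_one]
    simp
  have htr2 : RCLike.re C.trace = -∑ i, ∑ a, ∑ d, ‖(b i).1 a d‖ ^ 2 := by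
    rw [hCdef, Matrix.trace_sum, map_sum, ← Finset.sum_neg_distrib]
    exact Finset.sum_congr rfl fun i _ => trace_sq_re (b i)
  have hpos : 0 < ∑ i, ∑ a, ∑ d, ‖(b i).1 a d‖ ^ 2 := by
    have := nontrivial_skewLie (𝕜 := 𝕜) hm
    obtain ⟨i⟩ := b.index_nonempty
    refine Finset.sum_pos' (fun i _ => by positivity) ⟨i, Finset.mem_univ _, ?_⟩
    have hne : ((b i).1 : Matrix (Fin m) (Fin m) 𝕜) ≠ 0 := fun h => b.ne_zero i (Subtype.ext h)
    obtain ⟨a, d, had⟩ : ∃ a d, ((b i).1 : Matrix (Fin m) (Fin m) 𝕜) a d ≠ 0 := by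
      by_contra! h
      exact hne (Matrix.ext h)
    refine Finset.sum_pos' (fun i _ => by positivity) ⟨a, Finset.mem_univ _, ?_⟩
    exact Finset.sum_pos' (fun i _ => by positivity) ⟨d, Finset.mem_univ _, by positivity⟩
  refine ⟨-RCLike.re c, ?_, by rw [neg_neg]; exact hCr⟩
  have hm0 : (0 : ℝ) < m := by exact_mod_cast (by omega : 0 < m)
  rw [htr2] at htr
  by_contra! hcon
  nlinarith

/-- By invariance the inner sum is `-tr (ad b_i)²`, which is bounded by the trace form of the
standard representation. Summed over `i`, that trace form is `m μ` by the Casimir identity, and the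
dimension estimate finishes. -/
theorem sum_bracket_sq_le (hm : 3 ≤ m)
    (had : ∀ Z X Y, B (brK m 𝕜 Z X) Y = -B X (brK m 𝕜 Z Y))
    (hb : ∀ i j, B (b i) (b j) = if i = j then 1 else 0) {μ : ℝ} (hμ : 0 < μ)
    (hC : (∑ i, (b i).1 * (b i).1 : Matrix (Fin m) (Fin m) 𝕜) =
      (-μ) • (1 : Matrix (Fin m) (Fin m) 𝕜)) :
    ∑ i, ∑ j, B (brK m 𝕜 (b i) (b j)) (brK m 𝕜 (b i) (b j)) ≤
      3 / 2 * (2 * Fintype.card ι + 1) * μ := by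
  have h1 : ∀ i, ∑ j, B (brK m 𝕜 (b i) (b j)) (brK m 𝕜 (b i) (b j)) =
      -LinearMap.trace ℝ _ ((brK m 𝕜 (b i) : SkewLie m 𝕜 →ₗ[ℝ] SkewLie m 𝕜) ∘ₗ
      (brK m 𝕜 (b i) : SkewLie m 𝕜 →ₗ[ℝ] SkewLie m 𝕜)) := by
    intro i
    rw [trace_eq_sum_form (B := formLin B) b hb, ← Finset.sum_neg_distrib]
    refine Finset.sum_congr rfl fun j _ => ?_
    change _ = -B (brK m 𝕜 (b i) (brK m 𝕜 (b i) (b j))) (b j)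
    rw [had (b i) (brK m 𝕜 (b i) (b j)) (b j), neg_neg]
  have hm0 : m ≠ 0 := by omega
  have h2 : ∑ i, -RCLike.re ((b i).1 * (b i).1 : Matrix (Fin m) (Fin m) 𝕜).trace = m * μ := by
    rw [Finset.sum_neg_distrib, ← map_sum, ← Matrix.trace_sum, hC, Matrix.trace_smul,
      RCLike.smul_re, Matrix.trace_one]
    simp [mul_comm]
  calc ∑ i, ∑ j, B (brK m 𝕜 (b i) (b j)) (brK m 𝕜 (b i) (b j))
      ≤ ∑ i, (1 + RCLike.im (RCLike.I : 𝕜)) * m *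
        -RCLike.re ((b i).1 * (b i).1 : Matrix (Fin m) (Fin m) 𝕜).trace := by
        refine Finset.sum_le_sum fun i _ => ?_
        rw [h1]
        exact neg_trace_ad_sq_le hm0 (b i)
    _ = (1 + RCLike.im (RCLike.I : 𝕜)) * m ^ 2 * μ := by rw [← Finset.mul_sum, h2]; ring
    _ ≤ _ := by
        refine mul_le_mul_of_nonneg_right ?_ hμ.le
        rw [← Module.finrank_eq_card_basis b]
        exact one_add_im_mul_sq_le hm

end Casimir

/-! ### Ad-invariance of a bi-invariant metric -/

section AdInvariance

attribute [local instance] Matrix.linftyOpNormedRing Matrix.linftyOpNormedAlgebra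

variable {m : ℕ} {𝕜 : Type*} [RCLike 𝕜]

/-- The differential of conjugation, in matrix terms. -/
theorem inclMat_mfderiv_conj (a : GroupK m 𝕜) (v : SkewLie m 𝕜) :
    inclMat m 𝕜 ((mfderiv (modelK m 𝕜) (modelK m 𝕜) (fun x : GroupK m 𝕜 => a * x * a⁻¹) 1 :
      SkewLie m 𝕜 →L[ℝ] SkewLie m 𝕜) v) = toMatrix a * inclMat m 𝕜 v * toMatrix a⁻¹ := by
  let L : NormedMatrix m 𝕜 →L[ℝ] NormedMatrix m 𝕜 :=
    ContinuousLinearMap.mulLeftRight ℝ (NormedMatrix m 𝕜) (toMatrix a) (toMatrix a⁻¹)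
  have hL : (toMatrix ∘ fun x : GroupK m 𝕜 => a * x * a⁻¹) = L ∘ toMatrix := rfl
  have hc : MDifferentiableAt (modelK m 𝕜) (modelK m 𝕜) (fun x : GroupK m 𝕜 => a * x * a⁻¹) 1 :=
    (((contMDiff_const (c := a)).mul contMDiff_id).mul (contMDiff_const (c := a⁻¹))
      : ContMDiff (modelK m 𝕜) (modelK m 𝕜) ∞ fun x : GroupK m 𝕜 => a * x * a⁻¹).mdifferentiableAt
      (by simp)
  have h1 := mfderiv_comp_apply (1 : GroupK m 𝕜) (mdifferentiableAt_toMatrix (a * 1 * a⁻¹)) hc v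
  have h2 := mfderiv_comp_apply (g := L) (1 : GroupK m 𝕜) L.mdifferentiableAt
    (mdifferentiableAt_toMatrix 1) v
  rw [ContinuousLinearMap.mfderiv_eq] at h2
  have h4 : (mfderiv (modelK m 𝕜) 𝓘(ℝ, NormedMatrix m 𝕜) toMatrix (a * 1 * a⁻¹) :
      SkewLie m 𝕜 →L[ℝ] NormedMatrix m 𝕜) = inclMat m 𝕜 :=
    (mfderiv_congr_point (by simp)).trans mfderiv_toMatrix_one
  have h5 := congrArg (fun T : SkewLie m 𝕜 →L[ℝ] NormedMatrix m 𝕜 =>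
    T ((mfderiv (modelK m 𝕜) (modelK m 𝕜) (fun x : GroupK m 𝕜 => a * x * a⁻¹) 1 :
      SkewLie m 𝕜 →L[ℝ] SkewLie m 𝕜) v)) h4
  have h6 := congrArg (fun T : SkewLie m 𝕜 →L[ℝ] NormedMatrix m 𝕜 => L (T v))
    (mfderiv_toMatrix_one (m := m) (𝕜 := 𝕜))
  exact h5.symm.trans (h1.symm.trans (h2.trans h6))

/-- A bi-invariant metric is invariant under the adjoint representation. -/
theorem inner_conj {h : MetricField (modelK m 𝕜) (GroupK m 𝕜)}
    (hl : IsLeftInvariant (modelK m 𝕜) h) (hr : IsRightInvariant (modelK m 𝕜) h)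
    (a : GroupK m 𝕜) (v w : SkewLie m 𝕜) :
    (h 1 : SkewLie m 𝕜 →L[ℝ] SkewLie m 𝕜 →L[ℝ] ℝ)
      ((mfderiv (modelK m 𝕜) (modelK m 𝕜) (fun x : GroupK m 𝕜 => a * x * a⁻¹) 1 :
        SkewLie m 𝕜 →L[ℝ] SkewLie m 𝕜) v)
      ((mfderiv (modelK m 𝕜) (modelK m 𝕜) (fun x : GroupK m 𝕜 => a * x * a⁻¹) 1 :
        SkewLie m 𝕜 →L[ℝ] SkewLie m 𝕜) w) =
    (h 1 : SkewLie m 𝕜 →L[ℝ] SkewLie m 𝕜 →L[ℝ] ℝ) v w := by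
  have hd1 : MDifferentiableAt (modelK m 𝕜) (modelK m 𝕜) (fun x : GroupK m 𝕜 => a * x) 1 :=
    mdifferentiableAt_mul_left a 1
  have hd2 : MDifferentiableAt (modelK m 𝕜) (modelK m 𝕜) (fun x : GroupK m 𝕜 => x * a⁻¹) (a * 1) :=
    ((contMDiff_mul_right (n := ∞) (a := a⁻¹)) : ContMDiff (modelK m 𝕜) (modelK m 𝕜) ∞ _).mdifferentiableAt
      (by simp)
  have hc := mfderiv_comp_apply (1 : GroupK m 𝕜) hd2 hd1
  have e1 := congrArg (fun T : MetricField (modelK m 𝕜) (GroupK m 𝕜) =>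
    (T 1 : SkewLie m 𝕜 →L[ℝ] SkewLie m 𝕜 →L[ℝ] ℝ) v w) (hl a)
  have e2 := congrArg (fun T : MetricField (modelK m 𝕜) (GroupK m 𝕜) =>
    (T (a * 1) : SkewLie m 𝕜 →L[ℝ] SkewLie m 𝕜 →L[ℝ] ℝ)
      ((mfderiv (modelK m 𝕜) (modelK m 𝕜) (fun x : GroupK m 𝕜 => a * x) 1 :
        SkewLie m 𝕜 →L[ℝ] SkewLie m 𝕜) v)
      ((mfderiv (modelK m 𝕜) (modelK m 𝕜) (fun x : GroupK m 𝕜 => a * x) 1 :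
        SkewLie m 𝕜 →L[ℝ] SkewLie m 𝕜) w)) (hr a⁻¹)
  have e4 := e2.trans e1
  have e5 := metricField_congr h (x := a * 1 * a⁻¹) (y := 1) (by simp)
    (v := (mfderiv (modelK m 𝕜) (modelK m 𝕜) (fun x : GroupK m 𝕜 => a * x * a⁻¹) 1 :
      SkewLie m 𝕜 →L[ℝ] SkewLie m 𝕜) v)
    (w := (mfderiv (modelK m 𝕜) (modelK m 𝕜) (fun x : GroupK m 𝕜 => a * x * a⁻¹) 1 :
      SkewLie m 𝕜 →L[ℝ] SkewLie m 𝕜) w) rfl rfl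
  refine e5.symm.trans (Eq.trans ?_ e4)
  have hcv : (mfderiv (modelK m 𝕜) (modelK m 𝕜) (fun x : GroupK m 𝕜 => a * x * a⁻¹) 1 :
        SkewLie m 𝕜 →L[ℝ] SkewLie m 𝕜) v = _ := hc v
  have hcw : (mfderiv (modelK m 𝕜) (modelK m 𝕜) (fun x : GroupK m 𝕜 => a * x * a⁻¹) 1 :
        SkewLie m 𝕜 →L[ℝ] SkewLie m 𝕜) w = _ := hc w
  exact congrArg₂ (fun X Y => (h (a * 1 * a⁻¹) : SkewLie m 𝕜 →L[ℝ] SkewLie m 𝕜 →L[ℝ] ℝ) X Y) hcv hcw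

theorem hasDerivAt_conj_exp (Z M : NormedMatrix m 𝕜) :
    HasDerivAt (fun t : ℝ => NormedSpace.exp (t • Z) * M * NormedSpace.exp (t • (-Z)))
      (Z * M - M * Z) 0 := by
  have : CompleteSpace (NormedMatrix m 𝕜) := FiniteDimensional.complete ℝ _
  have h1 := hasDerivAt_exp_smul_const (𝕂 := ℝ) Z (0 : ℝ)
  have h2 := hasDerivAt_exp_smul_const (𝕂 := ℝ) (-Z) (0 : ℝ)
  have h3 := (h1.mul_const M).mul h2
  refine h3.congr_deriv ?_
  simp only [zero_smul, NormedSpace.exp_zero, one_mul, mul_one]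
  rw [mul_neg, sub_eq_add_neg]

/-- A bi-invariant metric is infinitesimally invariant under the adjoint representation. -/
theorem inner_brK {h : MetricField (modelK m 𝕜) (GroupK m 𝕜)}
    (hl : IsLeftInvariant (modelK m 𝕜) h) (hr : IsRightInvariant (modelK m 𝕜) h)
    (Z X Y : SkewLie m 𝕜) :
    (h 1 : SkewLie m 𝕜 →L[ℝ] SkewLie m 𝕜 →L[ℝ] ℝ) (brK m 𝕜 Z X) Y =
    -(h 1 : SkewLie m 𝕜 →L[ℝ] SkewLie m 𝕜 →L[ℝ] ℝ) X (brK m 𝕜 Z Y) := by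
  obtain ⟨P, hP⟩ := LinearMap.exists_leftInverse_of_injective (skewIncl m 𝕜)
    (LinearMap.ker_eq_bot.2 inclMat_injective)
  let Pc : NormedMatrix m 𝕜 →L[ℝ] SkewLie m 𝕜 :=
    LinearMap.toContinuousLinearMap (E := NormedMatrix m 𝕜) (F' := SkewLie m 𝕜) P
  have hPc : ∀ X, Pc (inclMat m 𝕜 X) = X := fun X => LinearMap.congr_fun hP X
  set B : SkewLie m 𝕜 →L[ℝ] SkewLie m 𝕜 →L[ℝ] ℝ := h 1 with hB
  -- The curve `Ad (exp tZ) X`, computed with matrices and brought back to the Lie algebra by a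
  -- linear left inverse of the inclusion. Its inner products are constant in `t`, and the
  -- derivative at `0` is the claim.
  let γ : SkewLie m 𝕜 → ℝ → SkewLie m 𝕜 := fun X t =>
    Pc (NormedSpace.exp (t • inclMat m 𝕜 Z) * inclMat m 𝕜 X *
      NormedSpace.exp (t • (-inclMat m 𝕜 Z)))
  have hγ : ∀ X, HasDerivAt (γ X) (brK m 𝕜 Z X) 0 := by
    intro X
    have h1 := Pc.hasFDerivAt.comp_hasDerivAt (0 : ℝ)
      (hasDerivAt_conj_exp (inclMat m 𝕜 Z) (inclMat m 𝕜 X))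
    rw [← inclMat_brK, hPc] at h1
    exact h1
  have hγ0 : ∀ X, γ X 0 = X := by
    intro X
    change Pc _ = X
    rw [zero_smul, zero_smul, NormedSpace.exp_zero, one_mul, mul_one, hPc]
  have hconst : ∀ t, B (γ X t) (γ Y t) = B X Y := by
    intro t
    let a : GroupK m 𝕜 := ⟨NormedSpace.exp (t • Z.1),
      exp_mem_specialUnitaryGroup ((skewSubmodule m 𝕜).smul_mem t Z.2)⟩
    have ha : toMatrix a⁻¹ = NormedSpace.exp (t • (-inclMat m 𝕜 Z)) := by
      have h1 : toMatrix a⁻¹ = (NormedSpace.exp (t • Z.1) : Matrix (Fin m) (Fin m) 𝕜)ᴴ := coe_inv a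
      rw [h1, ← Matrix.exp_conjTranspose, Matrix.conjTranspose_smul, Z.2.1, star_trivial]
      rfl
    have hT : ∀ X, γ X t = (mfderiv (modelK m 𝕜) (modelK m 𝕜) (fun x : GroupK m 𝕜 => a * x * a⁻¹) 1 :
      SkewLie m 𝕜 →L[ℝ] SkewLie m 𝕜) X := by
      intro X
      rw [← hPc ((mfderiv (modelK m 𝕜) (modelK m 𝕜) (fun x : GroupK m 𝕜 => a * x * a⁻¹) 1 :
        SkewLie m 𝕜 →L[ℝ] SkewLie m 𝕜) X), inclMat_mfderiv_conj, ha]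
      rfl
    rw [hT, hT]
    exact inner_conj hl hr a X Y
  have hd : HasDerivAt (fun t => B (γ X t) (γ Y t))
      (B (brK m 𝕜 Z X) (γ Y 0) + B (γ X 0) (brK m 𝕜 Z Y)) 0 := by
    have h1 : HasDerivAt (fun t => B (γ X t)) (B (brK m 𝕜 Z X)) 0 :=
      B.hasFDerivAt.comp_hasDerivAt 0 (hγ X)
    exact h1.clm_apply (hγ Y)
  have hd0 : HasDerivAt (fun t => B (γ X t) (γ Y t)) 0 0 := by
    rw [funext hconst]; exact hasDerivAt_const _ _
  have := hd.unique hd0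
  rw [hγ0, hγ0] at this
  exact eq_neg_of_add_eq_zero_left this

end AdInvariance

/-! ### Scalar curvature after the conformal change by the class function -/

section ClassFunction

attribute [local instance] Matrix.linftyOpNormedRing Matrix.linftyOpNormedAlgebra

variable {m : ℕ} {𝕜 : Type*} [RCLike 𝕜]

variable (m 𝕜) in
/-- The real part of the trace. -/
def reTr : NormedMatrix m 𝕜 →L[ℝ] ℝ :=
  LinearMap.toContinuousLinearMap (E := NormedMatrix m 𝕜) (F' := ℝ)
    (RCLike.reLm ∘ₗ Matrix.traceLinearMap (Fin m) ℝ 𝕜)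

theorem reTr_apply (M : NormedMatrix m 𝕜) :
    reTr m 𝕜 M = RCLike.re (Matrix.trace (M : Matrix (Fin m) (Fin m) 𝕜)) := rfl

theorem classFun_eq (ε : ℝ) (x : GroupK m 𝕜) :
    classFun ε x = Real.exp (2 * (ε / m * reTr m 𝕜 (toMatrix x))) := by
  rw [classFun, reTr_apply]
  congr 1
  change _ = 2 * (ε / m * RCLike.re (x : Matrix (Fin m) (Fin m) 𝕜).trace)
  ring

theorem classFun_pos (ε : ℝ) (x : GroupK m 𝕜) : 0 < classFun ε x := Real.exp_pos _

theorem contMDiff_classFun (ε : ℝ) :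
    ContMDiff (modelK m 𝕜) 𝓘(ℝ, ℝ) ∞ (classFun ε : GroupK m 𝕜 → ℝ) := by
  have h1 : ContMDiff (modelK m 𝕜) 𝓘(ℝ, NormedMatrix m 𝕜) ∞ (toMatrix (m := m) (𝕜 := 𝕜)) :=
    contMDiff_coe.of_le le_top
  have h2 : ContDiff ℝ ∞ fun M : NormedMatrix m 𝕜 => Real.exp (2 * (ε / m * reTr m 𝕜 M)) := by
    fun_prop
  rw [show (classFun ε : GroupK m 𝕜 → ℝ) =
    (fun M : NormedMatrix m 𝕜 => Real.exp (2 * (ε / m * reTr m 𝕜 M))) ∘ toMatrix from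
    funext (classFun_eq ε)]
  exact h2.contMDiff.comp h1

theorem chartMat_base : chartMat (extChartAt (modelK m 𝕜) (1 : GroupK m 𝕜) 1) = 1 := by
  rw [chartMat, extChartAt_to_inv]; rfl

variable {E H : Type*} [NormedAddCommGroup E] [NormedSpace ℝ E] [FiniteDimensional ℝ E]
  [TopologicalSpace H] {I : ModelWithCorners ℝ E H} [I.Boundaryless]
  {G : Type*} [TopologicalSpace G] [ChartedSpace H G] [Group G]

variable (I) in
/-- `ρ` is a smooth homomorphism which is given by the linear map `dρ` in the charts at `1`. -/
structure IsLinearInCharts (ρ : G →* GroupK m 𝕜) (dρ : E →L[ℝ] SkewLie m 𝕜) : Prop where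
  contMDiff : ContMDiff I (modelK m 𝕜) ∞ ρ
  base : dρ (extChartAt I (1 : G) 1) = extChartAt (modelK m 𝕜) (1 : GroupK m 𝕜) 1
  map_symm : ∀ w, ρ ((extChartAt I (1 : G)).symm w) =
    (extChartAt (modelK m 𝕜) (1 : GroupK m 𝕜)).symm (dρ w)
  map_mcChart : ∀ᶠ w in 𝓝 (extChartAt I (1 : G) 1), ∀ X,
    dρ (mcChart I (1 : G) w X) = mcChart (modelK m 𝕜) (1 : GroupK m 𝕜) (dρ w) (dρ X)

variable [LieGroup I ∞ G] {ι : Type*} [Fintype ι] [DecidableEq ι]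

/-- The scalar curvature of a conformal change of a left invariant metric by a class function. -/
theorem scalarCurvature_classFun {ρ : G →* GroupK m 𝕜} {dρ : E →L[ℝ] SkewLie m 𝕜}
    (hρ : IsLinearInCharts I ρ dρ) {B : E →L[ℝ] E →L[ℝ] ℝ} {br : E →L[ℝ] E →L[ℝ] E}
    (hMC : HasBracket I G br)
    (hsymm : ∀ a c, B a c = B c a) (hpos : ∀ a, a ≠ 0 → 0 < B a a)
    (hbr : ∀ a c, br a c = -br c a)
    (b : Module.Basis ι ℝ E) (hb : ∀ i j, B (b i) (b j) = if i = j then 1 else 0)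
    (huni : ∀ a, ∑ i, B (br a (b i)) (b i) = 0) (ε : ℝ) (p : G) :
    scalarCurvature I (fun x => classFun ε (ρ x) • leftInvMetric I B x) p =
      Real.exp (-2 * (ε / m * reTr m 𝕜 (toMatrix (ρ p)))) *
        ((-1 / 4 * ∑ i, ∑ j, B (br (b i) (b j)) (br (b i) (b j)) -
        1 / 2 * ∑ i, ∑ j, B (br (b i) (br (b i) (b j))) (b j)) -
        2 * (Fintype.card ι - 1) * (ε / m * ∑ i, reTr m 𝕜 (toMatrix (ρ p) *
          (inclMat m 𝕜 (dρ (b i)) * inclMat m 𝕜 (dρ (b i))))) -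
        (Fintype.card ι - 1) * (Fintype.card ι - 2) *
          ∑ i, (ε / m * reTr m 𝕜 (toMatrix (ρ p) * inclMat m 𝕜 (dρ (b i)))) *
            (ε / m * reTr m 𝕜 (toMatrix (ρ p) * inclMat m 𝕜 (dρ (b i))))) := by
  have hΦ : ContMDiff I 𝓘(ℝ, ℝ) ∞ (fun x : G => classFun ε (ρ x)) :=
    (contMDiff_classFun ε).comp hρ.contMDiff
  rw [scalarCurvature_smul_leftInvMetric hsymm hpos hΦ (fun x => classFun_pos ε _) p,
    scalarCurvature, metricInChart_leftInvMetric B (fun x => classFun ε (ρ (p * x)))]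
  set u₀ := extChartAt I (1 : G) 1 with hu₀
  set x : NormedMatrix m 𝕜 := toMatrix (ρ p) with hx
  -- `Λ M X` is the derivative of `(ε/m) Re tr` at `x M` in the left invariant direction `X`. It is
  -- linear in `M`, so a further derivative just replaces `M` by `M dρ(Y)`.
  let Λ : NormedMatrix m 𝕜 →L[ℝ] E →L[ℝ] ℝ := (ε / m) •
    (((ContinuousLinearMap.compL ℝ E (NormedMatrix m 𝕜) ℝ (reTr m 𝕜)).comp
      (ContinuousLinearMap.precomp (NormedMatrix m 𝕜) ((inclMat m 𝕜).comp dρ))).comp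
      ((ContinuousLinearMap.mul ℝ (NormedMatrix m 𝕜)).comp
        (ContinuousLinearMap.mul ℝ (NormedMatrix m 𝕜) x)))
  have hΛ : ∀ M X, Λ M X = ε / m * reTr m 𝕜 (x * M * inclMat m 𝕜 (dρ X)) := fun M X => rfl
  let f : E → ℝ := fun u => ε / m * reTr m 𝕜 (x * chartMat (dρ u))
  let f₁ : E → E →L[ℝ] ℝ := fun u => Λ (chartMat (dρ u))
  have hcm : ContDiffAt ℝ ∞ (fun u => chartMat (m := m) (𝕜 := 𝕜) (dρ u)) u₀ := by
    have := contDiffAt_chartMat (m := m) (𝕜 := 𝕜)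
    rw [← hρ.base] at this
    exact this.comp u₀ dρ.contDiff.contDiffAt
  have htarget : ∀ᶠ u in 𝓝 u₀, dρ u ∈ (extChartAt (modelK m 𝕜) (1 : GroupK m 𝕜)).target := by
    have h1 := eventually_mem_target (I := modelK m 𝕜) (1 : GroupK m 𝕜)
    rw [← hρ.base] at h1
    exact dρ.continuous.continuousAt.eventually h1
  have hdiff : ∀ᶠ u in 𝓝 u₀, HasFDerivAt (fun u => chartMat (m := m) (𝕜 := 𝕜) (dρ u))
      ((fderiv ℝ chartMat (dρ u)).comp dρ) u := by
    have h1 : ∀ᶠ v in 𝓝 (dρ u₀), ContDiffAt ℝ 1 (chartMat (m := m) (𝕜 := 𝕜)) v := by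
      rw [hρ.base]
      exact ((contDiffAt_chartMat (m := m) (𝕜 := 𝕜)).of_le ENat.LEInfty.out).eventually (by simp)
    filter_upwards [dρ.continuous.continuousAt.eventually h1] with u hu
    exact (hu.differentiableAt (by norm_num)).hasFDerivAt.comp u dρ.hasFDerivAt
  have hfun : (fun u => classFun ε (ρ (p * (extChartAt I (1 : G)).symm u)) •
      pullForm B (mcChart I (1 : G) u)) =
      fun u => Real.exp (2 * f u) • pullForm B (mcChart I (1 : G) u) := by
    funext u
    rw [map_mul, classFun_eq, toMatrix_mul, hρ.map_symm]
    rfl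
  rw [hfun, trace_ricciEnd_conformal (A := mcChart I (1 : G)) (f := f) (f₁ := f₁) (br := br)
    ((contDiffAt_mcChart (1 : G)).of_le ENat.LEInfty.out) mcChart_one ?_ ?_ hMC ?_ hsymm hpos hbr b
    hb huni]
  · have hbase : chartMat (dρ u₀) = (1 : NormedMatrix m 𝕜) := by rw [hρ.base, chartMat_base]
    have hf0 : f u₀ = ε / m * reTr m 𝕜 x := by
      change ε / m * reTr m 𝕜 (x * chartMat (dρ u₀)) = _
      rw [hbase, mul_one]
    have hf10 : ∀ X, f₁ u₀ X = ε / m * reTr m 𝕜 (x * inclMat m 𝕜 (dρ X)) := by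
      intro X
      change Λ (chartMat (dρ u₀)) X = _
      rw [hΛ, hbase, mul_one]
    have hf2 : ∀ X, fderiv ℝ f₁ u₀ X X =
        ε / m * reTr m 𝕜 (x * (inclMat m 𝕜 (dρ X) * inclMat m 𝕜 (dρ X))) := by
      intro X
      have h1 : HasFDerivAt f₁ _ u₀ := Λ.hasFDerivAt.comp u₀ hdiff.self_of_nhds
      rw [h1.fderiv]
      change Λ (fderiv ℝ chartMat (dρ u₀) (dρ X)) X = _
      rw [fderiv_chartMat htarget.self_of_nhds, hbase, one_mul, hρ.base, mcChart_one, hΛ, mul_assoc]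
      rfl
    simp only [← hu₀, hf0, hf10, hf2]
    rw [← Finset.mul_sum]
  · have : ContDiffAt ℝ ∞ f u₀ := by
      have h2 : ContDiff ℝ ∞ fun M : NormedMatrix m 𝕜 => ε / m * reTr m 𝕜 (x * M) := by fun_prop
      exact h2.contDiffAt.comp u₀ hcm
    exact this.of_le ENat.LEInfty.out
  · exact Λ.differentiableAt.comp u₀ (hcm.differentiableAt (by simp))
  · filter_upwards [hdiff, htarget, hρ.map_mcChart] with u h1 h2 h3 X
    have h4 : HasFDerivAt f _ u :=
      ((((reTr m 𝕜).comp (ContinuousLinearMap.mul ℝ (NormedMatrix m 𝕜) x)).hasFDerivAt.comp u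
        h1)).const_mul (ε / m)
    rw [h4.fderiv]
    change ε / m * reTr m 𝕜 (x * fderiv ℝ chartMat (dρ u) (dρ X)) =
      ε / m * reTr m 𝕜 (x * chartMat (dρ u) * inclMat m 𝕜 (dρ (mcChart I (1 : G) u X)))
    rw [fderiv_chartMat h2, h3, mul_assoc]

end ClassFunction

/-! ### The form at the identity, its orthonormal bases and bracket sums -/

section TotalForm

variable {E E' : Type*} [NormedAddCommGroup E] [NormedSpace ℝ E] [NormedAddCommGroup E']
  [NormedSpace ℝ E']

/-- The form `B(x, x') + k(λ x + z, λ x' + z')` on `E × E'`. -/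
def totalForm (B : E →L[ℝ] E →L[ℝ] ℝ) (k : E' →L[ℝ] E' →L[ℝ] ℝ) (lam : E →L[ℝ] E') :
    E × E' →L[ℝ] E × E' →L[ℝ] ℝ :=
  pullForm B (.fst ℝ E E') + pullForm k (lam.comp (.fst ℝ E E') + .snd ℝ E E')

variable {B : E →L[ℝ] E →L[ℝ] ℝ} {k : E' →L[ℝ] E' →L[ℝ] ℝ} {lam : E →L[ℝ] E'}

theorem totalForm_apply (v w : E × E') : totalForm B k lam v w =
    B v.1 w.1 + k (lam v.1 + v.2) (lam w.1 + w.2) := rfl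

theorem totalForm_symm (hB : ∀ a c, B a c = B c a) (hk : ∀ a c, k a c = k c a) (v w : E × E') :
    totalForm B k lam v w = totalForm B k lam w v := by
  rw [totalForm_apply, totalForm_apply, hB, hk]

theorem totalForm_pos (hB : ∀ a, a ≠ 0 → 0 < B a a) (hk : ∀ a, a ≠ 0 → 0 < k a a) (v : E × E')
    (hv : v ≠ 0) : 0 < totalForm B k lam v v := by
  have hB' : ∀ a, 0 ≤ B a a := fun a => by
    by_cases h : a = 0
    · simp [h]
    · exact (hB a h).le
  have hk' : ∀ a, 0 ≤ k a a := fun a => by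
    by_cases h : a = 0
    · simp [h]
    · exact (hk a h).le
  rw [totalForm_apply]
  by_cases h1 : v.1 = 0
  · have h2 : v.2 ≠ 0 := fun h2 => hv (Prod.ext h1 h2)
    rw [h1, map_zero lam, zero_add]
    exact add_pos_of_nonneg_of_pos (hB' _) (hk _ h2)
  · exact add_pos_of_pos_of_nonneg (hB _ h1) (hk' _)

variable {ι κ : Type*}

/-- The horizontal lifts of a basis of `E` and a basis of `E'`. -/
def totalBasis (b : Module.Basis ι ℝ E) (c : Module.Basis κ ℝ E') (lam : E →L[ℝ] E') :
    Module.Basis (ι ⊕ κ) ℝ (E × E') :=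
  (b.prod c).map (LinearEquiv.skewProd (.refl ℝ E) (.refl ℝ E') (-lam : E →L[ℝ] E').toLinearMap)

theorem totalBasis_inl (b : Module.Basis ι ℝ E) (c : Module.Basis κ ℝ E') (i : ι) :
    totalBasis b c lam (Sum.inl i) = (b i, -lam (b i)) := by
  simp [totalBasis]

theorem totalBasis_inr (b : Module.Basis ι ℝ E) (c : Module.Basis κ ℝ E') (j : κ) :
    totalBasis b c lam (Sum.inr j) = (0, c j) := by
  simp [totalBasis]

theorem totalForm_totalBasis [DecidableEq ι] [DecidableEq κ] {b : Module.Basis ι ℝ E}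
    {c : Module.Basis κ ℝ E'} (hb : ∀ i j, B (b i) (b j) = if i = j then 1 else 0)
    (hc : ∀ i j, k (c i) (c j) = if i = j then 1 else 0) (i j : ι ⊕ κ) :
    totalForm B k lam (totalBasis b c lam i) (totalBasis b c lam j) = if i = j then 1 else 0 := by
  rcases i with i | i <;> rcases j with j | j <;>
    simp [totalBasis_inl, totalBasis_inr, totalForm_apply, hb, hc]

section Sums

variable [Fintype ι] [Fintype κ] (b : Module.Basis ι ℝ E) (c : Module.Basis κ ℝ E')
  {br : E →L[ℝ] E →L[ℝ] E} {br' : E' →L[ℝ] E' →L[ℝ] E'}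

theorem brProd_skew (h : ∀ a c, br a c = -br c a) (h' : ∀ a c, br' a c = -br' c a)
    (v w : E × E') : brProd br br' v w = -brProd br br' w v := by
  rw [brProd_apply, brProd_apply, h, h' v.2]; rfl

theorem sum_prod_unimodular (h : ∀ a, ∑ i, B (br a (b i)) (b i) = 0)
    (h' : ∀ a, ∑ i, k (br' a (c i)) (c i) = 0) (v : E × E') :
    ∑ i, totalForm B k 0 (brProd br br' v (totalBasis b c 0 i)) (totalBasis b c 0 i) = 0 := by
  simp [Fintype.sum_sum_type, totalBasis_inl, totalBasis_inr, totalForm_apply, brProd_apply, h, h']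

theorem sum_prod_bracket_sq :
    ∑ i, ∑ j, totalForm B k 0 (brProd br br' (totalBasis b c 0 i) (totalBasis b c 0 j))
      (brProd br br' (totalBasis b c 0 i) (totalBasis b c 0 j)) =
    ∑ i, ∑ j, B (br (b i) (b j)) (br (b i) (b j)) +
      ∑ i, ∑ j, k (br' (c i) (c j)) (br' (c i) (c j)) := by
  simp [Fintype.sum_sum_type, totalBasis_inl, totalBasis_inr, totalForm_apply, brProd_apply]

theorem sum_prod_bracket_bracket :
    ∑ i, ∑ j, totalForm B k 0 (brProd br br' (totalBasis b c 0 i)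
      (brProd br br' (totalBasis b c 0 i) (totalBasis b c 0 j))) (totalBasis b c 0 j) =
    ∑ i, ∑ j, B (br (b i) (br (b i) (b j))) (b j) +
      ∑ i, ∑ j, k (br' (c i) (br' (c i) (c j))) (c j) := by
  simp [Fintype.sum_sum_type, totalBasis_inl, totalBasis_inr, totalForm_apply, brProd_apply]

theorem sum_total_unimodular (h : ∀ a, ∑ i, B (br a (b i)) (b i) = 0) (v : E × E') :
    ∑ i, totalForm B k lam (brProd br 0 v (totalBasis b c lam i)) (totalBasis b c lam i) = 0 := by
  simp [Fintype.sum_sum_type, totalBasis_inl, totalBasis_inr, totalForm_apply, brProd_apply, h]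

/-- The bracket of two horizontal lifts is `([b_i, b_j], 0)`, with vertical part `λ [b_i, b_j]`;
brackets with vertical vectors vanish. -/
theorem sum_total_bracket_sq :
    ∑ i, ∑ j, totalForm B k lam (brProd br 0 (totalBasis b c lam i) (totalBasis b c lam j))
      (brProd br 0 (totalBasis b c lam i) (totalBasis b c lam j)) =
    ∑ i, ∑ j, B (br (b i) (b j)) (br (b i) (b j)) +
      ∑ i, ∑ j, k (lam (br (b i) (b j))) (lam (br (b i) (b j))) := by
  simp [Fintype.sum_sum_type, totalBasis_inl, totalBasis_inr, totalForm_apply, brProd_apply,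
    Finset.sum_add_distrib]

/-- A horizontal lift has no vertical part, so pairing with it removes `λ`. Thus `λ` affects the
scalar curvature only through the squared brackets. -/
theorem sum_total_bracket_bracket :
    ∑ i, ∑ j, totalForm B k lam (brProd br 0 (totalBasis b c lam i)
      (brProd br 0 (totalBasis b c lam i) (totalBasis b c lam j))) (totalBasis b c lam j) =
    ∑ i, ∑ j, B (br (b i) (br (b i) (b j))) (b j) := by
  simp [Fintype.sum_sum_type, totalBasis_inl, totalBasis_inr, totalForm_apply, brProd_apply]

end Sums

theorem exists_orthonormal_basis [FiniteDimensional ℝ E] (hB : ∀ a c, B a c = B c a)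
    (hpos : ∀ a, a ≠ 0 → 0 < B a a) :
    ∃ b : Module.Basis (Fin (Module.finrank ℝ E)) ℝ E,
      ∀ i j, B (b i) (b j) = if i = j then 1 else 0 := by
  have hs : (formLin B).IsSymm := ⟨fun x y => hB x y⟩
  obtain ⟨v, hv⟩ := LinearMap.BilinForm.exists_orthogonal_basis hs
  have hvp : ∀ i, 0 < B (v i) (v i) := fun i => hpos _ (v.ne_zero i)
  refine ⟨v.unitsSMul fun i => Units.mk0 (Real.sqrt (B (v i) (v i)))⁻¹
    (inv_ne_zero (Real.sqrt_ne_zero'.2 (hvp i))), fun i j => ?_⟩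
  simp only [Module.Basis.unitsSMul_apply, Units.smul_mk0, map_smul, smul_apply, smul_eq_mul]
  by_cases hij : i = j
  · subst hij
    rw [if_pos rfl]
    have := Real.mul_self_sqrt (hvp i).le
    have h0 := Real.sqrt_ne_zero'.2 (hvp i)
    field_simp
    rw [pow_two, this]
  · have : B (v i) (v j) = 0 := hv hij
    rw [if_neg hij, this, mul_zero, mul_zero]

end TotalForm

/-! ### The given metrics as left invariant metrics -/

section InvariantMetrics

variable {E H : Type*} [NormedAddCommGroup E] [NormedSpace ℝ E] [TopologicalSpace H]
  {E' H' : Type*} [NormedAddCommGroup E'] [NormedSpace ℝ E'] [TopologicalSpace H']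
  {I : ModelWithCorners ℝ E H} {J : ModelWithCorners ℝ E' H'}
  {G : Type*} [TopologicalSpace G] [ChartedSpace H G] [Group G]
  {T : Type*} [TopologicalSpace T] [ChartedSpace H' T] [Group T]

theorem eq_leftInvMetric {h : MetricField I G} (hl : IsLeftInvariant I h) :
    h = leftInvMetric I (h 1 : E →L[ℝ] E →L[ℝ] ℝ) := by
  funext x
  refine ContinuousLinearMap.ext fun v => ContinuousLinearMap.ext fun w => ?_
  have e1 := congrArg (fun T : MetricField I G =>
    (T x : E →L[ℝ] E →L[ℝ] ℝ) v w) (hl x⁻¹)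
  refine e1.symm.trans ?_
  exact metricField_congr h (inv_mul_cancel x) (v := mcForm I x v) (w := mcForm I x w) rfl rfl

variable [LieGroup I ∞ G] [LieGroup J ∞ T]

/-- The connection form factors through the Maurer-Cartan form of the product group, so `g_λ` is
itself left invariant. -/
theorem metricOfForm_eq (B : E →L[ℝ] E →L[ℝ] ℝ) (k : MetricField J T)
    (lam : GroupLieAlgebra I G →L[ℝ] GroupLieAlgebra J T) :
    metricOfForm I J (leftInvMetric I B) k lam =
      leftInvMetric (I.prod J) (totalForm B (k 1 : E' →L[ℝ] E' →L[ℝ] ℝ) (lam : E →L[ℝ] E')) := by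
  funext p
  refine ContinuousLinearMap.ext fun v => ContinuousLinearMap.ext fun w => ?_
  have h1 : (mfderiv (I.prod J) I Prod.fst p : E × E' →L[ℝ] E) = .fst ℝ E E' := mfderiv_fst
  have h2 : (mfderiv (I.prod J) J Prod.snd p : E × E' →L[ℝ] E') = .snd ℝ E E' := mfderiv_snd
  let lam₀ : E →L[ℝ] E' := lam
  let k₀ : E' →L[ℝ] E' →L[ℝ] ℝ := k 1
  change B (mcForm I p.1 ((mfderiv (I.prod J) I Prod.fst p : E × E' →L[ℝ] E) v))
      (mcForm I p.1 ((mfderiv (I.prod J) I Prod.fst p : E × E' →L[ℝ] E) w)) +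
    k₀
      (lam₀ (mcForm I p.1 ((mfderiv (I.prod J) I Prod.fst p : E × E' →L[ℝ] E) v)) +
        mcForm J p.2 ((mfderiv (I.prod J) J Prod.snd p : E × E' →L[ℝ] E') v))
      (lam₀ (mcForm I p.1 ((mfderiv (I.prod J) I Prod.fst p : E × E' →L[ℝ] E) w)) +
        mcForm J p.2 ((mfderiv (I.prod J) J Prod.snd p : E × E' →L[ℝ] E') w)) =
    totalForm B k₀ lam₀ (mcForm (I.prod J) p v)
      (mcForm (I.prod J) p w)
  rw [h1, h2, mcForm_prod]
  rfl

theorem prodMetric_eq (B : E →L[ℝ] E →L[ℝ] ℝ) (k : E' →L[ℝ] E' →L[ℝ] ℝ) :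
    prodMetric I J (leftInvMetric (G := G) I B) (leftInvMetric (G := T) J k) =
      leftInvMetric (I.prod J) (totalForm B k 0) := by
  funext p
  refine ContinuousLinearMap.ext fun v => ContinuousLinearMap.ext fun w => ?_
  have h1 : (mfderiv (I.prod J) I Prod.fst p : E × E' →L[ℝ] E) = .fst ℝ E E' := mfderiv_fst
  have h2 : (mfderiv (I.prod J) J Prod.snd p : E × E' →L[ℝ] E') = .snd ℝ E E' := mfderiv_snd
  change B (mcForm I p.1 ((mfderiv (I.prod J) I Prod.fst p : E × E' →L[ℝ] E) v))
      (mcForm I p.1 ((mfderiv (I.prod J) I Prod.fst p : E × E' →L[ℝ] E) w)) +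
    k (mcForm J p.2 ((mfderiv (I.prod J) J Prod.snd p : E × E' →L[ℝ] E') v))
      (mcForm J p.2 ((mfderiv (I.prod J) J Prod.snd p : E × E' →L[ℝ] E') w)) =
    totalForm B k 0 (mcForm (I.prod J) p v) (mcForm (I.prod J) p w)
  rw [h1, h2, mcForm_prod, totalForm_apply, zero_apply, zero_apply, zero_add, zero_add]
  rfl

end InvariantMetrics

/-! ### Where the scalar curvature is maximal -/

section MaxScalar

variable {m : ℕ} {𝕜 : Type*} [RCLike 𝕜]

/-- The real part of the trace of a unitary matrix, in terms of its distance to the identity. -/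
theorem two_mul_reTr (x : GroupK m 𝕜) : 2 * reTr m 𝕜 (toMatrix x) =
    2 * m - ∑ a, ∑ b, ‖(x.1 - 1 : Matrix (Fin m) (Fin m) 𝕜) a b‖ ^ 2 := by
  have hx : (x.1 * x.1ᴴ : Matrix (Fin m) (Fin m) 𝕜) = 1 :=
    Matrix.mem_unitaryGroup_iff.1 (Matrix.mem_specialUnitaryGroup_iff.1 x.2).1
  have h1 : RCLike.re ((x.1 - 1) * (x.1 - 1)ᴴ : Matrix (Fin m) (Fin m) 𝕜).trace =
      ∑ a, ∑ b, ‖(x.1 - 1 : Matrix (Fin m) (Fin m) 𝕜) a b‖ ^ 2 := by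
    rw [Matrix.trace, map_sum]
    refine Finset.sum_congr rfl fun a _ => ?_
    rw [Matrix.diag_apply, Matrix.mul_apply, map_sum]
    refine Finset.sum_congr rfl fun b _ => ?_
    rw [Matrix.conjTranspose_apply, RCLike.star_def, RCLike.mul_conj]
    norm_cast
  have h2 : ((x.1 - 1) * (x.1 - 1)ᴴ : Matrix (Fin m) (Fin m) 𝕜) = 1 - x.1 - x.1ᴴ + 1 := by
    rw [Matrix.conjTranspose_sub, Matrix.conjTranspose_one, sub_mul, mul_sub, mul_sub, hx, mul_one,
      one_mul, mul_one]
    abel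
  rw [← h1, h2, Matrix.trace_add, Matrix.trace_sub, Matrix.trace_sub, Matrix.trace_conjTranspose,
    Matrix.trace_one, reTr_apply]
  simp only [map_add, map_sub, RCLike.star_def, RCLike.conj_re, Fintype.card_fin, RCLike.natCast_re]
  change 2 * RCLike.re (x.1 : Matrix (Fin m) (Fin m) 𝕜).trace = _
  ring

theorem reTr_le (x : GroupK m 𝕜) : reTr m 𝕜 (toMatrix x) ≤ m := by
  have h1 := two_mul_reTr x
  have h2 : 0 ≤ ∑ a, ∑ b, ‖(x.1 - 1 : Matrix (Fin m) (Fin m) 𝕜) a b‖ ^ 2 := by positivity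
  linarith

theorem eq_one_of_reTr_eq {x : GroupK m 𝕜} (hx : reTr m 𝕜 (toMatrix x) = m) : x = 1 := by
  have h1 := two_mul_reTr x
  have h2 : ∑ a, ∑ b, ‖(x.1 - 1 : Matrix (Fin m) (Fin m) 𝕜) a b‖ ^ 2 = 0 := by linarith
  apply Subtype.ext
  rw [← sub_eq_zero]
  ext a b
  have h3 := (Finset.sum_eq_zero_iff_of_nonneg (fun a _ => by positivity)).1 h2 a (Finset.mem_univ a)
  have h4 := (Finset.sum_eq_zero_iff_of_nonneg (fun a _ => by positivity)).1 h3 b (Finset.mem_univ b)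
  exact norm_eq_zero.1 (pow_eq_zero_iff two_ne_zero |>.1 h4)

theorem reTr_one : reTr m 𝕜 (toMatrix (1 : GroupK m 𝕜)) = m := by
  rw [reTr_apply]
  change RCLike.re (1 : Matrix (Fin m) (Fin m) 𝕜).trace = m
  simp

/-- `t ↦ e^{-2t} (s + 2ct)` increases as long as `s + 2ct < c`. -/
theorem exp_mul_lt {s c t r : ℝ} (hc : 0 < c) (hr : s + 2 * c * r < c) (h : t < r) :
    Real.exp (-2 * t) * (s + 2 * c * t) < Real.exp (-2 * r) * (s + 2 * c * r) := by
  have h1 : Real.exp (-2 * r) = Real.exp (-2 * t) * Real.exp (-2 * (r - t)) := by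
    rw [← Real.exp_add]; ring_nf
  rw [h1, mul_assoc (Real.exp _) (Real.exp _)]
  refine mul_lt_mul_of_pos_left ?_ (Real.exp_pos _)
  -- With `x = e^{-2(r-t)}` the claim is `(s + 2cr)(1 - x) < 2c(r - t)`. It follows from `s + 2cr <
  -- c` and `0 < 1 - x ≤ 2(r - t)`.
  have h2 := Real.add_one_le_exp (-2 * (r - t))
  have h3 : Real.exp (-2 * (r - t)) < 1 := by
    rw [← Real.exp_zero]; exact Real.exp_lt_exp.2 (by linarith)
  nlinarith

variable {E H : Type*} [NormedAddCommGroup E] [NormedSpace ℝ E] [FiniteDimensional ℝ E]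
  [TopologicalSpace H] {I : ModelWithCorners ℝ E H} [I.Boundaryless]
  {G : Type*} [TopologicalSpace G] [ChartedSpace H G] [Group G] [LieGroup I ∞ G]
  {ι : Type*} [Fintype ι] [DecidableEq ι]

/-- The scalar curvature of a conformal change by a class function is maximal on the kernel. -/
theorem maxScalarSet_classFun {ρ : G →* GroupK m 𝕜} {dρ : E →L[ℝ] SkewLie m 𝕜}
    (hρ : IsLinearInCharts I ρ dρ) {B : E →L[ℝ] E →L[ℝ] ℝ} {br : E →L[ℝ] E →L[ℝ] E}
    (hMC : HasBracket I G br)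
    (hsymm : ∀ a c, B a c = B c a) (hpos : ∀ a, a ≠ 0 → 0 < B a a)
    (hbr : ∀ a c, br a c = -br c a)
    (b : Module.Basis ι ℝ E) (hb : ∀ i j, B (b i) (b j) = if i = j then 1 else 0)
    (huni : ∀ a, ∑ i, B (br a (b i)) (b i) = 0)
    {ε μ S : ℝ} (hε : 0 < ε) (hε' : ε < 1 / 8) (hm : m ≠ 0) (hμ : 0 < μ)
    (hcard : 2 ≤ Fintype.card ι)
    (hcas : ∑ i, inclMat m 𝕜 (dρ (b i)) * inclMat m 𝕜 (dρ (b i)) = (-μ) • 1)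
    (hSdef : S = -1 / 4 * ∑ i, ∑ j, B (br (b i) (b j)) (br (b i) (b j)) -
        1 / 2 * ∑ i, ∑ j, B (br (b i) (br (b i) (b j))) (b j))
    (hS : S ≤ 3 / 4 * ((Fintype.card ι - 1) * μ)) :
    maxScalarSet I (fun x => classFun ε (ρ x) • leftInvMetric I B x) = {p | ρ p = 1} ∧
    ∀ p, ρ p = 1 → scalarCurvature I (fun x => classFun ε (ρ x) • leftInvMetric I B x) p =
      Real.exp (-2 * ε) * (S + 2 * ((Fintype.card ι - 1) * μ) * ε) := by
  set c : ℝ := (Fintype.card ι - 1) * μ with hcdef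
  have hcard' : (2 : ℝ) ≤ Fintype.card ι := by exact_mod_cast hcard
  have hc : 0 < c := mul_pos (by linarith) hμ
  have hm' : (0 : ℝ) < m := by exact_mod_cast Nat.pos_of_ne_zero hm
  -- The conformal exponent `t` is at most `ε`, with equality only on the kernel. The gradient term
  -- `q` is nonnegative, and it vanishes on the kernel because Lie algebra elements are traceless.
  let t : G → ℝ := fun p => ε / m * reTr m 𝕜 (toMatrix (ρ p))
  let q : G → ℝ := fun p => (Fintype.card ι - 1) * (Fintype.card ι - 2) *
    ∑ i, (ε / m * reTr m 𝕜 (toMatrix (ρ p) * inclMat m 𝕜 (dρ (b i)))) *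
      (ε / m * reTr m 𝕜 (toMatrix (ρ p) * inclMat m 𝕜 (dρ (b i))))
  have hscal : ∀ p, scalarCurvature I (fun x => classFun ε (ρ x) • leftInvMetric I B x) p =
      Real.exp (-2 * t p) * (S + 2 * c * t p - q p) := by
    intro p
    rw [scalarCurvature_classFun hρ hMC hsymm hpos hbr b hb huni, ← hSdef, ← map_sum,
      ← Finset.mul_sum, hcas, mul_smul_comm, mul_one, map_smul, smul_eq_mul]
    congr 1
    simp only [t, q, hcdef]
    ring
  have hq : ∀ p, 0 ≤ q p := fun p => mul_nonneg (mul_nonneg (by linarith) (by linarith))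
    (Finset.sum_nonneg fun i _ => mul_self_nonneg _)
  have hval : ∀ p, ρ p = 1 →
      scalarCurvature I (fun x => classFun ε (ρ x) • leftInvMetric I B x) p =
      Real.exp (-2 * ε) * (S + 2 * c * ε) := by
    intro p hp
    have ht : t p = ε := by
      change ε / m * reTr m 𝕜 (toMatrix (ρ p)) = ε
      rw [hp, reTr_one]
      field_simp
    have hq0 : q p = 0 := by
      simp only [q]
      have h1 : ∀ X : SkewLie m 𝕜, reTr m 𝕜 (toMatrix (ρ p) * inclMat m 𝕜 X) = 0 := by
        intro X
        have : toMatrix (ρ p) * inclMat m 𝕜 X = inclMat m 𝕜 X := by rw [hp]; exact one_mul _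
        rw [this, reTr_apply]
        have hX : Matrix.trace (X.1 : Matrix (Fin m) (Fin m) 𝕜) = 0 := X.2.2
        exact (congrArg RCLike.re hX).trans (map_zero _)
      simp [h1]
    rw [hscal, ht, hq0, sub_zero]
  have hlt : ∀ p, ρ p ≠ 1 →
      scalarCurvature I (fun x => classFun ε (ρ x) • leftInvMetric I B x) p <
      Real.exp (-2 * ε) * (S + 2 * c * ε) := by
    intro p hp
    have ht : t p < ε := by
      have h1 : reTr m 𝕜 (toMatrix (ρ p)) < m :=
        lt_of_le_of_ne (reTr_le _) fun h => hp (eq_one_of_reTr_eq h)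
      calc ε / m * reTr m 𝕜 (toMatrix (ρ p)) < ε / m * m :=
            mul_lt_mul_of_pos_left h1 (by positivity)
        _ = ε := by field_simp
    rw [hscal]
    -- The bounds `S ≤ 3c/4` and `ε < 1/8` give `S + 2cε < c`.
    refine lt_of_le_of_lt ?_ (exp_mul_lt hc (by nlinarith) ht)
    exact mul_le_mul_of_nonneg_left (by linarith [hq p]) (Real.exp_pos _).le
  refine ⟨?_, hval⟩
  ext p
  constructor
  · intro hp
    by_contra hne
    have h1 := hp 1
    rw [hval 1 (map_one ρ)] at h1
    exact absurd (hlt p hne) (not_lt.2 h1)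
  · intro hp r
    rw [hval p hp]
    by_cases hr : ρ r = 1
    · rw [hval r hr]
    · exact (hlt r hr).le

end MaxScalar

/-! ### Coordinate projections to `K` are linear in exponential charts -/

section Projections

variable {m : ℕ} {𝕜 : Type*} [RCLike 𝕜]
  {E H : Type*} [NormedAddCommGroup E] [NormedSpace ℝ E] [TopologicalSpace H]
  {E' H' : Type*} [NormedAddCommGroup E'] [NormedSpace ℝ E'] [TopologicalSpace H']
  {I : ModelWithCorners ℝ E H} {J : ModelWithCorners ℝ E' H'} [I.Boundaryless] [J.Boundaryless]
  {G : Type*} [TopologicalSpace G] [ChartedSpace H G] [Group G]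
  {T : Type*} [TopologicalSpace T] [ChartedSpace H' T] [Group T]

theorem IsLinearInCharts.id : IsLinearInCharts (modelK m 𝕜) (MonoidHom.id (GroupK m 𝕜)) (.id ℝ _) where
  contMDiff := contMDiff_id
  base := rfl
  map_symm _ := rfl
  map_mcChart := Filter.Eventually.of_forall fun _ _ => rfl

variable [LieGroup I ∞ G] [LieGroup J ∞ T]

theorem IsLinearInCharts.comp_fst {ρ : G →* GroupK m 𝕜} {dρ : E →L[ℝ] SkewLie m 𝕜}
    (hρ : IsLinearInCharts I ρ dρ) :
    IsLinearInCharts (I.prod J) (ρ.comp (MonoidHom.fst G T)) (dρ.comp (.fst ℝ E E')) where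
  contMDiff := hρ.contMDiff.comp contMDiff_fst
  base := by
    rw [extChartAt_prod]; exact hρ.base
  map_symm w := by
    rw [extChartAt_prod_symm_apply]; exact hρ.map_symm w.1
  map_mcChart := by
    have h0 : extChartAt (I.prod J) (1 : G × T) 1 =
        (extChartAt I (1 : G) 1, extChartAt J (1 : T) 1) := by
      rw [extChartAt_prod]; rfl
    have h1 := hρ.map_mcChart.prod_inl (𝓝 (extChartAt J (1 : T) 1))
    rw [← nhds_prod_eq, ← h0] at h1
    filter_upwards [h1, eventually_mcChart_prod (I := I) (J := J) (1 : G × T)] with w hw hw' X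
    rw [hw']
    exact hw X.1

theorem IsLinearInCharts.comp_snd {ρ : T →* GroupK m 𝕜} {dρ : E' →L[ℝ] SkewLie m 𝕜}
    (hρ : IsLinearInCharts J ρ dρ) :
    IsLinearInCharts (I.prod J) (ρ.comp (MonoidHom.snd G T)) (dρ.comp (.snd ℝ E E')) where
  contMDiff := hρ.contMDiff.comp contMDiff_snd
  base := by
    rw [extChartAt_prod]; exact hρ.base
  map_symm w := by
    rw [extChartAt_prod_symm_apply]; exact hρ.map_symm w.2
  map_mcChart := by
    have h0 : extChartAt (I.prod J) (1 : G × T) 1 =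
        (extChartAt I (1 : G) 1, extChartAt J (1 : T) 1) := by
      rw [extChartAt_prod]; rfl
    have h1 := hρ.map_mcChart.prod_inr (𝓝 (extChartAt I (1 : G) 1))
    rw [← nhds_prod_eq, ← h0] at h1
    filter_upwards [h1, eventually_mcChart_prod (I := I) (J := J) (1 : G × T)] with w hw hw' X
    rw [hw']
    exact hw X.2

end Projections

/-! ### The curvature estimate and the maximum sets on `K × K × H` -/

section TotalSpace

variable {m : ℕ} {𝕜 : Type*} [RCLike 𝕜]
  {E' H' : Type*} [NormedAddCommGroup E'] [NormedSpace ℝ E']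

/-- Write `N` for the sum of squared brackets on one factor. By invariance the double bracket sum is
`-N`, so each factor contributes `-N/4 + N/2 = N/4`, and the term with `lam` is nonpositive. The
total is at most `N/2`. -/
theorem scalar_totalForm_le {d e : ℕ} {B : SkewLie m 𝕜 →L[ℝ] SkewLie m 𝕜 →L[ℝ] ℝ}
    (had : ∀ Z X Y, B (brK m 𝕜 Z X) Y = -B X (brK m 𝕜 Z Y))
    {k : E' →L[ℝ] E' →L[ℝ] ℝ} (hk0 : ∀ a, 0 ≤ k a a)
    (lam : SkewLie m 𝕜 × SkewLie m 𝕜 →L[ℝ] E') (b : Module.Basis (Fin d) ℝ (SkewLie m 𝕜))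
    (c : Module.Basis (Fin e) ℝ E') {μ : ℝ}
    (hN : ∑ i, ∑ j, B (brK m 𝕜 (b i) (b j)) (brK m 𝕜 (b i) (b j)) ≤ 3 / 2 * (2 * d + 1) * μ) :
    -1 / 4 * ∑ i, ∑ j, totalForm (totalForm B B 0) k lam
        (brProd (brProd (brK m 𝕜) (brK m 𝕜)) 0 ((totalBasis (totalBasis b b 0) c lam) i) ((totalBasis (totalBasis b b 0) c lam) j))
        (brProd (brProd (brK m 𝕜) (brK m 𝕜)) 0 ((totalBasis (totalBasis b b 0) c lam) i) ((totalBasis (totalBasis b b 0) c lam) j)) -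
        1 / 2 * ∑ i, ∑ j, totalForm (totalForm B B 0) k lam
          (brProd (brProd (brK m 𝕜) (brK m 𝕜)) 0 ((totalBasis (totalBasis b b 0) c lam) i)
            (brProd (brProd (brK m 𝕜) (brK m 𝕜)) 0 ((totalBasis (totalBasis b b 0) c lam) i) ((totalBasis (totalBasis b b 0) c lam) j))) ((totalBasis (totalBasis b b 0) c lam) j) ≤
      3 / 4 * ((2 * d + 1) * μ) := by
  have e2 : ∑ i, ∑ j, B (brK m 𝕜 (b i) (brK m 𝕜 (b i) (b j))) (b j) =
      -∑ i, ∑ j, B (brK m 𝕜 (b i) (b j)) (brK m 𝕜 (b i) (b j)) := by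
    simp only [← Finset.sum_neg_distrib]
    exact Finset.sum_congr rfl fun i _ => Finset.sum_congr rfl fun j _ => had _ _ _
  rw [sum_total_bracket_sq, sum_total_bracket_bracket, sum_prod_bracket_sq,
    sum_prod_bracket_bracket, e2]
  have e3 : 0 ≤ ∑ i, ∑ j, k (lam (brProd (brK m 𝕜) (brK m 𝕜) ((totalBasis b b 0) i) ((totalBasis b b 0) j)))
      (lam (brProd (brK m 𝕜) (brK m 𝕜) ((totalBasis b b 0) i) ((totalBasis b b 0) j))) :=
    Finset.sum_nonneg fun i _ => Finset.sum_nonneg fun j _ => hk0 _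
  linarith

variable [FiniteDimensional ℝ E'] [TopologicalSpace H'] {J : ModelWithCorners ℝ E' H'}
  [J.Boundaryless] {T : Type*} [TopologicalSpace T] [ChartedSpace H' T] [CommGroup T] [LieGroup J ∞ T]

/-- For both projections to `K`, the scalar curvature of the conformally changed metric is
maximal on the kernel of the projection, with the same maximum. -/
theorem exists_maxScalarSet_eq (hm : 3 ≤ m) {B : SkewLie m 𝕜 →L[ℝ] SkewLie m 𝕜 →L[ℝ] ℝ}
    (hsymm : ∀ X Y, B X Y = B Y X) (hpos : ∀ X, X ≠ 0 → 0 < B X X)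
    (had : ∀ Z X Y, B (brK m 𝕜 Z X) Y = -B X (brK m 𝕜 Z Y))
    {k : E' →L[ℝ] E' →L[ℝ] ℝ} (hksymm : ∀ X Y, k X Y = k Y X) (hkpos : ∀ X, X ≠ 0 → 0 < k X X)
    (lam : SkewLie m 𝕜 × SkewLie m 𝕜 →L[ℝ] E') {ε : ℝ} (hε : 0 < ε) (hε' : ε < 1 / 8)
    (hdim : 2 ≤ Module.finrank ℝ E') :
    ∃ v : ℝ,
      (maxScalarSet (((modelK m 𝕜).prod (modelK m 𝕜)).prod J)
        (fun p : (GroupK m 𝕜 × GroupK m 𝕜) × T => classFun ε p.1.1 •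
          leftInvMetric (((modelK m 𝕜).prod (modelK m 𝕜)).prod J)
            (totalForm (totalForm B B 0) k lam) p) = {p | p.1.1 = 1} ∧
      ∀ p : (GroupK m 𝕜 × GroupK m 𝕜) × T, p.1.1 = 1 →
        scalarCurvature (((modelK m 𝕜).prod (modelK m 𝕜)).prod J) (fun p => classFun ε p.1.1 •
          leftInvMetric (((modelK m 𝕜).prod (modelK m 𝕜)).prod J)
            (totalForm (totalForm B B 0) k lam) p) p = v) ∧
      (maxScalarSet (((modelK m 𝕜).prod (modelK m 𝕜)).prod J)
        (fun p : (GroupK m 𝕜 × GroupK m 𝕜) × T => classFun ε p.1.2 •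
          leftInvMetric (((modelK m 𝕜).prod (modelK m 𝕜)).prod J)
            (totalForm (totalForm B B 0) k lam) p) = {p | p.1.2 = 1} ∧
      ∀ p : (GroupK m 𝕜 × GroupK m 𝕜) × T, p.1.2 = 1 →
        scalarCurvature (((modelK m 𝕜).prod (modelK m 𝕜)).prod J) (fun p => classFun ε p.1.2 •
          leftInvMetric (((modelK m 𝕜).prod (modelK m 𝕜)).prod J)
            (totalForm (totalForm B B 0) k lam) p) p = v) := by
  obtain ⟨d, b, hb⟩ : ∃ (d : ℕ) (b : Module.Basis (Fin d) ℝ (SkewLie m 𝕜)),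
      ∀ i j, B (b i) (b j) = if i = j then 1 else 0 := ⟨_, exists_orthonormal_basis hsymm hpos⟩
  obtain ⟨e, he, c, hc⟩ : ∃ (e : ℕ) (_ : 2 ≤ e) (c : Module.Basis (Fin e) ℝ E'),
      ∀ i j, k (c i) (c j) = if i = j then 1 else 0 :=
    ⟨_, hdim, exists_orthonormal_basis hksymm hkpos⟩
  obtain ⟨μ, hμ, hcas⟩ := exists_casimir hm hsymm had hb
  have hN := sum_bracket_sq_le hm had hb hμ hcas
  have hbb := totalForm_totalBasis (lam := 0) hb hb
  have hbt := totalForm_totalBasis (lam := lam) hbb hc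
  have hbrK : ∀ X Y, brK m 𝕜 X Y = -brK m 𝕜 Y X := by
    intro X Y
    refine inclMat_injective ?_
    rw [map_neg, inclMat_brK, inclMat_brK, neg_sub]
  have hskew := brProd_skew (brProd_skew hbrK hbrK) (br' := (0 : E' →L[ℝ] E' →L[ℝ] E')) (by simp)
  have huni0 : ∀ a, ∑ i, B (brK m 𝕜 a (b i)) (b i) = 0 := by
    intro a
    refine Finset.sum_eq_zero fun i _ => ?_
    have h1 := had a (b i) (b i)
    rw [hsymm (b i)] at h1
    linarith
  have huni := sum_total_unimodular (totalBasis b b 0) c (k := k) (lam := lam)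
    (sum_prod_unimodular b b huni0 huni0)
  have hMC : HasBracket (((modelK m 𝕜).prod (modelK m 𝕜)).prod J) ((GroupK m 𝕜 × GroupK m 𝕜) × T)
      (brProd (brProd (brK m 𝕜) (brK m 𝕜)) 0) :=
    (hasBracket_brK.prod hasBracket_brK).prod hasBracket_zero
  have htsymm := totalForm_symm (lam := lam) (totalForm_symm (lam := 0) hsymm hsymm) hksymm
  have htpos := totalForm_pos (lam := lam) (totalForm_pos (lam := 0) hpos hpos) hkpos
  have hk0 : ∀ a, 0 ≤ k a a := fun a => by
    by_cases h : a = 0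
    · simp [h]
    · exact (hkpos a h).le
  have hcard : Fintype.card ((Fin d ⊕ Fin d) ⊕ Fin e) =
      2 * d + e := by simp [two_mul]
  rw [Fintype.card_fin] at hN
  have hS := scalar_totalForm_le had hk0 lam b c hN
  have hcast : ((Fintype.card ((Fin d ⊕ Fin d) ⊕ Fin e) : ℕ) : ℝ) =
      2 * d + e := by rw [hcard]; push_cast; ring
  -- The fibre dimension is at least `2`, so `2d + 1` is at most the total dimension minus one.
  have hS' := hS.trans (show 3 / 4 * ((2 * d + 1) * μ) ≤ 3 / 4 *
      ((((Fintype.card ((Fin d ⊕ Fin d) ⊕ Fin e) : ℕ) : ℝ) - 1) * μ) by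
    have h2 : (2 : ℝ) ≤ e := by exact_mod_cast he
    rw [hcast]
    have := mul_le_mul_of_nonneg_right h2 hμ.le
    linarith)
  have hcard2 : 2 ≤ Fintype.card ((Fin d ⊕ Fin d) ⊕ Fin e) := by omega
  have hcas' : ∑ i, inclMat m 𝕜 (b i) * inclMat m 𝕜 (b i) = (-μ) • (1 : NormedMatrix m 𝕜) := hcas
  have hm0 : m ≠ 0 := by omega
  have hρ₁ : IsLinearInCharts (((modelK m 𝕜).prod (modelK m 𝕜)).prod J)
      (((MonoidHom.id (GroupK m 𝕜)).comp (MonoidHom.fst (GroupK m 𝕜) (GroupK m 𝕜))).comp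
        (MonoidHom.fst (GroupK m 𝕜 × GroupK m 𝕜) T)) _ :=
    IsLinearInCharts.id.comp_fst.comp_fst
  have hρ₂ : IsLinearInCharts (((modelK m 𝕜).prod (modelK m 𝕜)).prod J)
      (((MonoidHom.id (GroupK m 𝕜)).comp (MonoidHom.snd (GroupK m 𝕜) (GroupK m 𝕜))).comp
        (MonoidHom.fst (GroupK m 𝕜 × GroupK m 𝕜) T)) _ :=
    IsLinearInCharts.id.comp_snd.comp_fst
  -- The projection kills all basis vectors except those of one copy of the Lie algebra, so the sum
  -- of squares is the Casimir element of the standard representation.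
  have h1 := maxScalarSet_classFun hρ₁ hMC htsymm htpos hskew (totalBasis (totalBasis b b 0) c lam) hbt huni hε hε' hm0 hμ hcard2
    (by
      simp only [Fintype.sum_sum_type, totalBasis_inl, totalBasis_inr,
        ContinuousLinearMap.comp_apply, ContinuousLinearMap.coe_fst', map_zero, Prod.fst_zero,
        ContinuousLinearMap.id_apply, mul_zero, Finset.sum_const_zero, add_zero]
      exact hcas') rfl hS'
  have h2 := maxScalarSet_classFun hρ₂ hMC htsymm htpos hskew (totalBasis (totalBasis b b 0) c lam) hbt huni hε hε' hm0 hμ hcard2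
    (by
      simp only [Fintype.sum_sum_type, totalBasis_inl, totalBasis_inr,
        ContinuousLinearMap.comp_apply, ContinuousLinearMap.coe_fst', ContinuousLinearMap.coe_snd',
        zero_apply, neg_zero, map_zero, Prod.snd_zero, ContinuousLinearMap.id_apply, mul_zero,
        Finset.sum_const_zero, add_zero, zero_add]
      exact hcas') rfl hS'
  -- The maximum depends only on `ε`, `μ`, the dimension and the scalar curvature of the unscaled
  -- metric, so it is the same for both projections.
  exact ⟨_, h1, h2⟩

end TotalSpace

/-! ### The fibres over `1` as embedded submanifolds -/

section Embeddings

variable {m : ℕ} {𝕜 : Type*} [RCLike 𝕜]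

/-- The chart at `1` sends `1` to `0`, so in the preferred charts the map is literally `u ↦ (0, u)`;
swapping the factors gives the normal form of an immersion. -/
theorem isSmoothEmbedding_one_prodMk :
    Manifold.IsSmoothEmbedding (modelK m 𝕜) ((modelK m 𝕜).prod (modelK m 𝕜)) ∞
      (fun y : GroupK m 𝕜 => ((1 : GroupK m 𝕜), y)) where
  isImmersion := by
    refine Manifold.IsImmersionOfComplement.isImmersion (F := SkewLie m 𝕜) fun y => ?_
    refine Manifold.IsImmersionAtOfComplement.mk_of_continuousAt (by fun_prop)
      (ContinuousLinearEquiv.prodComm ℝ _ _) (chartAt _ y) (chartAt _ ((1 : GroupK m 𝕜), y))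
      (mem_chart_source _ _) (mem_chart_source _ _) (IsManifold.chart_mem_maximalAtlas y)
      (IsManifold.chart_mem_maximalAtlas _) ?_
    intro u hu
    have h1 := chartAt_self (1 : GroupK m 𝕜)
    have h2 := (chartAt (SkewLie m 𝕜) y).right_inv (x := u) (by simpa using hu)
    exact Prod.ext h1 h2
  isEmbedding := Topology.IsEmbedding.of_leftInverse (f := Prod.snd) (fun _ => rfl) continuous_snd
    (by fun_prop)

theorem isSmoothEmbedding_prodMk_one :
    Manifold.IsSmoothEmbedding (modelK m 𝕜) ((modelK m 𝕜).prod (modelK m 𝕜)) ∞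
      (fun x : GroupK m 𝕜 => (x, (1 : GroupK m 𝕜))) where
  isImmersion := by
    refine Manifold.IsImmersionOfComplement.isImmersion (F := SkewLie m 𝕜) fun x => ?_
    refine Manifold.IsImmersionAtOfComplement.mk_of_continuousAt (by fun_prop)
      (ContinuousLinearEquiv.refl ℝ _) (chartAt _ x) (chartAt _ (x, (1 : GroupK m 𝕜)))
      (mem_chart_source _ _) (mem_chart_source _ _) (IsManifold.chart_mem_maximalAtlas x)
      (IsManifold.chart_mem_maximalAtlas _) ?_
    intro u hu
    have h1 := chartAt_self (1 : GroupK m 𝕜)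
    have h2 := (chartAt (SkewLie m 𝕜) x).right_inv (x := u) (by simpa using hu)
    exact Prod.ext h2 h1
  isEmbedding := Topology.IsEmbedding.of_leftInverse (f := Prod.fst) (fun _ => rfl) continuous_fst
    (by fun_prop)

end Embeddings

/-! ### Local isometries between level sets of the scalar curvature -/

section Pullback

variable {E₁ H₁ E₂ H₂ E₃ H₃ : Type*} [NormedAddCommGroup E₁] [NormedSpace ℝ E₁]
  [TopologicalSpace H₁] [NormedAddCommGroup E₂] [NormedSpace ℝ E₂] [TopologicalSpace H₂]
  [NormedAddCommGroup E₃] [NormedSpace ℝ E₃] [TopologicalSpace H₃]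
  {I₁ : ModelWithCorners ℝ E₁ H₁} {I₂ : ModelWithCorners ℝ E₂ H₂} {I₃ : ModelWithCorners ℝ E₃ H₃}
  {M₁ : Type*} [TopologicalSpace M₁] [ChartedSpace H₁ M₁]
  {M₂ : Type*} [TopologicalSpace M₂] [ChartedSpace H₂ M₂]
  {M₃ : Type*} [TopologicalSpace M₃] [ChartedSpace H₃ M₃]

theorem pullbackMetric_comp {f : M₁ → M₂} {e : M₂ → M₃} {x : M₁}
    (he : MDifferentiableAt I₂ I₃ e (f x)) (hf : MDifferentiableAt I₁ I₂ f x)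
    (g : MetricField I₃ M₃) :
    pullbackMetric I₁ I₃ (e ∘ f) g x = pullbackMetric I₁ I₂ f (pullbackMetric I₂ I₃ e g) x := by
  refine ContinuousLinearMap.ext fun v => ContinuousLinearMap.ext fun w => ?_
  exact metricField_congr g rfl (mfderiv_comp_apply x he hf v) (mfderiv_comp_apply x he hf w)

theorem pullbackMetric_congr {f f' : M₁ → M₂} {x : M₁} (h : f =ᶠ[𝓝 x] f') (g : MetricField I₂ M₂) :
    pullbackMetric I₁ I₂ f g x = pullbackMetric I₁ I₂ f' g x := by
  have hd : (mfderiv I₁ I₂ f x : E₁ →L[ℝ] E₂) = (mfderiv I₁ I₂ f' x : E₁ →L[ℝ] E₂) := h.mfderiv_eq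
  refine ContinuousLinearMap.ext fun v => ContinuousLinearMap.ext fun w => ?_
  exact metricField_congr g h.self_of_nhds (congrArg (fun T : E₁ →L[ℝ] E₂ => T v) hd)
    (congrArg (fun T : E₁ →L[ℝ] E₂ => T w) hd)

theorem pullbackMetric_congr_metric {f : M₁ → M₂} {x : M₁} {g g' : MetricField I₂ M₂}
    (h : g (f x) = g' (f x)) :
    pullbackMetric I₁ I₂ f g x = pullbackMetric I₁ I₂ f g' x := by
  rw [pullbackMetric, h]; rfl

variable [FiniteDimensional ℝ E₁] [FiniteDimensional ℝ E₂] [I₁.Boundaryless] [I₂.Boundaryless]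
  [IsManifold I₁ ∞ M₁] [IsManifold I₂ ∞ M₂]

/-- A local isometry maps a level set of the scalar curvature to a level set; hence it induces
a local isometry between embedded level sets. -/
theorem exists_ricciNormSq_eq [Nonempty M₁] {g g' : MetricField I₂ M₂} (hg : IsSmoothMetric g)
    (hg' : IsSmoothMetric g') (hiso : IsLocallyIsometricTo I₂ I₂ g g')
    {j j' : M₁ → M₂} {r : M₂ → M₁} {s : ℝ} (hj : ContMDiff I₁ I₂ ∞ j) (hj' : ContMDiff I₁ I₂ ∞ j')
    (hr : ContMDiff I₂ I₁ ∞ r) (hjs : ∀ x, scalarCurvature I₂ g (j x) = s)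
    (hjs' : ∀ q, scalarCurvature I₂ g' q = s → j' (r q) = q)
    {g₀ g₀' : MetricField I₁ M₁} (h₀ : IsSmoothMetric g₀) (h₀' : IsSmoothMetric g₀')
    (hjg : pullbackMetric I₁ I₂ j g = g₀) (hjg' : pullbackMetric I₁ I₂ j' g' = g₀') :
    ∃ p q, ricciNormSq I₁ g₀ p = ricciNormSq I₁ g₀' q := by
  obtain ⟨p⟩ := ‹Nonempty M₁›
  obtain ⟨e, hpe, he, -, hpull⟩ := hiso (j p)
  have hsrc : ∀ᶠ x in 𝓝 p, j x ∈ e.source :=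
    hj.continuous.continuousAt.eventually (e.open_source.mem_nhds hpe)
  have heAt : ∀ y ∈ e.source, ContMDiffAt I₂ I₂ ∞ e y := fun y hy =>
    he.contMDiffAt (e.open_source.mem_nhds hy)
  -- The isometry `e` preserves scalar curvature, so it maps the image of `j` into the level `s` of
  -- `g'`, which lies in the image of `j'`. Hence `r ∘ e ∘ j` is a lift of `e ∘ j` through `j'`.
  have hF : ∀ x, j x ∈ e.source → j' (r (e (j x))) = e (j x) := by
    intro x hx
    refine hjs' _ ?_
    rw [← scalarCurvature_eq (heAt _ hx) hg.pos hg'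
      (Filter.eventually_of_mem (e.open_source.mem_nhds hx) hpull), hjs]
  have hFs : ∀ x, j x ∈ e.source → ContMDiffAt I₁ I₁ ∞ (r ∘ e ∘ j) x := fun x hx =>
    hr.contMDiffAt.comp x ((heAt _ hx).comp x hj.contMDiffAt)
  refine ⟨p, r (e (j p)), ricciNormSq_eq (F := r ∘ e ∘ j) (hFs p hpe) h₀.pos h₀' ?_⟩
  filter_upwards [hsrc, hsrc.eventually_nhds] with x hx hx'
  have hjd := hj.mdifferentiableAt (x := x) (by simp)
  rw [← hjg', ← pullbackMetric_comp (hj'.mdifferentiableAt (by simp))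
    ((hFs x hx).mdifferentiableAt (by simp)),
    pullbackMetric_congr (f := j' ∘ r ∘ e ∘ j) (f' := e ∘ j) (hx'.mono fun y hy => hF y hy),
    pullbackMetric_comp ((heAt _ hx).mdifferentiableAt (by simp)) hjd,
    pullbackMetric_congr_metric (hpull _ hx), hjg]

end Pullback

/-! ### Metrics induced on the fibres over `1` -/

section Fibres

variable {m : ℕ} {𝕜 : Type*} [RCLike 𝕜]
  {E' H' : Type*} [NormedAddCommGroup E'] [NormedSpace ℝ E']
  [TopologicalSpace H'] {J : ModelWithCorners ℝ E' H'}
  {T : Type*} [TopologicalSpace T] [ChartedSpace H' T] [Group T] [LieGroup J ∞ T]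

/-- On the Maurer-Cartan components the embedding is `(Y, Z) ↦ ((0, Y), Z)`, so only the restriction
of `lam` to the second summand survives. -/
theorem pullback_one_prodMk (B : SkewLie m 𝕜 →L[ℝ] SkewLie m 𝕜 →L[ℝ] ℝ)
    (k : E' →L[ℝ] E' →L[ℝ] ℝ) (lam : SkewLie m 𝕜 × SkewLie m 𝕜 →L[ℝ] E') :
    pullbackMetric ((modelK m 𝕜).prod J) (((modelK m 𝕜).prod (modelK m 𝕜)).prod J)
      (Prod.map (fun y : GroupK m 𝕜 => ((1 : GroupK m 𝕜), y)) (id : T → T))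
      (leftInvMetric (((modelK m 𝕜).prod (modelK m 𝕜)).prod J)
        (totalForm (totalForm B B 0) k lam)) =
    leftInvMetric ((modelK m 𝕜).prod J) (totalForm B k (lam.comp (.inr ℝ _ _))) := by
  funext p
  have hd : (mfderiv ((modelK m 𝕜).prod J) (((modelK m 𝕜).prod (modelK m 𝕜)).prod J)
      (Prod.map (fun y : GroupK m 𝕜 => ((1 : GroupK m 𝕜), y)) (id : T → T)) p :
      SkewLie m 𝕜 × E' →L[ℝ] (SkewLie m 𝕜 × SkewLie m 𝕜) × E') =
      (ContinuousLinearMap.inr ℝ (SkewLie m 𝕜) (SkewLie m 𝕜)).prodMap (.id ℝ E') := by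
    have h1 : MDifferentiableAt (modelK m 𝕜) ((modelK m 𝕜).prod (modelK m 𝕜))
        (fun y : GroupK m 𝕜 => ((1 : GroupK m 𝕜), y)) p.1 :=
      mdifferentiableAt_const.prodMk mdifferentiableAt_id
    have h2 : (mfderiv (modelK m 𝕜) ((modelK m 𝕜).prod (modelK m 𝕜))
        (fun y : GroupK m 𝕜 => ((1 : GroupK m 𝕜), y)) p.1 : SkewLie m 𝕜 →L[ℝ] _) =
        ContinuousLinearMap.inr ℝ (SkewLie m 𝕜) (SkewLie m 𝕜) := mfderiv_prod_right
    have h3 : (mfderiv J J (id : T → T) p.2 : E' →L[ℝ] E') = .id ℝ E' := mfderiv_id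
    refine (mfderiv_prodMap (p := p) h1 mdifferentiableAt_id).trans ?_
    exact congrArg₂ (fun (S : SkewLie m 𝕜 →L[ℝ] SkewLie m 𝕜 × SkewLie m 𝕜) (S' : E' →L[ℝ] E') =>
      S.prodMap S') h2 h3
  refine ContinuousLinearMap.ext fun v => ContinuousLinearMap.ext fun w => ?_
  have key : ∀ v : SkewLie m 𝕜 × E', mcForm (((modelK m 𝕜).prod (modelK m 𝕜)).prod J)
      (Prod.map (fun y : GroupK m 𝕜 => ((1 : GroupK m 𝕜), y)) (id : T → T) p)
      ((mfderiv ((modelK m 𝕜).prod J) (((modelK m 𝕜).prod (modelK m 𝕜)).prod J)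
      (Prod.map (fun y : GroupK m 𝕜 => ((1 : GroupK m 𝕜), y)) (id : T → T)) p :
      SkewLie m 𝕜 × E' →L[ℝ] (SkewLie m 𝕜 × SkewLie m 𝕜) × E') v) =
      ((0, mcForm (modelK m 𝕜) p.1 v.1), mcForm J p.2 v.2) := by
    intro v
    rw [hd, mcForm_prod, mcForm_prod]
    exact Prod.ext (Prod.ext (map_zero (mcForm (modelK m 𝕜) (1 : GroupK m 𝕜))) rfl) rfl
  change totalForm (totalForm B B 0) k lam (mcForm _ _ _) (mcForm _ _ _) = totalForm B k _
    (mcForm ((modelK m 𝕜).prod J) p v) (mcForm ((modelK m 𝕜).prod J) p w)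
  refine (congrArg₂ (fun a c => totalForm (totalForm B B 0) k lam a c) (key v) (key w)).trans ?_
  rw [mcForm_prod]
  simp [totalForm_apply]
  rfl

theorem pullback_prodMk_one (B : SkewLie m 𝕜 →L[ℝ] SkewLie m 𝕜 →L[ℝ] ℝ)
    (k : E' →L[ℝ] E' →L[ℝ] ℝ) (lam : SkewLie m 𝕜 × SkewLie m 𝕜 →L[ℝ] E') :
    pullbackMetric ((modelK m 𝕜).prod J) (((modelK m 𝕜).prod (modelK m 𝕜)).prod J)
      (Prod.map (fun x : GroupK m 𝕜 => (x, (1 : GroupK m 𝕜))) (id : T → T))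
      (leftInvMetric (((modelK m 𝕜).prod (modelK m 𝕜)).prod J)
        (totalForm (totalForm B B 0) k lam)) =
    leftInvMetric ((modelK m 𝕜).prod J) (totalForm B k (lam.comp (.inl ℝ _ _))) := by
  funext p
  have hd : (mfderiv ((modelK m 𝕜).prod J) (((modelK m 𝕜).prod (modelK m 𝕜)).prod J)
      (Prod.map (fun x : GroupK m 𝕜 => (x, (1 : GroupK m 𝕜))) (id : T → T)) p :
      SkewLie m 𝕜 × E' →L[ℝ] (SkewLie m 𝕜 × SkewLie m 𝕜) × E') =
      (ContinuousLinearMap.inl ℝ (SkewLie m 𝕜) (SkewLie m 𝕜)).prodMap (.id ℝ E') := by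
    have h1 : MDifferentiableAt (modelK m 𝕜) ((modelK m 𝕜).prod (modelK m 𝕜))
        (fun x : GroupK m 𝕜 => (x, (1 : GroupK m 𝕜))) p.1 :=
      mdifferentiableAt_id.prodMk mdifferentiableAt_const
    have h2 : (mfderiv (modelK m 𝕜) ((modelK m 𝕜).prod (modelK m 𝕜))
        (fun x : GroupK m 𝕜 => (x, (1 : GroupK m 𝕜))) p.1 : SkewLie m 𝕜 →L[ℝ] _) =
        ContinuousLinearMap.inl ℝ (SkewLie m 𝕜) (SkewLie m 𝕜) := mfderiv_prod_left
    have h3 : (mfderiv J J (id : T → T) p.2 : E' →L[ℝ] E') = .id ℝ E' := mfderiv_id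
    refine (mfderiv_prodMap (p := p) h1 mdifferentiableAt_id).trans ?_
    exact congrArg₂ (fun (S : SkewLie m 𝕜 →L[ℝ] SkewLie m 𝕜 × SkewLie m 𝕜) (S' : E' →L[ℝ] E') =>
      S.prodMap S') h2 h3
  refine ContinuousLinearMap.ext fun v => ContinuousLinearMap.ext fun w => ?_
  have key : ∀ v : SkewLie m 𝕜 × E', mcForm (((modelK m 𝕜).prod (modelK m 𝕜)).prod J)
      (Prod.map (fun x : GroupK m 𝕜 => (x, (1 : GroupK m 𝕜))) (id : T → T) p)
      ((mfderiv ((modelK m 𝕜).prod J) (((modelK m 𝕜).prod (modelK m 𝕜)).prod J)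
      (Prod.map (fun x : GroupK m 𝕜 => (x, (1 : GroupK m 𝕜))) (id : T → T)) p :
      SkewLie m 𝕜 × E' →L[ℝ] (SkewLie m 𝕜 × SkewLie m 𝕜) × E') v) =
      ((mcForm (modelK m 𝕜) p.1 v.1, 0), mcForm J p.2 v.2) := by
    intro v
    rw [hd, mcForm_prod, mcForm_prod]
    exact Prod.ext (Prod.ext rfl (map_zero (mcForm (modelK m 𝕜) (1 : GroupK m 𝕜)))) rfl
  change totalForm (totalForm B B 0) k lam (mcForm _ _ _) (mcForm _ _ _) = totalForm B k _
    (mcForm ((modelK m 𝕜).prod J) p v) (mcForm ((modelK m 𝕜).prod J) p w)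
  refine (congrArg₂ (fun a c => totalForm (totalForm B B 0) k lam a c) (key v) (key w)).trans ?_
  rw [mcForm_prod]
  simp [totalForm_apply]
  rfl

theorem classFun_one (ε : ℝ) (hm : m ≠ 0) : classFun ε (1 : GroupK m 𝕜) = Real.exp (2 * ε) := by
  rw [classFun_eq, reTr_one]
  have : (m : ℝ) ≠ 0 := Nat.cast_ne_zero.2 hm
  congr 1
  field_simp

end Fibres

end IsoConf

end

/-! ### The main theorem -/

theorem proposition4p7 {𝕜 : Type*} [RCLike 𝕜] {m : ℕ}
    -- `𝕜 ≅ ℝ`, `K = SO(m)`, `m ≥ 5`; or `𝕜 ≅ ℂ`, `K = SU(m)`, `m ≥ 3`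
    (hm : (Module.finrank ℝ 𝕜 = 1 ∧ 5 ≤ m) ∨ (Module.finrank ℝ 𝕜 = 2 ∧ 3 ≤ m))
    -- the two-dimensional torus `H`
    {H : Type*} [TopologicalSpace H] [ChartedSpace (EuclideanSpace ℝ (Fin 2)) H] [CommGroup H]
    [LieGroup (𝓡 2) ∞ H] [CompactSpace H] [ConnectedSpace H]
    -- the bi-invariant metric `h` on `K` and the invariant metric `k` on `H`
    (h : ContMDiffRiemannianMetric (modelK m 𝕜) ∞ (SkewLie m 𝕜)
      (fun x : GroupK m 𝕜 => TangentSpace (modelK m 𝕜) x))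
    (hl : IsLeftInvariant (modelK m 𝕜) h.inner) (hr : IsRightInvariant (modelK m 𝕜) h.inner)
    (k : ContMDiffRiemannianMetric (𝓡 2) ∞ (EuclideanSpace ℝ (Fin 2))
      (fun z : H => TangentSpace (𝓡 2) z))
    (hk : IsLeftInvariant (𝓡 2) k.inner)
    -- the linear maps `λ, λ'` with `λ'_Z ∈ Ad_K^* λ_Z` for every `Z`
    (lam lam' : GroupLieAlgebra (modelK m 𝕜) (GroupK m 𝕜) →L[ℝ] GroupLieAlgebra (𝓡 2) H)
    (hiso : ∀ Z : GroupLieAlgebra (𝓡 2) H, ∃ a : GroupK m 𝕜, ∀ X,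
      k.inner 1 (lam' X) Z = k.inner 1 (lam (Ad (modelK m 𝕜) a X)) Z)
    -- the metrics `g_λ, g_λ'` on `K × H`
    (gl gl' : MetricField ((modelK m 𝕜).prod (𝓡 2)) (GroupK m 𝕜 × H))
    (hgl : gl = metricOfForm (modelK m 𝕜) (𝓡 2) h.inner k.inner lam)
    (hgl' : gl' = metricOfForm (modelK m 𝕜) (𝓡 2) h.inner k.inner lam')
    (hric : ricciNormSq ((modelK m 𝕜).prod (𝓡 2)) gl ≠
      ricciNormSq ((modelK m 𝕜).prod (𝓡 2)) gl')
    (ε : ℝ) (hε : 0 < ε) (hε' : ε < 1 / 8)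
    -- the metrics `g_λ̄, φ̃₁ g_λ̄, φ̃₂ g_λ̄` on `K × K × H`
    (gbar g₁ g₂ : MetricField (((modelK m 𝕜).prod (modelK m 𝕜)).prod (𝓡 2))
      ((GroupK m 𝕜 × GroupK m 𝕜) × H))
    (hgbar : gbar = metricOfForm ((modelK m 𝕜).prod (modelK m 𝕜)) (𝓡 2)
      (prodMetric (modelK m 𝕜) (modelK m 𝕜) h.inner h.inner) k.inner
      (sumForm (modelK m 𝕜) (𝓡 2) lam lam'))
    (hg₁ : g₁ = fun p => classFun ε p.1.1 • gbar p)
    (hg₂ : g₂ = fun p => classFun ε p.1.2 • gbar p) :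
    ¬ IsLocallyIsometricTo (((modelK m 𝕜).prod (modelK m 𝕜)).prod (𝓡 2))
        (((modelK m 𝕜).prod (modelK m 𝕜)).prod (𝓡 2)) g₁ g₂ ∧
    ¬ IsLocallyIsometricTo (((modelK m 𝕜).prod (modelK m 𝕜)).prod (𝓡 2))
        (((modelK m 𝕜).prod (modelK m 𝕜)).prod (𝓡 2)) g₂ g₁ ∧
    (∃ ι : GroupK m 𝕜 × H → (GroupK m 𝕜 × GroupK m 𝕜) × H,
      Manifold.IsSmoothEmbedding ((modelK m 𝕜).prod (𝓡 2))
        (((modelK m 𝕜).prod (modelK m 𝕜)).prod (𝓡 2)) ∞ ι ∧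
      range ι = maxScalarSet (((modelK m 𝕜).prod (modelK m 𝕜)).prod (𝓡 2)) g₁ ∧
      pullbackMetric ((modelK m 𝕜).prod (𝓡 2)) (((modelK m 𝕜).prod (modelK m 𝕜)).prod (𝓡 2)) ι g₁ =
        fun p => Real.exp (2 * ε) • gl' p) ∧
    (∃ ι : GroupK m 𝕜 × H → (GroupK m 𝕜 × GroupK m 𝕜) × H,
      Manifold.IsSmoothEmbedding ((modelK m 𝕜).prod (𝓡 2))
        (((modelK m 𝕜).prod (modelK m 𝕜)).prod (𝓡 2)) ∞ ι ∧
      range ι = maxScalarSet (((modelK m 𝕜).prod (modelK m 𝕜)).prod (𝓡 2)) g₂ ∧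
      pullbackMetric ((modelK m 𝕜).prod (𝓡 2)) (((modelK m 𝕜).prod (modelK m 𝕜)).prod (𝓡 2)) ι g₂ =
        fun p => Real.exp (2 * ε) • gl p) ∧
    ∀ p q : GroupK m 𝕜 × H,
      ricciNormSq ((modelK m 𝕜).prod (𝓡 2)) (fun x => Real.exp (2 * ε) • gl' x) p ≠
        ricciNormSq ((modelK m 𝕜).prod (𝓡 2)) (fun x => Real.exp (2 * ε) • gl x) q := by
  have hm3 : 3 ≤ m := by omega
  have hm0 : m ≠ 0 := by omega
  let B : SkewLie m 𝕜 →L[ℝ] SkewLie m 𝕜 →L[ℝ] ℝ := h.inner 1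
  let k₀ : EuclideanSpace ℝ (Fin 2) →L[ℝ] EuclideanSpace ℝ (Fin 2) →L[ℝ] ℝ := k.inner 1
  let l : SkewLie m 𝕜 →L[ℝ] EuclideanSpace ℝ (Fin 2) := lam
  let l' : SkewLie m 𝕜 →L[ℝ] EuclideanSpace ℝ (Fin 2) := lam'
  have hB : ∀ X Y, B X Y = B Y X := h.symm 1
  have hBpos : ∀ X, X ≠ 0 → 0 < B X X := h.pos 1
  have hk₀ : ∀ X Y, k₀ X Y = k₀ Y X := k.symm 1
  have hkpos : ∀ X, X ≠ 0 → 0 < k₀ X X := k.pos 1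
  have had : ∀ Z X Y, B (brK m 𝕜 Z X) Y = -B X (brK m 𝕜 Z Y) := inner_brK hl hr
  have hh := eq_leftInvMetric hl
  have egl : gl = leftInvMetric ((modelK m 𝕜).prod (𝓡 2)) (totalForm B k₀ l) := by
    rw [hgl]
    exact (congrArg (fun h' => metricOfForm (modelK m 𝕜) (𝓡 2) h' k.inner lam) hh).trans
      (metricOfForm_eq _ _ _)
  have egl' : gl' = leftInvMetric ((modelK m 𝕜).prod (𝓡 2)) (totalForm B k₀ l') := by
    rw [hgl']
    exact (congrArg (fun h' => metricOfForm (modelK m 𝕜) (𝓡 2) h' k.inner lam') hh).trans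
      (metricOfForm_eq _ _ _)
  have egbar : gbar = leftInvMetric (((modelK m 𝕜).prod (modelK m 𝕜)).prod (𝓡 2))
      (totalForm (totalForm B B 0) k₀ (l.coprod l')) := by
    rw [hgbar]
    have e1 := (congrArg (fun h' => prodMetric (modelK m 𝕜) (modelK m 𝕜) h' h') hh).trans
      (prodMetric_eq _ _)
    exact (congrArg (fun h' => metricOfForm ((modelK m 𝕜).prod (modelK m 𝕜)) (𝓡 2) h' k.inner
      (sumForm (modelK m 𝕜) (𝓡 2) lam lam')) e1).trans (metricOfForm_eq _ _ _)
  have hs : ∀ l : SkewLie m 𝕜 →L[ℝ] EuclideanSpace ℝ (Fin 2), ∀ v w,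
      totalForm B k₀ l v w = totalForm B k₀ l w v := fun l => totalForm_symm hB hk₀
  have hp : ∀ l : SkewLie m 𝕜 →L[ℝ] EuclideanSpace ℝ (Fin 2), ∀ v, v ≠ 0 →
      0 < totalForm B k₀ l v v := fun l => totalForm_pos hBpos hkpos
  have hts := totalForm_symm (lam := l.coprod l') (totalForm_symm (lam := 0) hB hB) hk₀
  have htp := totalForm_pos (lam := l.coprod l') (totalForm_pos (lam := 0) hBpos hBpos) hkpos
  obtain ⟨v, ⟨hmax₁, hv₁⟩, hmax₂, hv₂⟩ := exists_maxScalarSet_eq (J := 𝓡 2) (T := H) hm3 hB hBpos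
    had hk₀ hkpos (l.coprod l') hε hε' (by simp)
  rw [← egbar, ← hg₁] at hmax₁ hv₁
  rw [← egbar, ← hg₂] at hmax₂ hv₂
  let j₁ : GroupK m 𝕜 × H → (GroupK m 𝕜 × GroupK m 𝕜) × H :=
    Prod.map (fun y : GroupK m 𝕜 => ((1 : GroupK m 𝕜), y)) (id : H → H)
  let j₂ : GroupK m 𝕜 × H → (GroupK m 𝕜 × GroupK m 𝕜) × H :=
    Prod.map (fun x : GroupK m 𝕜 => (x, (1 : GroupK m 𝕜))) (id : H → H)
  have hc₁ : l'  = (l.coprod l').comp (.inr ℝ _ _) := by ext1 X; simp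
  have hc₂ : l = (l.coprod l').comp (.inl ℝ _ _) := by ext1 X; simp
  have hpull₁ : pullbackMetric ((modelK m 𝕜).prod (𝓡 2))
      (((modelK m 𝕜).prod (modelK m 𝕜)).prod (𝓡 2)) j₁ g₁ = fun p => Real.exp (2 * ε) • gl' p := by
    have e1 := pullback_one_prodMk (J := 𝓡 2) (T := H) B k₀ (l.coprod l')
    rw [← egbar, ← hc₁, ← egl'] at e1
    rw [← e1, hg₁, ← classFun_one (𝕜 := 𝕜) ε hm0]
    rfl
  have hpull₂ : pullbackMetric ((modelK m 𝕜).prod (𝓡 2))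
      (((modelK m 𝕜).prod (modelK m 𝕜)).prod (𝓡 2)) j₂ g₂ = fun p => Real.exp (2 * ε) • gl p := by
    have e1 := pullback_prodMk_one (J := 𝓡 2) (T := H) B k₀ (l.coprod l')
    rw [← egbar, ← hc₂, ← egl] at e1
    rw [← e1, hg₂, ← classFun_one (𝕜 := 𝕜) ε hm0]
    rfl
  have hrange₁ : range j₁ = {p | p.1.1 = 1} := by
    ext ⟨⟨x, y⟩, z⟩
    constructor
    · rintro ⟨q, hq⟩
      exact (congrArg (fun p => p.1.1) hq).symm
    · intro hx
      exact ⟨(y, z), Prod.ext (Prod.ext (Eq.symm hx) rfl) rfl⟩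
  have hrange₂ : range j₂ = {p | p.1.2 = 1} := by
    ext ⟨⟨x, y⟩, z⟩
    constructor
    · rintro ⟨q, hq⟩
      exact (congrArg (fun p => p.1.2) hq).symm
    · intro hx
      exact ⟨(x, z), Prod.ext (Prod.ext rfl (Eq.symm hx)) rfl⟩
  have hemb₁ : Manifold.IsSmoothEmbedding ((modelK m 𝕜).prod (𝓡 2))
      (((modelK m 𝕜).prod (modelK m 𝕜)).prod (𝓡 2)) ∞ j₁ :=
    isSmoothEmbedding_one_prodMk.prodMap .id
  have hemb₂ : Manifold.IsSmoothEmbedding ((modelK m 𝕜).prod (𝓡 2))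
      (((modelK m 𝕜).prod (modelK m 𝕜)).prod (𝓡 2)) ∞ j₂ :=
    isSmoothEmbedding_prodMk_one.prodMap .id
  have hexp : (0 : ℝ) < Real.exp (2 * ε) := Real.exp_pos _
  have hne : ∀ p q : GroupK m 𝕜 × H,
      ricciNormSq ((modelK m 𝕜).prod (𝓡 2)) (fun x => Real.exp (2 * ε) • gl' x) p ≠
        ricciNormSq ((modelK m 𝕜).prod (𝓡 2)) (fun x => Real.exp (2 * ε) • gl x) q := by
    intro p q hpq
    rw [ricciNormSq_smul hexp.ne', ricciNormSq_smul hexp.ne'] at hpq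
    have hpq' := mul_left_cancel₀ (mul_ne_zero (inv_ne_zero hexp.ne') (inv_ne_zero hexp.ne')) hpq
    rw [egl, egl', ricciNormSq_leftInvMetric (hs l') (hp l'),
      ricciNormSq_leftInvMetric (hs l) (hp l)] at hpq'
    -- Both functions are constant by homogeneity, so equality at one pair of points makes them
    -- equal as functions.
    apply hric
    funext r
    rw [egl, egl', ricciNormSq_leftInvMetric (hs l') (hp l') r,
      ricciNormSq_leftInvMetric (hs l) (hp l) r, hpq']
  have hsm : ∀ l : SkewLie m 𝕜 →L[ℝ] EuclideanSpace ℝ (Fin 2),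
      IsSmoothMetric (I := (modelK m 𝕜).prod (𝓡 2)) (M := GroupK m 𝕜 × H)
        (fun x => Real.exp (2 * ε) • leftInvMetric ((modelK m 𝕜).prod (𝓡 2)) (totalForm B k₀ l) x) :=
    fun l => isSmoothMetric_smul_leftInvMetric (hs l) (hp l) contMDiff_const fun _ => hexp
  have hsgl := hsm l
  have hsgl' := hsm l'
  rw [← egl] at hsgl
  rw [← egl'] at hsgl'
  have hsg₁ : IsSmoothMetric g₁ := by
    rw [hg₁, egbar]
    exact isSmoothMetric_smul_leftInvMetric hts htp
      ((contMDiff_classFun ε).comp (contMDiff_fst.comp contMDiff_fst)) fun _ => classFun_pos ε _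
  have hsg₂ : IsSmoothMetric g₂ := by
    rw [hg₂, egbar]
    exact isSmoothMetric_smul_leftInvMetric hts htp
      ((contMDiff_classFun ε).comp (contMDiff_snd.comp contMDiff_fst)) fun _ => classFun_pos ε _
  -- A local isometry preserves the value of the scalar curvature, not the property of being a
  -- global maximum. The maximum set is therefore described as the level set of the common value
  -- `v`.
  have hlevel₁ : ∀ q, scalarCurvature (((modelK m 𝕜).prod (modelK m 𝕜)).prod (𝓡 2)) g₁ q = v →
      j₁ (q.1.2, q.2) = q := by
    intro q hq
    have hmem : q ∈ maxScalarSet (((modelK m 𝕜).prod (modelK m 𝕜)).prod (𝓡 2)) g₁ := by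
      have h1 : (1 : (GroupK m 𝕜 × GroupK m 𝕜) × H) ∈
          maxScalarSet (((modelK m 𝕜).prod (modelK m 𝕜)).prod (𝓡 2)) g₁ := by rw [hmax₁]; rfl
      intro r
      rw [hq, ← hv₁ 1 rfl]
      exact h1 r
    rw [hmax₁] at hmem
    exact Prod.ext (Prod.ext (Eq.symm hmem) rfl) rfl
  have hlevel₂ : ∀ q, scalarCurvature (((modelK m 𝕜).prod (modelK m 𝕜)).prod (𝓡 2)) g₂ q = v →
      j₂ (q.1.1, q.2) = q := by
    intro q hq
    have hmem : q ∈ maxScalarSet (((modelK m 𝕜).prod (modelK m 𝕜)).prod (𝓡 2)) g₂ := by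
      have h1 : (1 : (GroupK m 𝕜 × GroupK m 𝕜) × H) ∈
          maxScalarSet (((modelK m 𝕜).prod (modelK m 𝕜)).prod (𝓡 2)) g₂ := by rw [hmax₂]; rfl
      intro r
      rw [hq, ← hv₂ 1 rfl]
      exact h1 r
    rw [hmax₂] at hmem
    exact Prod.ext (Prod.ext rfl (Eq.symm hmem)) rfl
  refine ⟨fun hloc => ?_, fun hloc => ?_, ⟨j₁, hemb₁, hrange₁.trans hmax₁.symm, hpull₁⟩,
    ⟨j₂, hemb₂, hrange₂.trans hmax₂.symm, hpull₂⟩, hne⟩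
  -- The retraction drops the coordinate which equals `1` on the maximum set of the target metric.
  · obtain ⟨p, q, hpq⟩ := exists_ricciNormSq_eq hsg₁ hsg₂ hloc (r := fun q => (q.1.1, q.2))
      hemb₁.contMDiff hemb₂.contMDiff
      ((contMDiff_fst.comp contMDiff_fst).prodMk contMDiff_snd)
      (fun x => hv₁ (j₁ x) rfl) hlevel₂ hsgl' hsgl hpull₁ hpull₂
    exact hne p q hpq
  · obtain ⟨p, q, hpq⟩ := exists_ricciNormSq_eq hsg₂ hsg₁ hloc (r := fun q => (q.1.2, q.2))
      hemb₂.contMDiff hemb₁.contMDiff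
      ((contMDiff_snd.comp contMDiff_fst).prodMk contMDiff_snd)
      (fun x => hv₂ (j₂ x) rfl) hlevel₁ hsgl hsgl' hpull₂ hpull₁
    exact hne q p hpq.symm
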